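/- Let $m\ge 3$ be an odd integer and $n\ge 2$. Number $n+1$ qubits by $1,\dots,n+1$, let $X_j,Z_j$ be the Pauli operators on the $j$-th qubit, and put $Z_0=Z_{n+2}=1$. Let $H_j=Z_{j-1}X_jZ_{j+1}$ if $m\ge 5$ and $H_j=X_j$ if $m=3$, and for $1\le k\le l\le n+1$ let $S_{k,l}=H_kH_{k+1}\cdots H_l$. Let $\mathrm{NOT}_j$ be the gate that flips the $j$-th bit of a computational basis vector $|x_1\cdots x_{n+1}\rangle$ exactly when $x_{j-1}+x_{j+1}$ is odd (with $x_0=x_{n+2}=0$). Let $G$ be the subgroup of the unitary group of $(\mathbb C^2)^{\otimes(n+1)}$ generated by the operators $\exp(\pi i S_{k,l}/m)$, $1\le k\le l\le n+1$, and let $H$ be the subgroup generated by the operators $N_j$, $1\le j\le n+1$, where $N_j=\mathrm{NOT}_j$ if $m\ge 5$ and $N_j=Z_{j-1}Z_{j+1}\mathrm{NOT}_j$ if $m=3$. Put $\nu=-1$ if $m=3$ and $\nu=1$ if $m\ge5$, $c=\cos(\pi/m)$, $s=i\sin(\pi/m)$, and let $R_{Y_1}$ be the $8\times 8$ matrix $$\begin{pmatrix}\nu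 c&0&s&0\\0&-s&0&c\\s&0&\nu c&0\\0&c&0&-s\end{pmatrix}\oplus\begin{pmatrix}-s&0&c&0\\0&\nu c&0&s\\c&0&-s&0\\0&s&0&\nu c\end{pmatrix}$$ acting on $(\mathbb C^2)^{\otimes 3}$. Then $\sigma_i\mapsto I^{\otimes(i-1)}\otimes R_{Y_1}\otimes I^{\otimes(n-i-1)}$, $1\le i\le n-1$, defines a unitary representation $\rho_{R_{Y_1}}$ of the $n$-strand braid group $B_n$ on $(\mathbb C^2)^{\otimes(n+1)}$ (the qubit representation). Theorem. The group $H$ normalizes $G$ and $G\cap H=1$, so that $G$ and $H$ generate a semidirect product $G\rtimes H$, and $\rho_{R_{Y_1}}(B_n)\subseteq G\rtimes H$. Say that an element $U=AC$ with $A\in G$, $C\in H$ is described by an array of exponents $e_{k,l}\in\{0,\dots,2m-1\}$ with $A=\prod_{k\le l}\exp(\pi i S_{k,l}/m)^{e_{k,l}}$ (written in an $(n+1)\times(n+1)$ table) together with the Pauli operators $CX_jC^\dagger$ and $CZ_jC^\dagger$, $1\le j\le n+1$, each stored as a phase in $\{1,i,-1,-i\}$ and $2(n+1)$ bits. Then every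 element of $G\rtimes H$ has such a description, a description determines the element, and a description is a string of $O(n^2)$ symbols over a finite alphabet that depends only on $m$. For each fixed $m$ there is a Turing machine that, given $n$ and descriptions of two elements $U,U'\in G\rtimes H$, computes a description of $UU'$ in time polynomial in the length of the input, hence in $n$. Consequently there is a Turing machine that, given $n$ and a word of length $L$ in the generators $\sigma_i^{\pm1}$ of $B_n$, computes a description of the image of this braid under $\rho_{R_{Y_1}}$ in time polynomial in $n+L$. -/

import Mathlib

namespace QubitBraid

noncomputable section

/-! ### Qubits, Pauli operators and the gates -/

/-- Labels of the computational basis of `n + 1` qubits. -/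
abbrev Bits (n : ℕ) : Type := Fin (n + 1) → Fin 2

/-- Operators on `(ℂ²)^{⊗(n+1)}`, written in the computational basis. -/
abbrev Op (n : ℕ) : Type := Matrix (Bits n) (Bits n) ℂ

/-- The unitary group of `(ℂ²)^{⊗(n+1)}`. -/
abbrev UOp (n : ℕ) : Type := Matrix.unitaryGroup (Bits n) ℂ

/-- The bit `x_j`, where the qubits are numbered `1, …, n + 1`; it is `0` for every other `j`. -/
def bitAt {n : ℕ} (x : Bits n) (j : ℕ) : Fin 2 :=
  if h : 1 ≤ j ∧ j ≤ n + 1 then x ⟨j - 1, by omega⟩ else 0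

/-- Add `b` modulo `2` to the bit `x_j`. -/
def addBit {n : ℕ} (x : Bits n) (j : ℕ) (b : Fin 2) : Bits n :=
  fun a => if a.val + 1 = j then x a + b else x a

/-- The Pauli operator `X_j`. -/
def opX (n j : ℕ) : Op n :=
  Matrix.of fun y x => if y = addBit x j 1 then 1 else 0

/-- The Pauli operator `Z_j`; in particular `Z_0 = Z_{n+2} = 1`. -/
def opZ (n j : ℕ) : Op n :=
  Matrix.diagonal fun x => if bitAt x j = 0 then 1 else -1

/-- The XOR-controlled NOT gate: flip the qubit `j` iff the XOR of its two neighbours is `1`. -/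
def opNot (n j : ℕ) : Op n :=
  Matrix.of fun y x =>
    if y = addBit x j (bitAt x (j - 1) + bitAt x (j + 1)) then 1 else 0

/-- `H_j = Z_{j-1} X_j Z_{j+1}` for `m ≥ 5`, and `H_j = X_j` for `m = 3`. -/
def opH (m n j : ℕ) : Op n :=
  if m = 3 then opX n j else opZ n (j - 1) * opX n j * opZ n (j + 1)

/-- `S_{k,l} = H_k H_{k+1} ⋯ H_l`. -/
def opS (m n k l : ℕ) : Op n :=
  ((List.range' k (l + 1 - k)).map (opH m n)).prod

/-- `exp(π i S_{k,l} / m)`. -/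
def expS (m n k l : ℕ) : Op n :=
  NormedSpace.exp (((Real.pi : ℂ) * Complex.I / (m : ℂ)) • opS m n k l)

/-- The Clifford generators: `NOT_j` for `m ≥ 5`, and `Z_{j-1} Z_{j+1} NOT_j` for `m = 3`. -/
def cliffordGen (m n j : ℕ) : Op n :=
  if m = 3 then opZ n (j - 1) * opZ n (j + 1) * opNot n j else opNot n j

/-- The group `G`, generated by the `exp(π i S_{k,l} / m)` with `1 ≤ k ≤ l ≤ n + 1`. -/
def groupG (m n : ℕ) : Subgroup (UOp n) :=
  Subgroup.closure {u | ∃ k l, 1 ≤ k ∧ k ≤ l ∧ l ≤ n + 1 ∧ (u : Op n) = expS m n k l}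

/-- The group `H`, generated by the Clifford generators with `1 ≤ j ≤ n + 1`. -/
def groupH (m n : ℕ) : Subgroup (UOp n) :=
  Subgroup.closure {u | ∃ j, 1 ≤ j ∧ j ≤ n + 1 ∧ (u : Op n) = cliffordGen m n j}

/-- The (internal) semidirect product `G ⋊ H`: the group generated by `G` and `H`. That `H`
normalizes `G` and meets it trivially is part of the theorem. -/
def groupGH (m n : ℕ) : Subgroup (UOp n) := groupG m n ⊔ groupH m n

/-! ### The braid group and the qubit representation -/

/-- The relations of the Artin presentation of the braid group on `n` strands. -/
def braidRels (n : ℕ) : Set (FreeGroup (Fin (n - 1))) :=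
  {r | ∃ i j : Fin (n - 1), i.val + 1 = j.val ∧
      r = FreeGroup.of i * FreeGroup.of j * FreeGroup.of i *
        (FreeGroup.of j * FreeGroup.of i * FreeGroup.of j)⁻¹} ∪
  {r | ∃ i j : Fin (n - 1), i.val + 2 ≤ j.val ∧
      r = FreeGroup.of i * FreeGroup.of j * (FreeGroup.of j * FreeGroup.of i)⁻¹}

/-- The braid group on `n` strands. -/
abbrev BraidGroup (n : ℕ) : Type := PresentedGroup (braidRels n)

/-- The standard generator `σ_{i+1}` of the braid group (`i` counts from `0`). -/
def braidGen {n : ℕ} (i : Fin (n - 1)) : BraidGroup n := PresentedGroup.of i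

/-- The `8 × 8` matrix `R_{Y_1}`, in the basis `|000⟩, |001⟩, …, |111⟩`. -/
def matR (m : ℕ) : Matrix (Fin 8) (Fin 8) ℂ :=
  let ν : ℂ := if m = 3 then -1 else 1
  let c : ℂ := (Real.cos (Real.pi / m) : ℂ)
  let s : ℂ := Complex.I * (Real.sin (Real.pi / m) : ℂ)
  !![ν * c, 0, s, 0, 0, 0, 0, 0;
     0, -s, 0, c, 0, 0, 0, 0;
     s, 0, ν * c, 0, 0, 0, 0, 0;
     0, c, 0, -s, 0, 0, 0, 0;
     0, 0, 0, 0, -s, 0, c, 0;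
     0, 0, 0, 0, 0, ν * c, 0, s;
     0, 0, 0, 0, c, 0, -s, 0;
     0, 0, 0, 0, 0, s, 0, ν * c]

/-- The basis label of `|x_j x_{j+1} x_{j+2}⟩`. -/
def triple {n : ℕ} (x : Bits n) (j : ℕ) : Fin 8 :=
  ⟨4 * (bitAt x j).val + 2 * (bitAt x (j + 1)).val + (bitAt x (j + 2)).val, by omega⟩

/-- `I^{⊗(j-1)} ⊗ R_{Y_1} ⊗ I^{⊗(n-j-1)}`, that is, `R_{Y_1}` acting on the qubits
`j, j + 1, j + 2`. -/
def localR (m n j : ℕ) : Op n :=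
  Matrix.of fun y x =>
    if ∀ a : Fin (n + 1), a.val + 1 < j ∨ j + 2 < a.val + 1 → y a = x a then
      matR m (triple y j) (triple x j) else 0

/-- A braid word on `n` strands: the letter `(i, true)` is `σ_{i+1}` and the letter `(i, false)`
is its inverse. -/
abbrev BraidWord (n : ℕ) : Type := List (Fin (n - 1) × Bool)

/-- The braid given by a word. -/
def braidOf {n : ℕ} (w : BraidWord n) : BraidGroup n :=
  (w.map fun p => if p.2 then braidGen p.1 else (braidGen p.1)⁻¹).prod

/-! ### The classical description -/

/-- A product of Pauli operators with a phase, `i ^ phase * X ^ xBits * Z ^ zBits`. -/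
structure PauliWord (n : ℕ) where
  phase : Fin 4
  xBits : Bits n
  zBits : Bits n

/-- The operator that a `PauliWord` stands for. -/
def PauliWord.toOp {n : ℕ} (P : PauliWord n) : Op n :=
  (Complex.I ^ P.phase.val) •
    ((List.ofFn fun j : Fin (n + 1) => if P.xBits j = 1 then opX n (j.val + 1) else 1).prod *
      (List.ofFn fun j : Fin (n + 1) => if P.zBits j = 1 then opZ n (j.val + 1) else 1).prod)

/-- A description of `A * C` with `A` in `G` and `C` in `H`: an array of exponents of the
`exp(π i S_{k,l} / m)` (only the entries on or above the diagonal are used), and the images of the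
Pauli operators under conjugation by `C`. -/
structure Desc (m n : ℕ) where
  expo : Fin (n + 1) → Fin (n + 1) → Fin (2 * m)
  xImg : Fin (n + 1) → PauliWord n
  zImg : Fin (n + 1) → PauliWord n

/-- The product of the `exp(π i S_{k,l} / m) ^ e_{k,l}` over `1 ≤ k ≤ l ≤ n + 1`. -/
def expProd (m n : ℕ) (e : Fin (n + 1) → Fin (n + 1) → Fin (2 * m)) : Op n :=
  (List.ofFn fun k : Fin (n + 1) => (List.ofFn fun l : Fin (n + 1) =>
    if k ≤ l then expS m n (k.val + 1) (l.val + 1) ^ (e k l).val else 1).prod).prod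

/-- `d` is a description of `U`. -/
def Describes {m n : ℕ} (d : Desc m n) (U : UOp n) : Prop :=
  ∃ A ∈ groupG m n, ∃ C ∈ groupH m n, U = A * C ∧
    (A : Op n) = expProd m n d.expo ∧
    (∀ i : Fin (n + 1),
      (C : Op n) * opX n (i.val + 1) * star (C : Op n) = (d.xImg i).toOp) ∧
    (∀ i : Fin (n + 1),
      (C : Op n) * opZ n (i.val + 1) * star (C : Op n) = (d.zImg i).toOp)

/-! ### Strings -/

end

/-- The alphabet in which descriptions are written. -/
inductive Sym (m : ℕ) : Type
  | tick
  | sep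
  | expo (a : Fin (2 * m))
  | phase (p : Fin 4)
  | bit (b : Fin 2)
  deriving DecidableEq, Fintype

/-- Write down a `PauliWord`: its phase and its `2 (n + 1)` bits. -/
def encodePauli (m : ℕ) {n : ℕ} (P : PauliWord n) : List (Sym m) :=
  Sym.phase P.phase :: ((List.ofFn P.xBits).map Sym.bit ++ (List.ofFn P.zBits).map Sym.bit)

/-- Write down a description: `n` in unary, the exponents, and the images of the `X_i` and of the
`Z_i`. -/
def encodeDesc (m : ℕ) (d : Σ n, Desc m n) : List (Sym m) :=
  List.replicate d.1 Sym.tick ++ Sym.sep ::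
    ((List.finRange (d.1 + 1)).flatMap (fun k => (List.ofFn (d.2.expo k)).map Sym.expo) ++
      (List.finRange (d.1 + 1)).flatMap (fun i => encodePauli m (d.2.xImg i)) ++
      (List.finRange (d.1 + 1)).flatMap (fun i => encodePauli m (d.2.zImg i)))

/-- Write down two descriptions, one after the other. -/
def encodePair (m : ℕ) (p : Σ n, Desc m n × Desc m n) : List (Sym m) :=
  encodeDesc m ⟨p.1, p.2.1⟩ ++ encodeDesc m ⟨p.1, p.2.2⟩

/-- The alphabet in which braid words are written. -/
inductive BraidSym : Type
  | tick
  | sep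
  | letter (positive : Bool)
  deriving DecidableEq, Fintype

/-- Write down a braid word: `n` in unary, and then for every letter its index in unary and its
sign. -/
def encodeBraid (b : Σ n, BraidWord n) : List BraidSym :=
  List.replicate b.1 BraidSym.tick ++ BraidSym.sep ::
    b.2.flatMap fun p =>
      List.replicate (p.1.val + 1) BraidSym.tick ++ [BraidSym.letter p.2]

end QubitBraid

/-!
Label the computational basis by the bit strings `x` in `𝔽₂ ^ (n + 1)`, and conjugate everything by
the diagonal matrix of the signs `(-1) ^ q(x)`, where `q(x) = ∑ x_i` if `m = 3` and
`q(x) = ∑ x_i + ∑ x_i x_{i+1}` if `m ≥ 5`. Then, for every `m`, the operator `H_j` becomes minus the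
translation by the unit vector `e_j` (`opH_eq`), and the Clifford generator `N_j` becomes the
permutation matrix of the linear map `x ↦ x + (x_{j-1} + x_{j+1}) e_j` (`cliffordGen_eq`). Hence `H`
is a faithful image of the group generated by these maps (`groupH_eq`), which are the simple
reflections of type `A_{n+1}` modulo `2`. The operator `S_{k,l}` is, up to a sign, the translation by
the indicator of the interval `[k, l]`, so that its exponential is a rotation `cos + i sin S` in the
image of the commutative group algebra of the translations (`expS_eq`).

The reflections permute the indicators of intervals (`isIvl_reflect`), whence `H` normalizes `G`.
Elements of `G` commute with all translations, while a linear map that commutes with all translations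
is the identity, whence `G ∩ H = 1` (`groupG_inf_groupH`). As `G` is commutative and generated by
elements of order dividing `2 m`, tables of exponents describe all its elements; the images of the
Pauli operators determine the linear map that belongs to an element of `H` (`describes_iff`).

To multiply `A C` by `A' C'`, the factor `A'` is moved past `C`: its exponent at `[k, l]` is added, up
to a sign, at the interval that is the image of `[k, l]` under the linear map of `C`. This image is the
sum of the `X`-bits of the images of `X_k, …, X_l`, which can be accumulated while `l` runs through a
row of the table, and its endpoints are its first and its last `1` (`expA_innerE`,
`signedPerm_mul_rep_expA`). The Pauli operators are multiplied by substituting rows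
(`conjWord_canonX`, `conjWord_canonZ`). Both tasks need only scans over lists.

The algorithm is written in a small structured language of stack programs, whose semantics counts
steps and which is compiled to `Turing.FinTM2` (`StackProg.Exec.computable`). Every program comes with
a statement that describes its effect on the stacks together with an explicit polynomial time bound;
`mul_computable` and `braid_computable` are the results.

The image of a braid generator is `exp(π i S_{c,c} / m) ^ e N_c` with `c` the middle one of its three
qubits, and `e = 2` if `m = 3` and `e = 1` otherwise (`coe_genU`). The braid relation amounts to the
braid relation of the reflections together with the fact that both sides collect the rotations along
the three positive roots of an `A₂` system (`genU_braid`).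
-/

/-! ### A structured language for stack machines -/

namespace StackProg

open Turing

/-- Structured programs over stacks indexed by `K` with entries in `A`. -/
inductive Prog (K A : Type) : Type
  /-- Do nothing. -/
  | skip
  /-- Push `a` on the stack `k`. -/
  | push (k : K) (a : A)
  /-- Pop the stack `k` and continue according to what was found. -/
  | pop (k : K) (f : Option A → Prog K A)
  /-- Run one program after the other. -/
  | seq (p q : Prog K A)
  /-- As long as the top `a` of the stack `k` passes the test, pop it and run `body a`. -/
  | loop (k : K) (test : A → Bool) (body : A → Prog K A)

/-- Sequential composition. -/
infixr:60 " ;; " => Prog.seq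

variable {K A : Type}

section Semantics

variable [DecidableEq K]

/-- `Runs p s s' t`: started on the stacks `s`, the program `p` ends on the stacks `s'` after
exactly `t` steps of the machine that it compiles to. -/
inductive Runs : Prog K A → (K → List A) → (K → List A) → ℕ → Prop
  | skip (s) : Runs .skip s s 1
  | push (k a s) : Runs (.push k a) s (Function.update s k (a :: s k)) 1
  | pop {k f s s' t} (h : Runs (f (s k).head?) (Function.update s k (s k).tail) s' t) :
      Runs (.pop k f) s s' (t + 1)
  | seq {p q s s' s'' t t'} (h : Runs p s s' t) (h' : Runs q s' s'' t') :
      Runs (.seq p q) s s'' (t + t')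
  | loop_nil {k test body s} (h : s k = []) : Runs (.loop k test body) s s 1
  | loop_exit {k test body s a l} (h : s k = a :: l) (ha : test a = false) :
      Runs (.loop k test body) s s 1
  | loop_cons {k test body s a l s' s'' t t'} (h : s k = a :: l) (ha : test a = true)
      (hb : Runs (body a) (Function.update s k l) s' t)
      (hl : Runs (.loop k test body) s' s'' t') :
      Runs (.loop k test body) s s'' (t + t' + 1)

/-- `p` leads from the stacks `s` to the stacks `s'` in at most `T` steps. -/
def Exec (p : Prog K A) (s s' : K → List A) (T : ℕ) : Prop := ∃ t ≤ T, Runs p s s' t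

namespace Exec

variable {p q : Prog K A} {s s' s'' : K → List A} {T T' : ℕ} {k : K}

theorem mono (h : Exec p s s' T) (hT : T ≤ T') : Exec p s s' T' :=
  let ⟨t, ht, hr⟩ := h
  ⟨t, ht.trans hT, hr⟩

theorem skip : Exec (.skip : Prog K A) s s 1 := ⟨1, le_rfl, .skip s⟩

theorem push (a : A) : Exec (.push k a) s (Function.update s k (a :: s k)) 1 :=
  ⟨1, le_rfl, .push k a s⟩

theorem seq (h : Exec p s s' T) (h' : Exec q s' s'' T') : Exec (p ;; q) s s'' (T + T') :=
  let ⟨t, ht, hr⟩ := h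
  let ⟨t', ht', hr'⟩ := h'
  ⟨t + t', by omega, .seq hr hr'⟩

theorem pop_nil {f : Option A → Prog K A} (hk : s k = []) (h : Exec (f none) s s' T) :
    Exec (.pop k f) s s' (T + 1) := by
  obtain ⟨t, ht, hr⟩ := h
  refine ⟨t + 1, by omega, .pop ?_⟩
  have : Function.update s k (s k).tail = s := by simp [hk]
  rw [this]
  simpa [hk] using hr

theorem pop_cons {f : Option A → Prog K A} {a : A} {l : List A} (hk : s k = a :: l)
    (h : Exec (f (some a)) (Function.update s k l) s' T) :
    Exec (.pop k f) s s' (T + 1) := by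
  obtain ⟨t, ht, hr⟩ := h
  exact ⟨t + 1, by omega, .pop (by simpa [hk] using hr)⟩

theorem loop_nil {test : A → Bool} {body : A → Prog K A} (hk : s k = []) :
    Exec (.loop k test body) s s 1 := ⟨1, le_rfl, .loop_nil hk⟩

theorem loop_exit {test : A → Bool} {body : A → Prog K A} {l : List A} (hk : s k = l)
    (hl : ∀ a ∈ l.head?, test a = false) : Exec (.loop k test body) s s 1 := by
  cases l with
  | nil => exact loop_nil hk
  | cons a l => exact ⟨1, le_rfl, .loop_exit hk (hl a (by simp))⟩

theorem loop_cons {test : A → Bool} {body : A → Prog K A} {a : A} {l : List A}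
    (hk : s k = a :: l) (ha : test a = true)
    (hb : Exec (body a) (Function.update s k l) s' T)
    (hl : Exec (.loop k test body) s' s'' T') :
    Exec (.loop k test body) s s'' (T + T' + 1) :=
  let ⟨t, ht, hr⟩ := hb
  let ⟨t', ht', hr'⟩ := hl
  ⟨t + t' + 1, by omega, .loop_cons hk ha hr hr'⟩

end Exec

end Semantics

/-! ### Compilation to `FinTM2` -/

section Compile

/-- The control points of a program. -/
@[reducible] def Lab : Prog K A → Type
  | .skip => Unit
  | .push _ _ => Unit
  | .pop _ f => Unit ⊕ (Σ o, Lab (f o))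
  | .seq p q => Lab p ⊕ Lab q
  | .loop _ _ body => Unit ⊕ (Σ a, Lab (body a))

noncomputable instance Lab.fintype [Fintype A] : (p : Prog K A) → Fintype (Lab p)
  | .skip => inferInstanceAs (Fintype Unit)
  | .push _ _ => inferInstanceAs (Fintype Unit)
  | .pop _ f =>
    letI : ∀ o, Fintype (Lab (f o)) := fun o => Lab.fintype (f o)
    inferInstanceAs (Fintype (Unit ⊕ (Σ o, Lab (f o))))
  | .seq p q =>
    letI := Lab.fintype p
    letI := Lab.fintype q
    inferInstanceAs (Fintype (Lab p ⊕ Lab q))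
  | .loop _ _ body =>
    letI : ∀ a, Fintype (Lab (body a)) := fun a => Lab.fintype (body a)
    inferInstanceAs (Fintype (Unit ⊕ (Σ a, Lab (body a))))

/-- The first control point of a program. -/
def start : (p : Prog K A) → Lab p
  | .skip => ()
  | .push _ _ => ()
  | .pop _ _ => .inl ()
  | .seq p _ => .inl (start p)
  | .loop _ _ _ => .inl ()

/-- The stacks of the compiled machine: one extra stack for the input, in its own alphabet. -/
abbrev Stk (I A : Type) : Option K → Type
  | none => I
  | some _ => A

variable {I Λ : Type}

/-- The instructions at the control points of a program that is placed inside a machine with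
labels `Λ` by means of `emb` and continues at `next`. The internal state of the machine holds the
result of the last `pop`. -/
def code [Inhabited A] : (p : Prog K A) → (emb : Lab p → Λ) → (next : Λ) → Lab p →
    TM2.Stmt (Stk (K := K) I A) Λ (Option A)
  | .skip, _, next, _ => .goto fun _ => next
  | .push k a, _, next, _ => .push (some k) (fun _ => a) (.goto fun _ => next)
  | .pop k f, emb, _, .inl _ =>
      .pop (some k) (fun _ o => o) (.goto fun o => emb (.inr ⟨o, start (f o)⟩))
  | .pop _ f, emb, next, .inr ⟨o, l⟩ => code (f o) (fun l => emb (.inr ⟨o, l⟩)) next l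
  | .seq p q, emb, _, .inl l => code p (fun l => emb (.inl l)) (emb (.inr (start q))) l
  | .seq _ q, emb, next, .inr l => code q (fun l => emb (.inr l)) next l
  | .loop k test body, emb, next, .inl _ =>
      .pop (some k) (fun _ o => o)
        (.branch (fun o => o.elim false test)
          (.goto fun o => o.elim next fun a => emb (.inr ⟨a, start (body a)⟩))
          (.branch Option.isSome
            (.push (some k) (fun o => o.getD default) (.goto fun _ => next))
            (.goto fun _ => next)))
  | .loop _ _ body, emb, _, .inr ⟨a, l⟩ =>
      code (body a) (fun l => emb (.inr ⟨a, l⟩)) (emb (.inl ())) l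

/-- The stacks of the compiled machine, given the input stack and the stacks of the program. -/
def stk (i : List I) (s : K → List A) : ∀ k : Option K, List (Stk (K := K) I A k)
  | none => i
  | some k => s k

variable [DecidableEq K]

theorem update_stk (i : List I) (s : K → List A) (k : K) (l : List A) :
    Function.update (stk i s) (some k) l = stk i (Function.update s k l) := by
  refine Function.update_eq_iff.2 ⟨?_, ?_⟩
  · exact (Function.update_self k l s).symm
  · rintro (_ | j) hj
    · rfl
    · exact (Function.update_of_ne (fun h => hj (congrArg some h)) l s).symm

theorem update_stk_none (i i' : List I) (s : K → List A) :
    Function.update (stk i s) none i' = stk i' s := by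
  refine Function.update_eq_iff.2 ⟨rfl, ?_⟩
  rintro (_ | j) hj
  · exact absurd rfl hj
  · rfl

/-- `t` steps of a machine lead from one configuration to another. -/
def Steps (M : Λ → TM2.Stmt (Stk (K := K) I A) Λ (Option A)) (t : ℕ)
    (c c' : TM2.Cfg (Stk (K := K) I A) Λ (Option A)) : Prop :=
  (flip bind (TM2.step M))^[t] (some c) = some c'

theorem Steps.trans {M : Λ → TM2.Stmt (Stk (K := K) I A) Λ (Option A)} {t t' : ℕ}
    {c c' c'' : TM2.Cfg (Stk (K := K) I A) Λ (Option A)}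
    (h : Steps M t c c') (h' : Steps M t' c' c'') : Steps M (t + t') c c'' := by
  rw [Steps, Nat.add_comm, Function.iterate_add_apply, show _ = _ from h]
  exact h'

theorem Steps.one {M : Λ → TM2.Stmt (Stk (K := K) I A) Λ (Option A)}
    {c c' : TM2.Cfg (Stk (K := K) I A) Λ (Option A)} (h : TM2.step M c = some c') :
    Steps M 1 c c' := h

/-- A compiled program does what `Runs` says. -/
theorem Runs.steps [Inhabited A] {p : Prog K A} {s s' : K → List A} {t : ℕ}
    (h : Runs p s s' t) (M : Λ → TM2.Stmt (Stk (K := K) I A) Λ (Option A)) (i : List I) :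
    ∀ (emb : Lab p → Λ) (next : Λ) (_ : ∀ l, M (emb l) = code p emb next l) (v : Option A),
      ∃ v', Steps M t ⟨some (emb (start p)), v, stk i s⟩ ⟨some next, v', stk i s'⟩ := by
  induction h with
  | skip s =>
    intro emb next hM v
    refine ⟨v, Steps.one ?_⟩
    rw [TM2.step, hM]
    rfl
  | push k a s =>
    intro emb next hM v
    refine ⟨v, Steps.one ?_⟩
    rw [TM2.step, hM, ← update_stk]
    rfl
  | @pop k f s s' t h ih =>
    intro emb next hM v
    obtain ⟨v', hv⟩ := ih (fun l => emb (.inr ⟨(s k).head?, l⟩)) next (fun l => hM _) (s k).head?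
    refine ⟨v', ?_⟩
    rw [Nat.add_comm]
    refine (Steps.one ?_).trans hv
    rw [TM2.step, hM, ← update_stk]
    rfl
  | @seq p q s s' s'' t t' _ _ ih ih' =>
    intro emb next hM v
    obtain ⟨v', hv⟩ := ih (fun l => emb (.inl l)) (emb (.inr (start q))) (fun l => hM _) v
    obtain ⟨v'', hv'⟩ := ih' (fun l => emb (.inr l)) next (fun l => hM _) v'
    exact ⟨v'', hv.trans hv'⟩
  | @loop_nil k test body s h =>
    intro emb next hM v
    refine ⟨none, Steps.one ?_⟩
    have h1 : (stk i s (some k)) = [] := h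
    have h2 : Function.update (stk i s) (some k) [] = stk i s := by
      rw [← h1, Function.update_eq_self]
    rw [TM2.step, hM]
    show some (TM2.stepAux _ (stk i s (some k)).head?
      (Function.update (stk i s) (some k) (stk i s (some k)).tail)) = _
    rw [h1, List.tail_nil, h2]
    rfl
  | @loop_exit k test body s a l h ha =>
    intro emb next hM v
    refine ⟨some a, Steps.one ?_⟩
    have h1 : (stk i s (some k)) = a :: l := h
    rw [TM2.step, hM]
    show some (TM2.stepAux _ (stk i s (some k)).head?
      (Function.update (stk i s) (some k) (stk i s (some k)).tail)) = _
    rw [h1, List.tail_cons, update_stk]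
    simp only [List.head?_cons, TM2.stepAux, Option.elim, ha, cond_false, Option.isSome,
      cond_true, Option.getD]
    have h3 : stk i (Function.update s k l) (some k) = l := by simp [stk]
    rw [h3, update_stk, Function.update_idem, ← h, Function.update_eq_self]
  | @loop_cons k test body s a l s' s'' t t' h ha _ _ ih ih' =>
    intro emb next hM v
    have h1 : (stk i s (some k)) = a :: l := h
    obtain ⟨v', hv⟩ := ih (fun l => emb (.inr ⟨a, l⟩)) (emb (.inl ())) (fun l => hM _) (some a)
    obtain ⟨v'', hv'⟩ := ih' emb next hM v'
    refine ⟨v'', ?_⟩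
    rw [Nat.add_comm]
    refine (Steps.one ?_).trans (hv.trans hv')
    rw [TM2.step, hM]
    show some (TM2.stepAux _ (stk i s (some k)).head?
      (Function.update (stk i s) (some k) (stk i s (some k)).tail)) = _
    rw [h1, List.tail_cons, update_stk]
    simp only [List.head?_cons, TM2.stepAux, Option.elim, ha, cond_true]

/-- The machine that copies its input, translated by `tr` and in reversed order, to the stack
`kin` of the program `p`, and then runs `p`. The result is read from the stack `kout`. -/
noncomputable def machine [Fintype K] [Fintype A] [Inhabited A] (I : Type) [Fintype I] (tr : I → A)
    (p : Prog K A) (kin kout : K) : FinTM2 where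
  K := Option K
  k₀ := none
  k₁ := some kout
  Γ := Stk I A
  -- the label `none` halts; `some none` copies the input
  Λ := Option (Option (Lab p))
  main := some none
  ΛFin := inferInstance
  σ := Option A
  initialState := none
  σFin := inferInstance
  Γk₀Fin := inferInstanceAs (Fintype I)
  m
    | none => .load (fun _ => none) .halt
    | some none => .pop none (fun _ o => Option.map tr o)
        (.branch Option.isSome
          (.push (some kin) (fun o => o.getD default) (.goto fun _ => some none))
          (.goto fun _ => some (some (start p))))
    | some (some l) => code p (fun l => some (some l)) none l

theorem machine_copy [Fintype K] [Fintype A] [Inhabited A] {I : Type} [Fintype I] (tr : I → A)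
    (p : Prog K A) (kin kout : K) (x : List I) (v : Option A) (s : K → List A) :
    ∃ v', Steps (machine I tr p kin kout).m (x.length + 1) ⟨some (some none), v, stk x s⟩
      ⟨some (some (some (start p))), v',
        stk [] (Function.update s kin ((x.map tr).reverse ++ s kin))⟩ := by
  induction x generalizing v s with
  | nil =>
    refine ⟨none, Steps.one ?_⟩
    have h : Function.update s kin (([].map tr).reverse ++ s kin) = s := by simp
    rw [h]
    show some (TM2.stepAux _ none (Function.update (stk [] s) none [])) = _
    rw [update_stk_none]
    rfl
  | cons a x ih =>
    obtain ⟨v', hv⟩ := ih (some (tr a)) (Function.update s kin (tr a :: s kin))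
    refine ⟨v', ?_⟩
    rw [List.length_cons, Nat.add_comm (x.length + 1)]
    refine Steps.trans
      (c' := ⟨some (some none), some (tr a), stk x (Function.update s kin (tr a :: s kin))⟩)
      (Steps.one ?_) ?_
    · show some (TM2.stepAux _ (some (tr a)) (Function.update (stk (a :: x) s) none x)) = _
      rw [update_stk_none, ← update_stk]
      rfl
    · simp only [Function.update_self, Function.update_idem] at hv
      rw [List.map_cons, List.reverse_cons, List.append_assoc, List.singleton_append]
      exact hv

/-- A program that turns the reversed input into the output, with every other stack empty at the
beginning and at the end, and within a polynomial time bound, gives a Turing machine that runs in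
polynomial time. -/
theorem Exec.computable [Fintype K] [Fintype A] [Inhabited A] {I : Type} [Fintype I] (tr : I → A)
    (p : Prog K A) (kin kout : K) {α β : Type} (ea : α → List I) (eb : β → List A) (f : α → β)
    (T : Polynomial ℕ)
    (h : ∀ a, Exec p (Function.update (fun _ => []) kin ((ea a).map tr).reverse)
      (Function.update (fun _ => []) kout (eb (f a))) (T.eval (ea a).length)) :
    Nonempty (TM2ComputableInPolyTime ea eb f) := by
  have key : ∀ a, ∃ t ≤ (Polynomial.X + 2 + T).eval (ea a).length,
      Steps (machine I tr p kin kout).m t ⟨some (some none), none, stk (ea a) fun _ => []⟩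
        ⟨none, none, stk [] (Function.update (fun _ => []) kout (eb (f a)))⟩ := by
    intro a
    obtain ⟨v, hv⟩ := machine_copy tr p kin kout (ea a) none (fun _ => [])
    obtain ⟨t, ht, hr⟩ := h a
    obtain ⟨v', hv'⟩ := hr.steps (I := I) (machine I tr p kin kout).m [] (fun l => some (some l))
      none (fun l => rfl) v
    rw [List.append_nil] at hv
    refine ⟨_, ?_, (hv.trans hv').trans (Steps.one (c' := ⟨none, none, _⟩) rfl)⟩
    simp only [Polynomial.eval_add, Polynomial.eval_X, Polynomial.eval_ofNat]
    omega
  choose t ht hs using key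
  refine ⟨{ tm := machine I tr p kin kout
            inputAlphabet := Equiv.refl I
            outputAlphabet := Equiv.refl A
            time := Polynomial.X + 2 + T
            outputsFun := fun a => ⟨⟨t a, ?_⟩, ht a⟩ }⟩
  have h1 : initList (machine I tr p kin kout) (List.map (Equiv.refl I).invFun (ea a)) =
      (⟨some (some none), none, stk (ea a) fun _ => []⟩ :
        TM2.Cfg (Stk (K := K) I A) (Option (Option (Lab p))) (Option A)) := by
    refine TM2.Cfg.mk.injEq .. |>.mpr ⟨rfl, rfl, ?_⟩
    funext k
    cases k with
    | none => exact List.map_id _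
    | some k => rfl
  have h2 : haltList (machine I tr p kin kout) (List.map (Equiv.refl A).invFun (eb (f a))) =
      (⟨none, none, stk [] (Function.update (fun _ => []) kout (eb (f a)))⟩ :
        TM2.Cfg (Stk (K := K) I A) (Option (Option (Lab p))) (Option A)) := by
    refine TM2.Cfg.mk.injEq .. |>.mpr ⟨rfl, rfl, ?_⟩
    funext k
    cases k with
    | none => rfl
    | some k =>
      have h3 : stk (I := I) [] (Function.update (fun _ => []) kout (eb (f a))) (some k) =
        Function.update (fun _ => []) kout (eb (f a)) k := rfl
      rw [h3]
      by_cases hk : k = kout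
      · subst hk
        rw [Function.update_self]
        exact (dif_pos rfl).trans (List.map_id _)
      · rw [Function.update_of_ne hk]
        exact dif_neg fun h => hk (Option.some.inj h)
  show (flip bind (TM2.step (machine I tr p kin kout).m))^[t a] (some (initList _ _)) =
    some (haltList _ _)
  rw [h1, h2]
  exact hs a

end Compile

end StackProg

/-! ### The registers -/

namespace QubitBraid

open StackProg

/-- The stacks of the programs below. A primed name belongs to a copy of the stack without the
prime, into which it is moved when it is read, except for the two factors of a product. -/
inductive Reg
  /-- the input, read from its end -/
  | inp
  /-- the output -/
  | out
  /-- the number of qubits, in unary; a loop over the qubits moves it to `cnt'` -/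
  | cnt
  | cnt'
  /-- a second copy of the number of qubits, for loops inside such a loop -/
  | len
  | len'
  /-- the exponents of the first factor, and finally of the product -/
  | expo
  /-- the Pauli words of the first factor, and finally of the product -/
  | pauli
  /-- the exponents of the second factor -/
  | expo'
  /-- the Pauli words of the second factor -/
  | pauli'
  /-- the part of `pauli` that has been read, reversed -/
  | done
  /-- the accumulator for a sum of rows; a scan moves it to `acc'` -/
  | acc
  | acc'
  /-- the Pauli words of the product, reversed -/
  | res
  /-- the index of the current row, in unary, which counts the entries below the diagonal -/
  | skip
  | skip'
  /-- the exponent that is to be added to the table -/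
  | coef
  /-- the indicator of the first `1` of the accumulator -/
  | first
  | first'
  /-- the indicator of the last `1` of the accumulator -/
  | last
  | last'
  /-- the part of `expo` that has been updated, reversed -/
  | expoDone
  /-- the letters of a braid that have not been treated -/
  | word
  /-- the index of a braid generator, in unary -/
  | idx
  /-- the marks of the qubits that determine the description of a generator -/
  | marks
  /-- the marks that precede the current one -/
  | pre
  deriving DecidableEq

instance : Fintype Reg :=
  ⟨[.inp, .out, .cnt, .cnt', .len, .len', .expo, .pauli, .expo', .pauli', .done, .acc, .acc', .res,
    .skip, .skip', .coef, .first, .first', .last, .last', .expoDone, .word, .idx, .marks,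
    .pre].toFinset, fun k => by cases k <;> decide⟩

/-- The contents of all the stacks, as a record. -/
structure Regs (A : Type) where
  inp : List A
  out : List A
  cnt : List A
  cnt' : List A
  len : List A
  len' : List A
  expo : List A
  pauli : List A
  expo' : List A
  pauli' : List A
  done : List A
  acc : List A
  acc' : List A
  res : List A
  skip : List A
  skip' : List A
  coef : List A
  first : List A
  first' : List A
  last : List A
  last' : List A
  expoDone : List A
  word : List A
  idx : List A
  marks : List A
  pre : List A

namespace Regs

variable {A : Type}

/-- The content of a stack. -/
@[simp] def get (σ : Regs A) : Reg → List A
  | .inp => σ.inp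
  | .out => σ.out
  | .cnt => σ.cnt
  | .cnt' => σ.cnt'
  | .len => σ.len
  | .len' => σ.len'
  | .expo => σ.expo
  | .pauli => σ.pauli
  | .expo' => σ.expo'
  | .pauli' => σ.pauli'
  | .done => σ.done
  | .acc => σ.acc
  | .acc' => σ.acc'
  | .res => σ.res
  | .skip => σ.skip
  | .skip' => σ.skip'
  | .coef => σ.coef
  | .first => σ.first
  | .first' => σ.first'
  | .last => σ.last
  | .last' => σ.last'
  | .expoDone => σ.expoDone
  | .word => σ.word
  | .idx => σ.idx
  | .marks => σ.marks
  | .pre => σ.pre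

/-- Replace the content of a stack. -/
@[simp] def set (σ : Regs A) : Reg → List A → Regs A
  | .inp, x => { σ with inp := x }
  | .out, x => { σ with out := x }
  | .cnt, x => { σ with cnt := x }
  | .cnt', x => { σ with cnt' := x }
  | .len, x => { σ with len := x }
  | .len', x => { σ with len' := x }
  | .expo, x => { σ with expo := x }
  | .pauli, x => { σ with pauli := x }
  | .expo', x => { σ with expo' := x }
  | .pauli', x => { σ with pauli' := x }
  | .done, x => { σ with done := x }
  | .acc, x => { σ with acc := x }
  | .acc', x => { σ with acc' := x }
  | .res, x => { σ with res := x }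
  | .skip, x => { σ with skip := x }
  | .skip', x => { σ with skip' := x }
  | .coef, x => { σ with coef := x }
  | .first, x => { σ with first := x }
  | .first', x => { σ with first' := x }
  | .last, x => { σ with last := x }
  | .last', x => { σ with last' := x }
  | .expoDone, x => { σ with expoDone := x }
  | .word, x => { σ with word := x }
  | .idx, x => { σ with idx := x }
  | .marks, x => { σ with marks := x }
  | .pre, x => { σ with pre := x }

/-- All stacks are empty. -/
def empty : Regs A :=
  ⟨[], [], [], [], [], [], [], [], [], [], [], [], [], [], [], [], [], [], [], [], [], [], [], [],
    [], []⟩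

theorem get_set_self (σ : Regs A) (k : Reg) (x : List A) : (σ.set k x).get k = x := by
  cases k <;> rfl

theorem get_set_ne (σ : Regs A) {j k : Reg} (h : j ≠ k) (x : List A) :
    (σ.set k x).get j = σ.get j := by
  cases k <;> cases j <;> first | rfl | exact absurd rfl h

theorem ext_get {σ τ : Regs A} (h : σ.get = τ.get) : σ = τ := by
  cases σ; cases τ
  simp only [Regs.mk.injEq]
  exact ⟨congrFun h .inp, congrFun h .out, congrFun h .cnt, congrFun h .cnt', congrFun h .len,
    congrFun h .len', congrFun h .expo, congrFun h .pauli, congrFun h .expo', congrFun h .pauli',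
    congrFun h .done, congrFun h .acc, congrFun h .acc', congrFun h .res, congrFun h .skip,
    congrFun h .skip', congrFun h .coef, congrFun h .first, congrFun h .first', congrFun h .last,
    congrFun h .last', congrFun h .expoDone, congrFun h .word, congrFun h .idx, congrFun h .marks,
    congrFun h .pre⟩

theorem update_get (σ : Regs A) (k : Reg) (x : List A) :
    Function.update σ.get k x = (σ.set k x).get := by
  refine Function.update_eq_iff.2 ⟨(get_set_self σ k x).symm, fun j hj => (get_set_ne σ hj x).symm⟩

theorem get_empty : (empty : Regs A).get = fun _ => [] := by
  funext k; cases k <;> rfl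

theorem set_get_self (σ : Regs A) (k : Reg) : σ.set k (σ.get k) = σ := by
  cases k <;> rfl

end Regs

/-- `p` leads from the stacks `σ` to the stacks `τ` in at most `T` steps. -/
def ExecR {A : Type} (p : Prog Reg A) (σ τ : Regs A) (T : ℕ) : Prop := Exec p σ.get τ.get T

namespace ExecR

variable {A : Type} {p q : Prog Reg A} {σ τ υ : Regs A} {T T' : ℕ} {k : Reg}

theorem congr (h : ExecR p σ τ T) (hs : τ = υ) (hT : T ≤ T') : ExecR p σ υ T' :=
  hs ▸ h.mono hT

theorem skip : ExecR (.skip : Prog Reg A) σ σ 1 := Exec.skip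

theorem push (k : Reg) (a : A) (σ : Regs A) :
    ExecR (.push k a) σ (σ.set k (a :: σ.get k)) 1 := by
  rw [ExecR, ← Regs.update_get]; exact Exec.push a

theorem seq (h : ExecR p σ τ T) (h' : ExecR q τ υ T') : ExecR (p ;; q) σ υ (T + T') :=
  Exec.seq h h'

theorem pop_nil {f : Option A → Prog Reg A} (hk : σ.get k = []) (h : ExecR (f none) σ τ T) :
    ExecR (.pop k f) σ τ (T + 1) := Exec.pop_nil hk h

theorem pop_cons {f : Option A → Prog Reg A} {a : A} {l : List A} (hk : σ.get k = a :: l)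
    (h : ExecR (f (some a)) (σ.set k l) τ T) : ExecR (.pop k f) σ τ (T + 1) :=
  Exec.pop_cons hk (by rw [Regs.update_get]; exact h)

theorem loop_nil {test : A → Bool} {body : A → Prog Reg A} (hk : σ.get k = []) :
    ExecR (.loop k test body) σ σ 1 := Exec.loop_nil hk

theorem loop_exit {test : A → Bool} {body : A → Prog Reg A} {l : List A} (hk : σ.get k = l)
    (hl : ∀ a ∈ l.head?, test a = false) : ExecR (.loop k test body) σ σ 1 :=
  Exec.loop_exit hk hl

theorem loop_cons {test : A → Bool} {body : A → Prog Reg A} {a : A} {l : List A}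
    (hk : σ.get k = a :: l) (ha : test a = true) (hb : ExecR (body a) (σ.set k l) τ T)
    (hl : ExecR (.loop k test body) τ υ T') : ExecR (.loop k test body) σ υ (T + T' + 1) :=
  Exec.loop_cons hk ha (by rw [Regs.update_get]; exact hb) hl

end ExecR

/-- The test that always succeeds. -/
def always {A : Type} : A → Bool := fun _ => true

/-- Move the stack `j` to the stack `k`, thereby reversing it. -/
def move {A : Type} (j k : Reg) : Prog Reg A := .loop j always fun a => .push k a

theorem exec_move {A : Type} {j k : Reg} (hjk : j ≠ k) (σ : Regs A) :
    ExecR (move j k) σ ((σ.set j []).set k ((σ.get j).reverse ++ σ.get k))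
      (2 * (σ.get j).length + 1) := by
  generalize hl : σ.get j = l
  induction l generalizing σ with
  | nil =>
    refine (ExecR.loop_nil hl).congr ?_ (by simp)
    have h1 : σ.set j [] = σ := by rw [← hl, Regs.set_get_self]
    rw [h1, List.reverse_nil, List.nil_append, Regs.set_get_self]
  | cons a l ih =>
    refine (ExecR.loop_cons hl rfl (ExecR.push k a _) (ih _ ?_)).congr ?_ ?_
    · rw [Regs.get_set_ne _ hjk, Regs.get_set_self]
    · apply Regs.ext_get
      simp only [← Regs.update_get, Function.update_self, List.reverse_cons, List.append_assoc,
        List.singleton_append, Function.update_of_ne hjk.symm]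
      funext i
      simp only [Function.update_apply]
      split_ifs <;> rfl
    · simp only [List.length_cons]; omega

/-- Empty the stack `k`. -/
def clear {A : Type} (k : Reg) : Prog Reg A := .loop k always fun _ => .skip

theorem exec_clear {A : Type} (k : Reg) (σ : Regs A) :
    ExecR (clear k) σ (σ.set k []) (2 * (σ.get k).length + 1) := by
  generalize hl : σ.get k = l
  induction l generalizing σ with
  | nil =>
    refine (ExecR.loop_nil hl).congr ?_ (by simp)
    rw [← hl, Regs.set_get_self]
  | cons a l ih =>
    refine (ExecR.loop_cons hl rfl ExecR.skip (ih _ (Regs.get_set_self ..))).congr ?_ ?_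
    · apply Regs.ext_get
      simp only [← Regs.update_get, Function.update_idem]
    · simp only [List.length_cons]; omega

end QubitBraid

/-! ### Words and tables as lists of symbols -/

namespace QubitBraid

open StackProg

variable {m : ℕ}

instance : Inhabited (Sym m) := ⟨.tick⟩

/-- A phase and a string of bits. -/
abbrev LWord : Type := Fin 4 × List (Fin 2)

/-- A table of exponents, as the list of its rows. -/
abbrev LTable (m : ℕ) : Type := List (List (Fin (2 * m)))

/-- Write down a string of bits. -/
def bitsS (m : ℕ) (l : List (Fin 2)) : List (Sym m) := l.map Sym.bit

/-- Write down a word. -/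
def wordS (m : ℕ) (w : LWord) : List (Sym m) := Sym.phase w.1 :: bitsS m w.2

/-- Write down several words. -/
def wordsS (m : ℕ) (ws : List LWord) : List (Sym m) := ws.flatMap (wordS m)

/-- Write down a table row by row. -/
def tableS (e : LTable m) : List (Sym m) := e.flatMap fun r => r.map Sym.expo

/-- Add `b` times the second string to the first one, which is continued by zeros. -/
def addBits (b : Fin 2) : List (Fin 2) → List (Fin 2) → List (Fin 2)
  | _, [] => []
  | [], c :: cs => b * c :: addBits b [] cs
  | x :: xs, c :: cs => (x + b * c) :: addBits b xs cs

/-- Add `b` times the second word to the first one. -/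
def addLWord (b : Fin 2) (v w : LWord) : LWord :=
  (if b = 1 then v.1 + w.1 else v.1, addBits b v.2 w.2)

/-- Add to `v` those rows that are selected by the bits. -/
def foldRows : LWord → List (Fin 2) → List LWord → LWord
  | v, b :: bs, r :: rs => foldRows (addLWord b v r) bs rs
  | v, _, _ => v

/-- Keep the first `1` of a string and replace everything else by `0`. -/
def firstOne : List (Fin 2) → List (Fin 2)
  | [] => []
  | b :: l => if b = 0 then 0 :: firstOne l else 1 :: l.map fun _ => 0

/-- Keep the last `1` of a string and replace everything else by `0`. -/
def lastOne (l : List (Fin 2)) : List (Fin 2) := (firstOne l.reverse).reverse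

/-- Negate `c` once for every `1` in the string. -/
def signed (l : List (Fin 2)) (c : Fin (2 * m)) : Fin (2 * m) :=
  l.foldl (fun c b => if b = 1 then -c else c) c

/-- Add `c` to one row of a table wherever the bit of `t` is set. -/
def addRowL (c : Fin (2 * m)) (si : Fin 2) (t : List (Fin 2)) (r : List (Fin (2 * m))) :
    List (Fin (2 * m)) :=
  List.zipWith (fun tj x => if si = 1 ∧ tj = 1 then x + c else x) t r

/-- Add the table `c s tᵀ` to a table. -/
def rankOne (c : Fin (2 * m)) (s t : List (Fin 2)) (e : LTable m) : LTable m :=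
  List.zipWith (fun si r => addRowL c si t r) s e

/-- Run through rows `r_a, r_{a+1}, …` of bits together with exponents: the sum `v` of the rows so
far determines the entry of the table to which the exponent, with a sign, is added. The sign is the
parity of the number `p / 2` of these rows plus the weight of `v`. -/
def innerL : Fin 4 → List (Fin 2) → LTable m → List (List (Fin 2) × Fin (2 * m)) → LTable m
  | _, _, e, [] => e
  | p, v, e, (r, c) :: l =>
    innerL (p + 2) (addBits 1 v r)
      (rankOne (signed (addBits 1 v r) (if p + 2 = 2 then -c else c)) (firstOne (addBits 1 v r))
        (lastOne (addBits 1 v r)) e) l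

/-- Apply `innerL` to the part of every row of a table that lies on or above the diagonal. -/
def outerL : ℕ → LTable m → List (List (Fin 2)) → LTable m → LTable m
  | _, e, _, [] => e
  | k, e, rs, er :: ers => outerL (k + 1) (innerL 0 [] e (rs.zip (er.drop k))) rs.tail ers

@[simp] theorem addBits_length (b : Fin 2) (xs cs : List (Fin 2)) :
    (addBits b xs cs).length = cs.length := by
  induction cs generalizing xs with
  | nil => cases xs <;> rfl
  | cons c cs ih => cases xs <;> simp [addBits, ih]

@[simp] theorem firstOne_length (l : List (Fin 2)) : (firstOne l).length = l.length := by
  induction l with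
  | nil => rfl
  | cons b l ih => rw [firstOne]; split_ifs <;> simp [ih]

@[simp] theorem lastOne_length (l : List (Fin 2)) : (lastOne l).length = l.length := by
  simp [lastOne]

@[simp] theorem bitsS_length (l : List (Fin 2)) : (bitsS m l).length = l.length := by simp [bitsS]

/-! ### Programs for the multiplication of Pauli words -/

/-- Recognize a bit. -/
def isBit : Sym m → Bool
  | .bit _ => true
  | _ => false

/-- Add `b` times the second symbol to the first one. -/
def addSym (b : Fin 2) : Option (Sym m) → Sym m → Sym m
  | some (.bit x), .bit c => .bit (x + b * c)
  | _, .bit c => .bit (b * c)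
  | some (.phase p), .phase q => .phase (if b = 1 then p + q else p)
  | _, y => y

/-- Move the symbol `y` of a row to `done` and add `b` times it to the next symbol of the
accumulator. -/
def addStep (b : Fin 2) (y : Sym m) : Prog Reg (Sym m) :=
  .pop .acc fun o => .push .done y ;; .push .acc' (addSym b o y)

/-- Move the first row of `pauli`, whose first symbol is `q`, to `done`, and add `b` times it to the
accumulator. -/
def addRow (b : Fin 2) (q : Sym m) : Prog Reg (Sym m) :=
  addStep b q ;; .loop .pauli isBit (addStep b) ;; move .acc' .acc

theorem exec_addStep_loop (b : Fin 2) (rest : List (Sym m))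
    (hrest : ∀ a ∈ rest.head?, isBit a = false) (cs : List (Fin 2)) :
    ∀ (xs : List (Fin 2)) (σ : Regs (Sym m)), σ.pauli = bitsS m cs ++ rest →
      σ.acc = bitsS m xs → xs.length ≤ cs.length →
      ExecR (.loop .pauli isBit (addStep b)) σ
        { σ with
          pauli := rest
          done := (bitsS m cs).reverse ++ σ.done
          acc := []
          acc' := (bitsS m (addBits b xs cs)).reverse ++ σ.acc' } (4 * cs.length + 1) := by
  induction cs with
  | nil =>
    intro xs σ hp ha hl
    obtain rfl : xs = [] := by simpa using hl
    refine ExecR.congr (ExecR.loop_exit hp hrest) ?_ (by simp)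
    simp only [bitsS, List.map_nil, List.nil_append] at hp ha
    rw [← hp, ← ha]
    rfl
  | cons c cs ih =>
    intro xs σ hp ha hl
    cases xs with
    | nil =>
      refine ExecR.congr (ExecR.loop_cons hp rfl
        (ExecR.pop_nil ha (ExecR.seq (ExecR.push ..) (ExecR.push ..)))
        (ih [] _ rfl ha (by simp))) ?_ ?_
      · simp [bitsS, addBits, addSym]
      · simp only [List.length_cons]; omega
    | cons x xs =>
      refine ExecR.congr (ExecR.loop_cons hp rfl
        (ExecR.pop_cons ha (ExecR.seq (ExecR.push ..) (ExecR.push ..)))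
        (ih xs _ rfl rfl (by simpa using hl))) ?_ ?_
      · simp [bitsS, addBits, addSym]
      · simp only [List.length_cons]; omega

theorem exec_addRow (b : Fin 2) (rest : List (Sym m))
    (hrest : ∀ a ∈ rest.head?, isBit a = false) (v r : LWord) (σ : Regs (Sym m))
    (hp : σ.pauli = bitsS m r.2 ++ rest) (ha : σ.acc = wordS m v) (hl : v.2.length ≤ r.2.length)
    (ha' : σ.acc' = []) :
    ExecR (addRow b (.phase r.1)) σ
      { σ with
        pauli := rest
        done := (wordS m r).reverse ++ σ.done
        acc := wordS m (addLWord b v r) } (6 * r.2.length + 10) := by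
  refine ExecR.congr (ExecR.seq (ExecR.pop_cons ha
    (ExecR.seq (ExecR.push ..) (ExecR.push ..)))
    (ExecR.seq (exec_addStep_loop b rest hrest r.2 v.2 _ hp rfl hl)
      (exec_move (by decide) _))) ?_ ?_
  · simp [wordS, addLWord, ha', addSym]
  · simp [ha']; omega

/-- Add to the accumulator those rows of `pauli` that are selected by the bits at the top of
`pauli'`. -/
def addRows : Prog Reg (Sym m) :=
  .loop .pauli' isBit fun b => .pop .pauli fun o => o.elim .skip
    (addRow (if b = .bit 1 then 1 else 0))

theorem head?_wordsS (ws : List LWord) : ∀ a ∈ (wordsS m ws).head?, isBit a = false := by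
  cases ws <;> simp [wordsS, wordS, isBit]

@[simp] theorem addLWord_length (b : Fin 2) (v w : LWord) :
    (addLWord b v w).2.length = w.2.length := by
  simp [addLWord]

theorem exec_addRows (L : ℕ) (rest : List (Sym m)) (hrest : ∀ a ∈ rest.head?, isBit a = false)
    (bs : List (Fin 2)) :
    ∀ (rs : List LWord) (v : LWord) (σ : Regs (Sym m)), bs.length = rs.length →
      (∀ r ∈ rs, r.2.length = L) → v.2.length ≤ L →
      σ.pauli' = bitsS m bs ++ rest → σ.pauli = wordsS m rs → σ.acc = wordS m v → σ.acc' = [] →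
      ExecR addRows σ
        { σ with
          pauli' := rest
          pauli := []
          done := (wordsS m rs).reverse ++ σ.done
          acc := wordS m (foldRows v bs rs) } (bs.length * (6 * L + 12) + 1) := by
  induction bs with
  | nil =>
    intro rs v σ hlen hrs hv hb hp ha ha'
    obtain rfl : rs = [] := by simpa using hlen.symm
    refine ExecR.congr (ExecR.loop_exit hb hrest) ?_ (by simp)
    cases σ
    simp_all [bitsS, wordsS, foldRows]
  | cons b bs ih =>
    intro rs v σ hlen hrs hv hb hp ha ha'
    cases rs with
    | nil => simp at hlen
    | cons r rs =>
      have hr : r.2.length = L := hrs r (by simp)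
      have hsym : (if (Sym.bit b : Sym m) = .bit 1 then (1 : Fin 2) else 0) = b := by
        fin_cases b <;> simp
      refine ExecR.congr (ExecR.loop_cons hb rfl
        (ExecR.pop_cons hp
          (exec_addRow (if (Sym.bit b : Sym m) = .bit 1 then 1 else 0) (wordsS m rs)
            (head?_wordsS rs) v r _ rfl ha (hv.trans hr.ge) ha'))
        (ih rs _ _ (by simpa using hlen) (fun r hr => hrs r (by simp [hr])) ?_ rfl rfl rfl ha'))
        ?_ ?_
      · simp [hr]
      · rw [hsym]
        simp [wordsS, foldRows]
      · simp only [List.length_cons, hr]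
        ring_nf; omega

/-- The word `w` with every bit replaced by the corresponding row, multiplied out. -/
def conjLWord (rs : List LWord) (w : LWord) : LWord := foldRows (w.1, []) w.2 rs

/-- Replace the words in `pauli'` by their images; the result is left in `res`, in reversed
order. -/
def mulPauli : Prog Reg (Sym m) :=
  .loop .pauli' always fun q =>
    .push .acc q ;; addRows ;; move .done .pauli ;; move .acc .res

@[simp] theorem wordS_length (w : LWord) : (wordS m w).length = w.2.length + 1 := by
  simp [wordS]

theorem wordsS_length (L : ℕ) (ws : List LWord) (h : ∀ w ∈ ws, w.2.length = L) :
    (wordsS m ws).length = ws.length * (L + 1) := by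
  induction ws with
  | nil => simp [wordsS]
  | cons w ws ih =>
    have := ih fun w hw => h w (by simp [hw])
    simp only [wordsS, List.flatMap_cons, List.length_append, wordS_length, List.length_cons] at *
    rw [this, h w (by simp)]; ring

theorem foldRows_length (L : ℕ) (bs : List (Fin 2)) (rs : List LWord) (v : LWord)
    (hv : v.2.length ≤ L) (h : ∀ r ∈ rs, r.2.length = L) : (foldRows v bs rs).2.length ≤ L := by
  induction bs generalizing rs v with
  | nil => simpa [foldRows] using hv
  | cons b bs ih =>
    cases rs with
    | nil => simpa [foldRows] using hv
    | cons r rs =>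
      rw [foldRows]
      exact ih _ _ (by simp [h r (by simp)]) fun r hr => h r (by simp [hr])

theorem exec_mulPauli (L : ℕ) (rs : List LWord) (hrs : ∀ r ∈ rs, r.2.length = L)
    (ws : List LWord) :
    ∀ (σ : Regs (Sym m)), (∀ w ∈ ws, w.2.length = rs.length) →
      σ.pauli' = wordsS m ws → σ.pauli = wordsS m rs → σ.done = [] → σ.acc = [] → σ.acc' = [] →
      ExecR mulPauli σ
        { σ with
          pauli' := []
          res := (wordsS m (ws.map (conjLWord rs))).reverse ++ σ.res }
        (ws.length * (rs.length * (8 * L + 14) + 2 * L + 8) + 1) := by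
  induction ws with
  | nil =>
    intro σ _ hp' hp hd ha ha'
    refine ExecR.congr (ExecR.loop_nil hp') ?_ (by simp)
    cases σ
    simp_all [wordsS]
  | cons w ws ih =>
    intro σ hws hp' hp hd ha ha'
    have hw : w.2.length = rs.length := hws w (by simp)
    have hfold := foldRows_length L w.2 rs (w.1, []) (by simp) hrs
    have h1 : ExecR addRows
        { σ with pauli' := bitsS m w.2 ++ wordsS m ws, acc := [.phase w.1] }
        { σ with
          pauli' := wordsS m ws
          pauli := []
          done := (wordsS m rs).reverse ++ σ.done
          acc := wordS m (conjLWord rs w) } _ :=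
      exec_addRows L (wordsS m ws) (head?_wordsS ws) w.2 rs (w.1, []) _ hw hrs (by simp) rfl hp rfl
        ha'
    have h2 : ExecR (move .done .pauli ;; move .acc .res)
        { σ with
          pauli' := wordsS m ws
          pauli := []
          done := (wordsS m rs).reverse ++ σ.done
          acc := wordS m (conjLWord rs w) }
        { σ with
          pauli' := wordsS m ws
          res := (wordS m (conjLWord rs w)).reverse ++ σ.res } (rs.length * (2 * L + 2) + 2 * L +
            4) := by
      refine ExecR.congr (ExecR.seq (exec_move (by decide) _) (exec_move (by decide) _)) ?_ ?_
      · cases σ; simp_all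
      · simp only [Regs.get, Regs.set, List.length_append, List.length_reverse, hd, List.length_nil,
          wordsS_length L rs hrs, wordS_length, conjLWord]
        nlinarith
    have h3 := ih { σ with
          pauli' := wordsS m ws
          res := (wordS m (conjLWord rs w)).reverse ++ σ.res }
        (fun w hw => hws w (by simp [hw])) rfl hp hd ha ha'
    have hp'' : σ.pauli' = Sym.phase w.1 :: (bitsS m w.2 ++ wordsS m ws) := hp'
    refine ExecR.congr (ExecR.loop_cons hp'' rfl
      (ExecR.seq (ExecR.congr (ExecR.push ..) (by simp [ha]) le_rfl) (ExecR.seq h1 h2)) h3) ?_ ?_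
    · simp [wordsS]
    · simp only [List.length_cons, hw]
      ring_nf; omega

end QubitBraid

namespace QubitBraid

open StackProg

variable {m : ℕ}

/-! ### Programs for the exponents -/

/-- Write down ticks. -/
def ticks (m k : ℕ) : List (Sym m) := List.replicate k .tick

/-- Unroll one round of a loop that is followed by another program. -/
theorem exec_seq_loop_cons {A : Type} {k : Reg} {test : A → Bool} {body : A → Prog Reg A}
    {q : Prog Reg A} {a : A} {l : List A} {σ τ υ : Regs A} {T T' : ℕ}
    (hk : σ.get k = a :: l) (ha : test a = true) (hb : ExecR (body a) (σ.set k l) τ T)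
    (hl : ExecR (.loop k test body ;; q) τ υ T') :
    ExecR (.loop k test body ;; q) σ υ (T + T' + 1) := by
  obtain ⟨t, ht, hr⟩ := hl
  obtain ⟨u, hu, hr'⟩ := hb
  cases hr with
  | @seq _ _ _ ρ _ t₁ t₂ h₁ h₂ =>
    refine ⟨u + t₁ + 1 + t₂, by omega, .seq (.loop_cons hk ha ?_ h₁) h₂⟩
    rw [Regs.update_get]
    exact hr'

/-- Scan the string in `acc` (or, for `f = false`, in `acc'`), moving it to `acc'` (or to `acc`),
and write its first `1` to the stack `first'` (or to `last`). -/
def scanOne (f : Bool) : Prog Reg (Sym m) :=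
  .loop (if f then .acc else .acc') (fun y => decide (y = .bit 0)) (fun y =>
    .push (if f then .acc' else .acc) y ;; .push (if f then .first' else .last) (.bit 0)) ;;
  .pop (if f then .acc else .acc') (fun o => o.elim .skip fun y =>
    .push (if f then .acc' else .acc) y ;; .push (if f then .first' else .last) (.bit 1)) ;;
  .loop (if f then .acc else .acc') always (fun y =>
    .push (if f then .acc' else .acc) y ;; .push (if f then .first' else .last) (.bit 0))

theorem exec_scan_rest_acc (l : List (Fin 2)) : ∀ (σ : Regs (Sym m)), σ.acc = bitsS m l →
    ExecR (.loop .acc always (fun y => .push .acc' y ;; .push .first' (.bit 0))) σ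
      { σ with
        acc := []
        acc' := (bitsS m l).reverse ++ σ.acc'
        first' := (bitsS m (l.map fun _ => 0)).reverse ++ σ.first' } (3 * l.length + 1) := by
  induction l with
  | nil =>
    intro σ h
    refine ExecR.congr (ExecR.loop_nil h) ?_ (by simp)
    cases σ; simp_all [bitsS]
  | cons b l ih =>
    intro σ h
    refine ExecR.congr (ExecR.loop_cons h rfl (ExecR.seq (ExecR.push ..) (ExecR.push ..))
      (ih _ rfl)) ?_ ?_
    · simp [bitsS]
    · simp only [List.length_cons]; omega

theorem exec_scan_rest_acc' (l : List (Fin 2)) : ∀ (σ : Regs (Sym m)), σ.acc' = bitsS m l →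
    ExecR (.loop .acc' always (fun y => .push .acc y ;; .push .last (.bit 0))) σ
      { σ with
        acc' := []
        acc := (bitsS m l).reverse ++ σ.acc
        last := (bitsS m (l.map fun _ => 0)).reverse ++ σ.last } (3 * l.length + 1) := by
  induction l with
  | nil =>
    intro σ h
    refine ExecR.congr (ExecR.loop_nil h) ?_ (by simp)
    cases σ; simp_all [bitsS]
  | cons b l ih =>
    intro σ h
    refine ExecR.congr (ExecR.loop_cons h rfl (ExecR.seq (ExecR.push ..) (ExecR.push ..))
      (ih _ rfl)) ?_ ?_
    · simp [bitsS]
    · simp only [List.length_cons]; omega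

theorem ExecR.ite_pos {A : Type} {c : Prop} [Decidable c] {p q : Prog Reg A} {σ τ : Regs A}
    {T : ℕ} (h : c) (hp : ExecR p σ τ T) : ExecR (if c then p else q) σ τ T := by
  rwa [if_pos h]

theorem ExecR.ite_neg {A : Type} {c : Prop} [Decidable c] {p q : Prog Reg A} {σ τ : Regs A}
    {T : ℕ} (h : ¬c) (hq : ExecR q σ τ T) : ExecR (if c then p else q) σ τ T := by
  rwa [if_neg h]

theorem exec_scanOne_acc (l : List (Fin 2)) : ∀ (σ : Regs (Sym m)), σ.acc = bitsS m l →
    ExecR (scanOne true) σ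
      { σ with
        acc := []
        acc' := (bitsS m l).reverse ++ σ.acc'
        first' := (bitsS m (firstOne l)).reverse ++ σ.first' } (3 * l.length + 5) := by
  induction l with
  | nil =>
    intro σ h
    refine ExecR.congr (ExecR.seq (ExecR.loop_nil h)
      (ExecR.seq (ExecR.pop_nil h ExecR.skip) (ExecR.loop_nil h))) ?_ (by simp)
    cases σ; simp_all [bitsS, firstOne]
  | cons b l ih =>
    intro σ h
    have hb : b = 0 ∨ b = 1 := by fin_cases b <;> simp
    obtain rfl | rfl := hb
    · refine ExecR.congr (exec_seq_loop_cons h (by simp)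
        (ExecR.seq (ExecR.push ..) (ExecR.push ..)) (ih _ rfl)) ?_ ?_
      · simp [bitsS, firstOne]
      · simp only [List.length_cons]; omega
    · refine ExecR.congr (ExecR.seq (ExecR.loop_exit h (by simp [bitsS]))
        (ExecR.seq (ExecR.pop_cons h (ExecR.seq (ExecR.push ..) (ExecR.push ..)))
          (exec_scan_rest_acc l _ rfl))) ?_ ?_
      · simp [bitsS, firstOne]
      · simp only [List.length_cons]; omega

theorem exec_scanOne_acc' (l : List (Fin 2)) : ∀ (σ : Regs (Sym m)), σ.acc' = bitsS m l →
    ExecR (scanOne false) σ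
      { σ with
        acc' := []
        acc := (bitsS m l).reverse ++ σ.acc
        last := (bitsS m (firstOne l)).reverse ++ σ.last } (3 * l.length + 5) := by
  induction l with
  | nil =>
    intro σ h
    refine ExecR.congr (ExecR.seq (ExecR.loop_nil h)
      (ExecR.seq (ExecR.pop_nil h ExecR.skip) (ExecR.loop_nil h))) ?_ (by simp)
    cases σ; simp_all [bitsS, firstOne]
  | cons b l ih =>
    intro σ h
    have hb : b = 0 ∨ b = 1 := by fin_cases b <;> simp
    obtain rfl | rfl := hb
    · refine ExecR.congr (exec_seq_loop_cons h (by simp)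
        (ExecR.seq (ExecR.push ..) (ExecR.push ..)) (ih _ rfl)) ?_ ?_
      · simp [bitsS, firstOne]
      · simp only [List.length_cons]; omega
    · refine ExecR.congr (ExecR.seq (ExecR.loop_exit h (by simp [bitsS]))
        (ExecR.seq (ExecR.pop_cons h (ExecR.seq (ExecR.push ..) (ExecR.push ..)))
          (exec_scan_rest_acc' l _ rfl))) ?_ ?_
      · simp [bitsS, firstOne]
      · simp only [List.length_cons]; omega

/-- Negate an exponent. -/
def negSym : Sym m → Sym m
  | .expo c => .expo (-c)
  | y => y

/-- Negate the exponent in `coef` once for every `1` in `acc`. -/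
def signPass : Prog Reg (Sym m) :=
  .loop .acc always (fun y => .push .acc' y ;;
    if y = .bit 1 then .pop .coef fun o => o.elim .skip fun c => .push .coef (negSym c)
    else .skip) ;;
  move .acc' .acc

theorem exec_signPass_loop (l : List (Fin 2)) : ∀ (c : Fin (2 * m)) (σ : Regs (Sym m)),
    σ.acc = bitsS m l → σ.coef = [.expo c] →
    ExecR (.loop .acc always (fun y => .push .acc' y ;;
      if y = .bit 1 then .pop .coef fun o => o.elim .skip fun c => .push .coef (negSym c)
      else .skip)) σ
      { σ with
        acc := []
        acc' := (bitsS m l).reverse ++ σ.acc'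
        coef := [.expo (signed l c)] } (4 * l.length + 1) := by
  induction l with
  | nil =>
    intro c σ h hc
    refine ExecR.congr (ExecR.loop_nil h) ?_ (by simp)
    cases σ; simp_all [bitsS, signed]
  | cons b l ih =>
    intro c σ h hc
    have hb : b = 0 ∨ b = 1 := by fin_cases b <;> simp
    obtain rfl | rfl := hb
    · refine ExecR.congr (ExecR.loop_cons h rfl (ExecR.seq (ExecR.push ..)
        (ExecR.ite_neg (by simp) ExecR.skip)) (ih c _ rfl hc)) ?_ ?_
      · simp [bitsS, signed]
      · simp only [List.length_cons]; omega
    · refine ExecR.congr (ExecR.loop_cons h rfl (ExecR.seq (ExecR.push ..)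
        (ExecR.ite_pos rfl (ExecR.pop_cons hc (ExecR.push ..)))) (ih (-c) _ rfl rfl)) ?_ ?_
      · simp [bitsS, signed]
      · simp only [List.length_cons]; omega

theorem exec_signPass (l : List (Fin 2)) (c : Fin (2 * m)) (σ : Regs (Sym m))
    (h : σ.acc = bitsS m l) (h' : σ.acc' = []) (hc : σ.coef = [.expo c]) :
    ExecR signPass σ { σ with coef := [.expo (signed l c)] } (6 * l.length + 2) := by
  refine ExecR.congr (ExecR.seq (exec_signPass_loop l c σ h hc) (exec_move (by decide) _)) ?_ ?_
  · cases σ; simp_all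
  · simp [h']; omega

/-- Add the second exponent to the first one if both bits are set. -/
def updSym (c si tj x : Sym m) : Sym m :=
  if si = .bit 1 ∧ tj = .bit 1 then
    match x, c with
    | .expo x, .expo c => .expo (x + c)
    | x, _ => x
  else x

/-- Add `c` to the next row of the table, wherever `si` and the bit of `last` are set. -/
def sweepRow (c si : Sym m) : Prog Reg (Sym m) :=
  .loop .last always fun tj => .push .last' tj ;;
    .pop .expo fun o => o.elim .skip fun x => .push .expoDone (updSym c si tj x)

/-- Add the table `c s tᵀ`, with `s` in `first` and `t` in `last`, to the table in `expo`. -/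
def sweep (c : Sym m) : Prog Reg (Sym m) :=
  .loop .first always (fun si => sweepRow c si ;; move .last' .last) ;;
  clear .last ;; move .expoDone .expo

theorem exec_sweepRow (c : Fin (2 * m)) (si : Fin 2) (rest : List (Sym m)) (t : List (Fin 2)) :
    ∀ (r : List (Fin (2 * m))) (σ : Regs (Sym m)), t.length = r.length → σ.last = bitsS m t →
      σ.expo = r.map Sym.expo ++ rest →
      ExecR (sweepRow (.expo c) (.bit si)) σ
        { σ with
          last := []
          last' := (bitsS m t).reverse ++ σ.last'
          expo := rest
          expoDone := ((addRowL c si t r).map Sym.expo).reverse ++ σ.expoDone }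
        (4 * t.length + 1) := by
  induction t with
  | nil =>
    intro r σ hl ht hr
    obtain rfl : r = [] := by simpa using hl.symm
    refine ExecR.congr (ExecR.loop_nil ht) ?_ (by simp)
    cases σ; simp_all [bitsS, addRowL]
  | cons b t ih =>
    intro r σ hl ht hr
    cases r with
    | nil => simp at hl
    | cons x r =>
      refine ExecR.congr (ExecR.loop_cons ht rfl (ExecR.seq (ExecR.push ..)
        (ExecR.pop_cons hr (ExecR.push ..))) (ih r _ (by simpa using hl) rfl rfl)) ?_ ?_
      · by_cases hc : si = 1 ∧ b = 1 <;> simp [bitsS, addRowL, updSym, hc]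
      · simp only [List.length_cons]; omega

theorem tableS_length (N : ℕ) (e : LTable m) (he : ∀ r ∈ e, r.length = N) :
    (tableS e).length = e.length * N := by
  induction e with
  | nil => simp [tableS]
  | cons r e ih =>
    have := ih fun r hr => he r (by simp [hr])
    simp only [tableS, List.flatMap_cons, List.length_append, List.length_map,
      List.length_cons] at *
    rw [this, he r (by simp)]; ring

theorem addRowL_length (N : ℕ) (c : Fin (2 * m)) (si : Fin 2) (t : List (Fin 2))
    (r : List (Fin (2 * m))) (ht : t.length = N) (hr : r.length = N) :
    (addRowL c si t r).length = N := by
  simp [addRowL, ht, hr]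

theorem rankOne_length (N : ℕ) (c : Fin (2 * m)) (s t : List (Fin 2)) (e : LTable m)
    (hs : s.length = N) (he : e.length = N) : (rankOne c s t e).length = N := by
  simp [rankOne, hs, he]

theorem rankOne_mem_length (N : ℕ) (c : Fin (2 * m)) (s t : List (Fin 2)) (e : LTable m)
    (ht : t.length = N) (he : ∀ r ∈ e, r.length = N) : ∀ r ∈ rankOne c s t e, r.length = N := by
  induction e generalizing s with
  | nil => simp [rankOne]
  | cons r e ih =>
    cases s with
    | nil => simp [rankOne]
    | cons b s =>
      simp only [rankOne, List.zipWith_cons_cons, List.mem_cons]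
      rintro _ (rfl | hr)
      · exact addRowL_length N c b t r ht (he r (by simp))
      · exact ih s (fun r hr => he r (by simp [hr])) _ hr

theorem exec_sweep_loop (N : ℕ) (c : Fin (2 * m)) (t : List (Fin 2)) (ht : t.length = N)
    (s : List (Fin 2)) :
    ∀ (e : LTable m) (σ : Regs (Sym m)), s.length = e.length → (∀ r ∈ e, r.length = N) →
      σ.first = bitsS m s → σ.last = bitsS m t → σ.last' = [] → σ.expo = tableS e →
      ExecR (.loop .first always (fun si => sweepRow (.expo c) si ;; move .last' .last)) σ
        { σ with
          first := []
          expo := []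
          expoDone := (tableS (rankOne c s t e)).reverse ++ σ.expoDone }
        (s.length * (6 * N + 3) + 1) := by
  induction s with
  | nil =>
    intro e σ hl _ hs _ _ hx
    obtain rfl : e = [] := by simpa using hl.symm
    refine ExecR.congr (ExecR.loop_nil hs) ?_ (by simp)
    cases σ; simp_all [bitsS, tableS, rankOne]
  | cons b s ih =>
    intro e σ hl he hs hlast hlast' hx
    cases e with
    | nil => simp at hl
    | cons r e =>
      refine ExecR.congr (ExecR.loop_cons hs rfl (ExecR.seq
        (exec_sweepRow c b (tableS e) t r _ (ht.trans (he r (by simp)).symm) hlast hx)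
        (exec_move (by decide) _)) (ih e _ (by simpa using hl)
          (fun r hr => he r (by simp [hr])) rfl ?_ rfl rfl)) ?_ ?_
      · simp [hlast', bitsS]
      · cases σ; simp_all [bitsS, tableS, rankOne]
      · simp only [List.length_cons, Regs.get, Regs.set, List.length_append, List.length_reverse,
          bitsS_length, ht, hlast', List.length_nil]
        ring_nf; omega

theorem exec_sweep (N : ℕ) (c : Fin (2 * m)) (s t : List (Fin 2)) (e : LTable m)
    (σ : Regs (Sym m)) (hsN : s.length = N) (htN : t.length = N) (heN : e.length = N)
    (he : ∀ r ∈ e, r.length = N) (hs : σ.first = bitsS m s) (ht : σ.last = bitsS m t)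
    (ht' : σ.last' = []) (hx : σ.expo = tableS e) (hd : σ.expoDone = []) :
    ExecR (sweep (.expo c)) σ
      { σ with
        first := []
        last := []
        expo := tableS (rankOne c s t e) } (8 * N ^ 2 + 5 * N + 3) := by
  refine ExecR.congr (ExecR.seq (exec_sweep_loop N c t htN s e σ (hsN.trans heN.symm) he hs ht ht'
    hx) (ExecR.seq (exec_clear _ _) (exec_move (by decide) _))) ?_ ?_
  · cases σ; simp_all
  · simp only [Regs.get, Regs.set, hd, List.append_nil, List.length_reverse, ht, bitsS_length,
      tableS_length N _ (rankOne_mem_length N c s t e htN he), rankOne_length N c s t e hsN heN,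
      hsN, htN]
    nlinarith

end QubitBraid

namespace QubitBraid

open StackProg

variable {m : ℕ}

/-- Treat one exponent of the second factor: the accumulator holds the string `v`, and the exponent,
with the sign that belongs to `v`, is added to the entry of the table that `v` determines. -/
def entry : Prog Reg (Sym m) :=
  .pop .expo' fun oe => oe.elim .skip fun e => .pop .acc fun op => op.elim .skip fun ph =>
    .push .coef (if ph = .phase 2 then negSym e else e) ;;
    scanOne true ;; scanOne false ;; move .first' .first ;; signPass ;; .push .acc ph ;;
    .pop .coef fun oc => oc.elim .skip sweep

theorem exec_entry (N : ℕ) (p : Fin 4) (v : List (Fin 2)) (c : Fin (2 * m)) (rest : List (Sym m))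
    (e : LTable m) (σ : Regs (Sym m)) (hv : v.length = N) (heN : e.length = N)
    (he : ∀ r ∈ e, r.length = N) (hx' : σ.expo' = .expo c :: rest) (ha : σ.acc = wordS m (p, v))
    (ha' : σ.acc' = []) (hc : σ.coef = []) (hf : σ.first = []) (hf' : σ.first' = [])
    (hl : σ.last = []) (hl' : σ.last' = []) (hx : σ.expo = tableS e) (hd : σ.expoDone = []) :
    ExecR entry σ
      { σ with
        expo' := rest
        expo := tableS (rankOne (signed v (if p = 2 then -c else c)) (firstOne v) (lastOne v) e) }
      (8 * N ^ 2 + 19 * N + 22) := by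
  have h1 :
    ExecR (.push .coef (if (.phase p : Sym m) = .phase 2 then negSym (.expo c) else .expo c))
      { σ with expo' := rest, acc := bitsS m v }
      { σ with
        expo' := rest
        acc := bitsS m v
        coef := [.expo (if p = 2 then -c else c)] } 1 := by
    refine ExecR.congr (ExecR.push ..) ?_ le_rfl
    by_cases hp : p = 2 <;> simp [hp, hc, negSym]
  have h2 : ExecR (scanOne true)
      { σ with
        expo' := rest
        acc := bitsS m v
        coef := [.expo (if p = 2 then -c else c)] }
      { σ with
        expo' := rest
        acc := []
        acc' := (bitsS m v).reverse
        first' := (bitsS m (firstOne v)).reverse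
        coef := [.expo (if p = 2 then -c else c)] } (3 * N + 5) := by
    refine ExecR.congr (exec_scanOne_acc v _ rfl) ?_ (by omega)
    simp [ha', hf']
  have h3 : ExecR (scanOne false)
      { σ with
        expo' := rest
        acc := []
        acc' := (bitsS m v).reverse
        first' := (bitsS m (firstOne v)).reverse
        coef := [.expo (if p = 2 then -c else c)] }
      { σ with
        expo' := rest
        acc := bitsS m v
        last := bitsS m (lastOne v)
        first' := (bitsS m (firstOne v)).reverse
        coef := [.expo (if p = 2 then -c else c)] } (3 * N + 5) := by
    refine ExecR.congr (exec_scanOne_acc' v.reverse _ ?_) ?_ (by simp; omega)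
    · simp [bitsS]
    · simp [bitsS, lastOne, ha', hl]
  have h4 : ExecR (move .first' .first)
      { σ with
        expo' := rest
        acc := bitsS m v
        last := bitsS m (lastOne v)
        first' := (bitsS m (firstOne v)).reverse
        coef := [.expo (if p = 2 then -c else c)] }
      { σ with
        expo' := rest
        acc := bitsS m v
        last := bitsS m (lastOne v)
        first := bitsS m (firstOne v)
        coef := [.expo (if p = 2 then -c else c)] } (2 * N + 1) := by
    refine ExecR.congr (exec_move (by decide) _) ?_ (by simp [hv])
    simp [hf, hf']
  have h5 : ExecR signPass
      { σ with
        expo' := rest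
        acc := bitsS m v
        last := bitsS m (lastOne v)
        first := bitsS m (firstOne v)
        coef := [.expo (if p = 2 then -c else c)] }
      { σ with
        expo' := rest
        acc := bitsS m v
        last := bitsS m (lastOne v)
        first := bitsS m (firstOne v)
        coef := [.expo (signed v (if p = 2 then -c else c))] } (6 * N + 2) := by
    refine ExecR.congr (exec_signPass v _ _ rfl ha' rfl) rfl (by omega)
  have h6 := exec_sweep N (signed v (if p = 2 then -c else c)) (firstOne v) (lastOne v) e
      { σ with
        expo' := rest
        acc := wordS m (p, v)
        last := bitsS m (lastOne v)
        first := bitsS m (firstOne v)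
        coef := [] }
      (by simp [hv]) (by simp [hv]) heN he rfl rfl hl' hx hd
  refine ExecR.congr (ExecR.pop_cons hx' (ExecR.pop_cons ha (ExecR.seq h1 (ExecR.seq h2
    (ExecR.seq h3 (ExecR.seq h4 (ExecR.seq h5 (ExecR.seq (ExecR.push ..)
      (ExecR.pop_cons rfl h6))))))))) ?_ ?_
  · cases σ; simp_all
  · ring_nf; omega

/-- Treat the exponents of one row of the second factor, from the diagonal on. -/
def inner : Prog Reg (Sym m) := .loop .pauli always fun q => addRow 1 q ;; entry

/-- The rows of bits, every one with the phase `2`, so that the phase of a sum of rows counts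
them. -/
def rowsS (m : ℕ) (rs : List (List (Fin 2))) : List (Sym m) :=
  wordsS m (rs.map fun r => ((2 : Fin 4), r))

theorem exec_inner (N : ℕ) (rest : List (Sym m)) (l : List (List (Fin 2) × Fin (2 * m))) :
    ∀ (p : Fin 4) (v : List (Fin 2)) (e : LTable m) (σ : Regs (Sym m)), v.length ≤ N →
      (∀ r ∈ l, r.1.length = N) → e.length = N → (∀ r ∈ e, r.length = N) →
      σ.pauli = rowsS m (l.map Prod.fst) →
      σ.expo' = (l.map fun r => Sym.expo r.2) ++ rest → σ.acc = wordS m (p, v) →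
      σ.acc' = [] → σ.coef = [] → σ.first = [] → σ.first' = [] → σ.last = [] → σ.last' = [] →
      σ.expo = tableS e → σ.expoDone = [] →
      ∃ w : LWord, w.2.length ≤ N ∧ ExecR inner σ
        { σ with
          pauli := []
          done := (rowsS m (l.map Prod.fst)).reverse ++ σ.done
          expo' := rest
          acc := wordS m w
          expo := tableS (innerL p v e l) }
        (l.length * (8 * N ^ 2 + 25 * N + 33) + 1) := by
  induction l with
  | nil =>
    intro p v e σ hv _ _ _ hp hx' ha _ _ _ _ _ _ hx _
    refine ⟨(p, v), hv, ExecR.congr (ExecR.loop_nil hp) ?_ (by simp)⟩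
    cases σ; simp_all [rowsS, wordsS, innerL]
  | cons a l ih =>
    obtain ⟨r, c⟩ := a
    intro p v e σ hv hl heN he hp hx' ha ha' hc hf hf' hl1 hl2 hx hd
    have hr : r.length = N := hl (r, c) (by simp)
    have h1 : ExecR (addRow 1 (.phase 2))
        { σ with pauli := bitsS m r ++ rowsS m (l.map Prod.fst) }
        { σ with
          pauli := rowsS m (l.map Prod.fst)
          done := (wordS m (2, r)).reverse ++ σ.done
          acc := wordS m (p + 2, addBits 1 v r) } (6 * N + 10) := by
      refine ExecR.congr (exec_addRow 1 (rowsS m (l.map Prod.fst)) (head?_wordsS _) (p, v) (2, r) _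
        rfl ha ?_ ha') ?_ ?_
      · simpa [hr] using hv
      · simp [addLWord]
      · simp [hr]
    have h2 := exec_entry N (p + 2) (addBits 1 v r) c ((l.map fun r => Sym.expo r.2) ++ rest) e
      { σ with
          pauli := rowsS m (l.map Prod.fst)
          done := (wordS m (2, r)).reverse ++ σ.done
          acc := wordS m (p + 2, addBits 1 v r) } (by simpa using hr) heN he hx' rfl ha' hc hf hf'
          hl1 hl2 hx hd
    obtain ⟨w, hw, h3⟩ := ih (p + 2) (addBits 1 v r)
      (rankOne (signed (addBits 1 v r) (if p + 2 = 2 then -c else c)) (firstOne (addBits 1 v r))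
        (lastOne (addBits 1 v r)) e)
      { σ with
          pauli := rowsS m (l.map Prod.fst)
          done := (wordS m (2, r)).reverse ++ σ.done
          expo' := (l.map fun r => Sym.expo r.2) ++ rest
          acc := wordS m (p + 2, addBits 1 v r)
          expo := tableS (rankOne (signed (addBits 1 v r) (if p + 2 = 2 then -c else c))
            (firstOne (addBits 1 v r)) (lastOne (addBits 1 v r)) e) }
      (by simp [hr]) (fun r hr => hl r (List.mem_cons_of_mem _ hr))
        (rankOne_length N _ _ _ _ (by simp [hr]) heN)
      (rankOne_mem_length N _ _ _ _ (by simp [hr]) he) rfl rfl rfl ha' hc hf hf' hl1 hl2 rfl hd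
    have hp' : σ.pauli = Sym.phase 2 :: (bitsS m r ++ rowsS m (l.map Prod.fst)) := hp
    refine ⟨w, hw, ExecR.congr (ExecR.loop_cons hp' rfl (ExecR.seq h1 h2) h3) ?_ ?_⟩
    · simp [rowsS, wordsS, innerL]
    · simp only [List.length_cons]; ring_nf; omega

/-- Drop one exponent of the second factor for every symbol in `skip`. -/
def dropEntries : Prog Reg (Sym m) :=
  .loop .skip always (fun t => .push .skip' t ;; .pop .expo' fun _ => .skip) ;; move .skip' .skip

theorem exec_dropEntries_loop (k : ℕ) : ∀ (σ : Regs (Sym m)), σ.skip = ticks m k →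
    k ≤ σ.expo'.length →
    ExecR (.loop .skip always (fun t => .push .skip' t ;; .pop .expo' fun _ => .skip)) σ
      { σ with
        skip := []
        skip' := ticks m k ++ σ.skip'
        expo' := σ.expo'.drop k } (4 * k + 1) := by
  induction k with
  | zero =>
    intro σ h _
    refine ExecR.congr (ExecR.loop_nil h) ?_ (by simp)
    cases σ; simp_all [ticks]
  | succ k ih =>
    intro σ h hk
    cases hx : σ.expo' with
    | nil => simp [hx] at hk
    | cons x l =>
      refine ExecR.congr (ExecR.loop_cons h rfl (ExecR.seq (ExecR.push ..)
        (ExecR.pop_cons hx ExecR.skip)) (ih _ rfl ?_)) ?_ (by omega)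
      · simpa [hx] using hk
      · simp only [Regs.set, Regs.get, ticks, List.replicate_succ', List.drop_succ_cons,
          List.append_assoc, List.singleton_append]

theorem exec_dropEntries (k : ℕ) (σ : Regs (Sym m)) (h : σ.skip = ticks m k)
    (h' : σ.skip' = []) (hk : k ≤ σ.expo'.length) :
    ExecR dropEntries σ { σ with expo' := σ.expo'.drop k } (6 * k + 2) := by
  refine ExecR.congr (ExecR.seq (exec_dropEntries_loop k σ h hk) (exec_move (by decide) _)) ?_ ?_
  · cases σ; simp_all [ticks]
  · simp [h', ticks]; omega

/-- Empty the stack `pauli` as long as there are bits at its top. -/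
def dropBits : Prog Reg (Sym m) := .loop .pauli isBit fun _ => .skip

theorem exec_dropBits (rest : List (Sym m)) (hrest : ∀ a ∈ rest.head?, isBit a = false)
    (l : List (Fin 2)) : ∀ (σ : Regs (Sym m)), σ.pauli = bitsS m l ++ rest →
    ExecR dropBits σ { σ with pauli := rest } (2 * l.length + 1) := by
  induction l with
  | nil =>
    intro σ h
    refine ExecR.congr (ExecR.loop_exit h hrest) ?_ (by simp)
    cases σ; simp_all [bitsS]
  | cons b l ih =>
    intro σ h
    refine ExecR.congr (ExecR.loop_cons h rfl ExecR.skip (ih _ rfl)) rfl ?_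
    simp only [List.length_cons]; omega

/-- Treat one row of the table of the second factor, and then drop the first row of `pauli`. -/
def outerBody : Prog Reg (Sym m) :=
  .push .acc (.phase 0) ;; dropEntries ;; inner ;; clear .acc ;; move .done .pauli ;;
  .pop .pauli (fun _ => .skip) ;; dropBits ;; .push .skip .tick

theorem rowsS_length (N : ℕ) (rs : List (List (Fin 2))) (h : ∀ r ∈ rs, r.length = N) :
    (rowsS m rs).length = rs.length * (N + 1) := by
  rw [rowsS, wordsS_length N _ (by simpa using h), List.length_map]

theorem exec_outerBody (N k : ℕ) (r : List (Fin 2)) (rs : List (List (Fin 2)))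
    (er : List (Fin (2 * m))) (rest : List (Sym m)) (e : LTable m) (σ : Regs (Sym m))
    (hr : ∀ x ∈ r :: rs, x.length = N) (hk : (r :: rs).length + k = N) (her : er.length = N)
    (heN : e.length = N) (he : ∀ r ∈ e, r.length = N) (hp : σ.pauli = rowsS m (r :: rs))
    (hx' : σ.expo' = er.map Sym.expo ++ rest) (ha : σ.acc = []) (ha' : σ.acc' = [])
    (hdo : σ.done = []) (hs : σ.skip = ticks m k) (hs' : σ.skip' = []) (hc : σ.coef = [])
    (hf : σ.first = []) (hf' : σ.first' = []) (hl1 : σ.last = []) (hl2 : σ.last' = [])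
    (hx : σ.expo = tableS e) (hd : σ.expoDone = []) :
    ExecR outerBody σ
      { σ with
        pauli := rowsS m rs
        skip := ticks m (k + 1)
        expo' := rest
        expo := tableS (innerL 0 [] e ((r :: rs).zip (er.drop k))) }
      (8 * N ^ 3 + 27 * N ^ 2 + 45 * N + 15) := by
  have hlen : (er.drop k).length = (r :: rs).length := by rw [List.length_drop]; omega
  have hfst : ((r :: rs).zip (er.drop k)).map Prod.fst = r :: rs :=
    List.map_fst_zip hlen.ge
  have hsnd : ((r :: rs).zip (er.drop k)).map (fun x => (Sym.expo x.2 : Sym m)) =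
      (er.drop k).map Sym.expo := by
    rw [← List.map_snd_zip (l₁ := r :: rs) hlen.le, List.map_map]
    rw [List.map_snd_zip hlen.le]
    rfl
  have h1 : ExecR dropEntries { σ with acc := [.phase 0] }
      { σ with acc := [.phase 0], expo' := (er.drop k).map Sym.expo ++ rest } (6 * k + 2) := by
    refine ExecR.congr (exec_dropEntries k _ hs hs' ?_) ?_ le_rfl
    · simp only [hx', List.length_append, List.length_map]; omega
    · have : (er.map Sym.expo ++ rest).drop k = (er.drop k).map Sym.expo ++ rest := by
        rw [List.drop_append_of_le_length (by rw [List.length_map]; omega), List.map_drop]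
      simp only [hx', this]
  obtain ⟨w, hw, h2⟩ := exec_inner N rest ((r :: rs).zip (er.drop k)) 0 [] e
    { σ with acc := [.phase 0], expo' := (er.drop k).map Sym.expo ++ rest } (by simp)
    (fun x hx => hr x.1 (List.of_mem_zip hx).1) heN he (by rw [hfst]; exact hp) (by rw [hsnd]) rfl
    ha' hc hf hf' hl1 hl2 hx hd
  rw [hfst] at h2
  have h3 : ExecR (clear .acc ;; move .done .pauli)
      { σ with
        pauli := []
        done := (rowsS m (r :: rs)).reverse ++ σ.done
        expo' := rest
        acc := wordS m w
        expo := tableS (innerL 0 [] e ((r :: rs).zip (er.drop k))) }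
      { σ with
        pauli := .phase 2 :: (bitsS m r ++ rowsS m rs)
        expo' := rest
        expo := tableS (innerL 0 [] e ((r :: rs).zip (er.drop k))) }
      (2 * N ^ 2 + 4 * N + 4) := by
    refine ExecR.congr (ExecR.seq (exec_clear _ _) (exec_move (by decide) _)) ?_ ?_
    · simp [hdo, ha, rowsS, wordsS, wordS]
    · simp only [Regs.get, Regs.set, hdo, List.append_nil, List.length_reverse,
        rowsS_length N _ hr, wordS_length]
      have : (r :: rs).length ≤ N := by omega
      nlinarith
  have h4 := exec_dropBits (m := m) (rowsS m rs) (head?_wordsS _) r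
    { σ with
      pauli := bitsS m r ++ rowsS m rs
      expo' := rest
      expo := tableS (innerL 0 [] e ((r :: rs).zip (er.drop k))) } rfl
  obtain ⟨t1, ht1, hr1⟩ := h3
  have h3' : ∀ {q : Prog Reg (Sym m)} {υ : Regs (Sym m)} {T : ℕ}, ExecR q
      { σ with
        pauli := .phase 2 :: (bitsS m r ++ rowsS m rs)
        expo' := rest
        expo := tableS (innerL 0 [] e ((r :: rs).zip (er.drop k))) } υ T →
      ExecR (clear .acc ;; move .done .pauli ;; q)
      { σ with
        pauli := []
        done := (rowsS m (r :: rs)).reverse ++ σ.done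
        expo' := rest
        acc := wordS m w
        expo := tableS (innerL 0 [] e ((r :: rs).zip (er.drop k))) } υ
        (2 * N ^ 2 + 4 * N + 4 + T) := by
    rintro q υ T ⟨t, ht, h⟩
    cases hr1 with
    | seq a b => exact ⟨_, by omega, Runs.seq a (Runs.seq b h)⟩
  refine ExecR.congr (ExecR.seq (ExecR.congr (ExecR.push ..) (by simp [ha]) le_rfl)
    (ExecR.seq h1 (ExecR.seq h2 (h3' (ExecR.seq (ExecR.pop_cons rfl ExecR.skip)
      (ExecR.seq h4 (ExecR.push ..))))))) ?_ ?_
  · simp [hs, ticks, List.replicate_succ]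
  · rw [hr r (by simp), List.length_zip, hlen, min_self]
    have h5 : (r :: rs).length ≤ N := by omega
    have h6 : (r :: rs).length * (8 * N ^ 2 + 25 * N + 33) ≤ N * (8 * N ^ 2 + 25 * N + 33) :=
      Nat.mul_le_mul_right _ h5
    have h7 : k ≤ N := by omega
    ring_nf at h6 ⊢
    omega

/-- Run through all rows of the table of the second factor. -/
def outer : Prog Reg (Sym m) := .loop .cnt always fun t => .push .cnt' t ;; outerBody

theorem innerL_length (N : ℕ) (l : List (List (Fin 2) × Fin (2 * m))) :
    ∀ (p : Fin 4) (v : List (Fin 2)) (e : LTable m), (∀ r ∈ l, r.1.length = N) → e.length = N →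
      (innerL p v e l).length = N := by
  induction l with
  | nil => intro p v e _ he; exact he
  | cons a l ih =>
    intro p v e hl he
    refine ih _ _ _ (fun r hr => hl r (List.mem_cons_of_mem _ hr)) ?_
    exact rankOne_length N _ _ _ _ (by simpa using hl a (by simp)) he

theorem innerL_mem_length (N : ℕ) (l : List (List (Fin 2) × Fin (2 * m))) :
    ∀ (p : Fin 4) (v : List (Fin 2)) (e : LTable m), (∀ r ∈ l, r.1.length = N) →
      (∀ r ∈ e, r.length = N) → ∀ r ∈ innerL p v e l, r.length = N := by
  induction l with
  | nil => intro p v e _ he; exact he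
  | cons a l ih =>
    intro p v e hl he
    refine ih _ _ _ (fun r hr => hl r (List.mem_cons_of_mem _ hr)) ?_
    exact rankOne_mem_length N _ _ _ _ (by simpa using hl a (by simp)) he

theorem exec_outer (N : ℕ) (ers : LTable m) :
    ∀ (k : ℕ) (rs : List (List (Fin 2))) (e : LTable m) (σ : Regs (Sym m)),
      rs.length = ers.length → rs.length + k = N → (∀ r ∈ rs, r.length = N) →
      (∀ r ∈ ers, r.length = N) → e.length = N → (∀ r ∈ e, r.length = N) →
      σ.cnt = ticks m ers.length → σ.pauli = rowsS m rs → σ.expo' = tableS ers → σ.acc = [] →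
      σ.acc' = [] → σ.done = [] → σ.skip = ticks m k → σ.skip' = [] → σ.coef = [] →
      σ.first = [] → σ.first' = [] → σ.last = [] → σ.last' = [] → σ.expo = tableS e →
      σ.expoDone = [] →
      ExecR outer σ
        { σ with
          cnt := []
          cnt' := ticks m ers.length ++ σ.cnt'
          pauli := []
          skip := ticks m N
          expo' := []
          expo := tableS (outerL k e rs ers) }
        (ers.length * (8 * N ^ 3 + 27 * N ^ 2 + 45 * N + 17) + 1) := by
  induction ers with
  | nil =>
    intro k rs e σ hl hk _ _ _ _ hcnt hp hx' _ _ _ hs _ _ _ _ _ _ hx _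
    obtain rfl : rs = [] := by simpa using hl
    obtain rfl : k = N := by simpa using hk
    refine ExecR.congr (ExecR.loop_nil hcnt) ?_ (by simp)
    cases σ; simp_all [ticks, rowsS, wordsS, tableS, outerL]
  | cons er ers ih =>
    intro k rs e σ hl hk hrs hers heN he hcnt hp hx' ha ha' hdo hs hs' hc hf hf' hl1 hl2 hx hd
    cases rs with
    | nil => simp at hl
    | cons r rs =>
      have hlz : ∀ x ∈ (r :: rs).zip (er.drop k), x.1.length = N :=
        fun x hx => hrs x.1 (List.of_mem_zip hx).1
      have h1 := exec_outerBody N k r rs er (tableS ers) e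
        { σ with cnt := ticks m ers.length, cnt' := .tick :: σ.cnt' } hrs hk (hers er (by simp))
        heN he hp hx' ha ha' hdo hs hs' hc hf hf' hl1 hl2 hx hd
      have h2 := ih (k + 1) rs (innerL 0 [] e ((r :: rs).zip (er.drop k)))
        { σ with
          cnt := ticks m ers.length
          cnt' := .tick :: σ.cnt'
          pauli := rowsS m rs
          skip := ticks m (k + 1)
          expo' := tableS ers
          expo := tableS (innerL 0 [] e ((r :: rs).zip (er.drop k))) }
        (by simpa using hl) (by rw [← hk, List.length_cons]; ring)
        (fun r hr => hrs r (List.mem_cons_of_mem _ hr))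
        (fun r hr => hers r (List.mem_cons_of_mem _ hr))
        (innerL_length N _ _ _ _ hlz heN) (innerL_mem_length N _ _ _ _ hlz he)
        rfl rfl rfl ha ha' hdo rfl hs' hc hf hf' hl1 hl2 rfl hd
      have hcnt' : σ.cnt = .tick :: ticks m ers.length := hcnt
      refine ExecR.congr (ExecR.loop_cons hcnt' rfl (ExecR.seq (ExecR.push ..) h1) h2) ?_ ?_
      · simp [ticks, outerL, List.replicate_succ']
      · simp only [List.length_cons]; ring_nf; omega

end QubitBraid

namespace QubitBraid

open StackProg

variable {m : ℕ}

/-- Move as many symbols from `pauli` to `done` as `len` has ticks. -/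
def takeBits : Prog Reg (Sym m) :=
  .loop .len always (fun t => .push .len' t ;;
    .pop .pauli fun o => o.elim .skip fun y => .push .done y) ;; move .len' .len

theorem exec_takeBits_loop (rest : List (Sym m)) (xs : List (Fin 2)) : ∀ (σ : Regs (Sym m)),
    σ.len = ticks m xs.length → σ.pauli = bitsS m xs ++ rest →
    ExecR (.loop .len always (fun t => .push .len' t ;;
      .pop .pauli fun o => o.elim .skip fun y => .push .done y)) σ
      { σ with
        len := []
        len' := ticks m xs.length ++ σ.len'
        pauli := rest
        done := (bitsS m xs).reverse ++ σ.done } (4 * xs.length + 1) := by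
  induction xs with
  | nil =>
    intro σ h hp
    refine ExecR.congr (ExecR.loop_nil h) ?_ (by simp)
    cases σ; simp_all [ticks, bitsS]
  | cons x xs ih =>
    intro σ h hp
    refine ExecR.congr (ExecR.loop_cons h rfl (ExecR.seq (ExecR.push ..)
      (ExecR.pop_cons hp (ExecR.push ..))) (ih _ rfl rfl)) ?_ ?_
    · simp [ticks, bitsS, List.replicate_succ']
    · simp only [List.length_cons]; omega

theorem exec_takeBits (rest : List (Sym m)) (xs : List (Fin 2)) (σ : Regs (Sym m))
    (h : σ.len = ticks m xs.length) (h' : σ.len' = []) (hp : σ.pauli = bitsS m xs ++ rest) :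
    ExecR takeBits σ
      { σ with
        pauli := rest
        done := (bitsS m xs).reverse ++ σ.done } (6 * xs.length + 2) := by
  refine ExecR.congr (ExecR.seq (exec_takeBits_loop rest xs σ h hp) (exec_move (by decide) _)) ?_ ?_
  · cases σ; simp_all [ticks]
  · simp [h', ticks]; omega

/-- Move the `X`-bits of as many words as `cnt` has ticks from `pauli` to `done`. -/
def truncateLoop : Prog Reg (Sym m) :=
  .loop .cnt always fun t => .push .cnt' t ;; .pop .pauli (fun _ => .push .done (.phase 2)) ;;
    takeBits ;; dropBits

theorem exec_truncateLoop (N : ℕ) (rest : List (Sym m)) (hrest : ∀ a ∈ rest.head?, isBit a = false)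
    (rs : List (Fin 4 × List (Fin 2) × List (Fin 2))) : ∀ (σ : Regs (Sym m)),
    (∀ r ∈ rs, r.2.1.length = N ∧ r.2.2.length = N) → σ.cnt = ticks m rs.length →
    σ.len = ticks m N → σ.len' = [] →
    σ.pauli = wordsS m (rs.map fun r => (r.1, r.2.1 ++ r.2.2)) ++ rest →
    ExecR truncateLoop σ
      { σ with
        cnt := []
        cnt' := ticks m rs.length ++ σ.cnt'
        pauli := rest
        done := (rowsS m (rs.map fun r => r.2.1)).reverse ++ σ.done }
      (rs.length * (8 * N + 8) + 1) := by
  induction rs with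
  | nil =>
    intro σ _ hc _ _ hp
    refine ExecR.congr (ExecR.loop_nil hc) ?_ (by simp)
    cases σ; simp_all [ticks, wordsS, rowsS]
  | cons r rs ih =>
    obtain ⟨p, xs, zs⟩ := r
    intro σ hrs hc hl hl' hp
    have hr := hrs (p, xs, zs) (by simp)
    simp only at hr
    have hc' : σ.cnt = .tick :: ticks m rs.length := hc
    have hp' : σ.pauli = .phase p :: (bitsS m xs ++ (bitsS m zs ++
        (wordsS m (rs.map fun r => (r.1, r.2.1 ++ r.2.2)) ++ rest))) := by
      rw [hp]; simp [wordsS, wordS, bitsS]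
    have h1 := exec_takeBits (bitsS m zs ++
        (wordsS m (rs.map fun r => (r.1, r.2.1 ++ r.2.2)) ++ rest)) xs
      { σ with
        cnt := ticks m rs.length
        cnt' := .tick :: σ.cnt'
        pauli := bitsS m xs ++ (bitsS m zs ++
          (wordsS m (rs.map fun r => (r.1, r.2.1 ++ r.2.2)) ++ rest))
        done := .phase 2 :: σ.done } (by rw [hr.1]; exact hl) hl' rfl
    have h2 := exec_dropBits (wordsS m (rs.map fun r => (r.1, r.2.1 ++ r.2.2)) ++ rest) (by
        cases rs with
        | nil => exact hrest
        | cons r rs => simp [wordsS, wordS, isBit]) zs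
      { σ with
        cnt := ticks m rs.length
        cnt' := .tick :: σ.cnt'
        pauli := bitsS m zs ++ (wordsS m (rs.map fun r => (r.1, r.2.1 ++ r.2.2)) ++ rest)
        done := (bitsS m xs).reverse ++ .phase 2 :: σ.done } rfl
    have h3 := ih
      { σ with
        cnt := ticks m rs.length
        cnt' := .tick :: σ.cnt'
        pauli := wordsS m (rs.map fun r => (r.1, r.2.1 ++ r.2.2)) ++ rest
        done := (bitsS m xs).reverse ++ .phase 2 :: σ.done }
      (fun r hr => hrs r (List.mem_cons_of_mem _ hr)) rfl hl hl' rfl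
    refine ExecR.congr (ExecR.loop_cons hc' rfl (ExecR.seq (ExecR.push ..) (ExecR.seq
      (ExecR.pop_cons hp' (ExecR.push ..)) (ExecR.seq h1 h2))) h3) ?_ ?_
    · simp [ticks, rowsS, wordsS, wordS, List.replicate_succ']
    · simp only [List.length_cons, hr.1, hr.2]; ring_nf; omega

/-- Replace the words in `pauli` by the `X`-bits of the first half of them. -/
def truncate : Prog Reg (Sym m) :=
  truncateLoop ;; move .cnt' .cnt ;; clear .pauli ;; move .done .pauli

theorem exec_truncate (N : ℕ) (rs : List (Fin 4 × List (Fin 2) × List (Fin 2))) (rs' : List LWord)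
    (σ : Regs (Sym m)) (hN : rs.length = N) (hN' : rs'.length = N)
    (hrs : ∀ r ∈ rs, r.2.1.length = N ∧ r.2.2.length = N) (hrs' : ∀ r ∈ rs', r.2.length = 2 * N)
    (hc : σ.cnt = ticks m N) (hc' : σ.cnt' = []) (hl : σ.len = ticks m N) (hl' : σ.len' = [])
    (hd : σ.done = []) (hp : σ.pauli = wordsS m (rs.map (fun r => (r.1, r.2.1 ++ r.2.2)) ++ rs')) :
    ExecR truncate σ { σ with pauli := rowsS m (rs.map fun r => r.2.1) }
      (14 * N ^ 2 + 14 * N + 4) := by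
  have h1 : (wordsS m rs').length = N * (2 * N + 1) := by
    rw [wordsS_length (2 * N) rs' hrs', hN']
  have h2 : (rowsS m (rs.map fun r => r.2.1)).length = N * (N + 1) := by
    rw [rowsS_length N, List.length_map, hN]
    simpa using fun b a x hx => (hrs (a, b, x) hx).1
  refine ExecR.congr (ExecR.seq (exec_truncateLoop N (wordsS m rs') (head?_wordsS _) rs σ hrs
    (hN ▸ hc) hl hl' (by rw [hp, wordsS, List.flatMap_append]; rfl)) (ExecR.seq
    (exec_move (by decide) _) (ExecR.seq (exec_clear _ _) (exec_move (by decide) _)))) ?_ ?_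
  · cases σ; simp_all [ticks]
  · simp only [Regs.get, Regs.set, hd, hc', List.append_nil, List.length_reverse, h1, h2, hN,
      ticks, List.length_replicate]
    nlinarith

/-- All working stacks are empty. -/
structure Idle (σ : Regs (Sym m)) : Prop where
  cnt' : σ.cnt' = []
  len' : σ.len' = []
  done : σ.done = []
  acc : σ.acc = []
  acc' : σ.acc' = []
  res : σ.res = []
  skip : σ.skip = []
  skip' : σ.skip' = []
  coef : σ.coef = []
  first : σ.first = []
  first' : σ.first' = []
  last : σ.last = []
  last' : σ.last' = []
  expoDone : σ.expoDone = []

/-- Multiply the description in `expo` and `pauli` by the one in `expo'` and `pauli'`. -/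
def mulCore : Prog Reg (Sym m) :=
  mulPauli ;; truncate ;; outer ;; move .cnt' .cnt ;; clear .skip ;; move .res .pauli

theorem exec_mulCore (N : ℕ) (rs : List (Fin 4 × List (Fin 2) × List (Fin 2))) (rs' ws : List LWord)
    (e ers : LTable m) (σ : Regs (Sym m)) (hσ : Idle σ) (hN : rs.length = N) (hN' : rs'.length = N)
    (hrs : ∀ r ∈ rs, r.2.1.length = N ∧ r.2.2.length = N) (hrs' : ∀ r ∈ rs', r.2.length = 2 * N)
    (hws : ∀ w ∈ ws, w.2.length = 2 * N) (hwsN : ws.length = 2 * N)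
    (heN : e.length = N) (he : ∀ r ∈ e, r.length = N)
    (hersN : ers.length = N) (hers : ∀ r ∈ ers, r.length = N)
    (hc : σ.cnt = ticks m N) (hl : σ.len = ticks m N)
    (hp : σ.pauli = wordsS m (rs.map (fun r => (r.1, r.2.1 ++ r.2.2)) ++ rs'))
    (hp' : σ.pauli' = wordsS m ws) (hx : σ.expo = tableS e) (hx' : σ.expo' = tableS ers) :
    ExecR mulCore σ
      { σ with
        expo := tableS (outerL 0 e (rs.map fun r => r.2.1) ers)
        expo' := []
        pauli := wordsS m
          (ws.map (conjLWord (rs.map (fun r => (r.1, r.2.1 ++ r.2.2)) ++ rs')))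
        pauli' := [] } (200 * (N + 1) ^ 4) := by
  obtain ⟨g1, g2, g3, g4, g5, g6, g7, g8, g9, g10, g11, g12, g13, g14⟩ := hσ
  have hrows : ∀ r ∈ rs.map (fun r => (r.1, r.2.1 ++ r.2.2)) ++ rs', r.2.length = 2 * N := by
    intro r hr
    rcases List.mem_append.1 hr with hr | hr
    · obtain ⟨x, hx, rfl⟩ := List.mem_map.1 hr
      simp only [List.length_append, (hrs x hx).1, (hrs x hx).2]; ring
    · exact hrs' r hr
  have hlen : (rs.map (fun r => (r.1, r.2.1 ++ r.2.2)) ++ rs').length = 2 * N := by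
    simp [hN, hN']; ring
  have h1 := exec_mulPauli (2 * N) _ hrows ws σ (by rw [hlen]; exact hws) hp' hp g3 g4 g5
  rw [g6, List.append_nil] at h1
  generalize hW : ws.map (conjLWord (rs.map (fun r => (r.1, r.2.1 ++ r.2.2)) ++ rs')) = W at *
  have hWlen : (wordsS m W).length ≤ 2 * N * (2 * N + 1) := by
    have : ∀ (V : List LWord), (∀ w ∈ V, w.2.length ≤ 2 * N) →
        (wordsS m V).length ≤ V.length * (2 * N + 1) := by
      intro V
      induction V with
      | nil => simp [wordsS]
      | cons w V ih =>
        intro hV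
        have := ih fun w hw => hV w (List.mem_cons_of_mem _ hw)
        have := hV w (by simp)
        simp only [wordsS, List.flatMap_cons, List.length_append, wordS_length,
          List.length_cons] at *
        linarith
    refine (this W ?_).trans ?_
    · rw [← hW]
      intro w hw
      obtain ⟨x, hx, rfl⟩ := List.mem_map.1 hw
      exact foldRows_length (2 * N) _ _ _ (by simp) hrows
    · rw [← hW, List.length_map, hwsN]
  have h2 := exec_truncate N rs rs'
    { σ with pauli' := [], res := (wordsS m W).reverse } hN hN' hrs hrs' hc g1 hl g2 g3 hp
  have h3 := exec_outer N ers 0 (rs.map fun r => r.2.1) e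
    { σ with
      pauli' := []
      res := (wordsS m W).reverse
      pauli := rowsS m (rs.map fun r => r.2.1) }
    (by simp [hN, hersN]) (by simp [hN]) (by simpa using fun b a x hx => (hrs (a, b, x) hx).1)
    hers heN he (hersN ▸ hc) rfl hx' g4 g5 g3 g7 g8 g9 g10 g11 g12 g13 hx g14
  refine ExecR.congr (ExecR.seq h1 (ExecR.seq h2 (ExecR.seq h3 (ExecR.seq
    (exec_move (by decide) _) (ExecR.seq (exec_clear _ _) (exec_move (by decide) _)))))) ?_ ?_
  · cases σ; simp_all [ticks]
  · simp only [Regs.get, Regs.set, g1, List.append_nil, List.length_reverse, hersN, hwsN, hlen,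
      ticks, List.length_replicate]
    ring_nf at hWlen ⊢
    nlinarith [sq_nonneg N]

end QubitBraid

/-! ### Multiplication of descriptions -/

namespace QubitBraid

variable {m n : ℕ}

/-- The image of the word `w` under the conjugation that the images of the Pauli operators in `d`
describe. Products of the form `X Z` in the wrong order do not occur for the descriptions of
interest, so that the phases simply add up. -/
def conjWord (d : Desc m n) (w : PauliWord n) : PauliWord n where
  phase := w.phase + (∑ a, if w.xBits a = 1 then (d.xImg a).phase else 0) +
    ∑ a, if w.zBits a = 1 then (d.zImg a).phase else 0
  xBits b := ∑ a, w.xBits a * (d.xImg a).xBits b + ∑ a, w.zBits a * (d.zImg a).xBits b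
  zBits b := ∑ a, w.xBits a * (d.xImg a).zBits b + ∑ a, w.zBits a * (d.zImg a).zBits b

/-- The first `1` of a bit string. -/
def firstBit (u : Bits n) : Bits n := fun k => (firstOne (List.ofFn u))[k.val]'(by
  rw [firstOne_length, List.length_ofFn]; exact k.isLt)

/-- The last `1` of a bit string. -/
def lastBit (u : Bits n) : Bits n := fun k => (lastOne (List.ofFn u))[k.val]'(by
  rw [lastOne_length, List.length_ofFn]; exact k.isLt)

/-- A table of exponents. -/
abbrev Table (m n : ℕ) : Type := Fin (n + 1) → Fin (n + 1) → Fin (2 * m)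

/-- Add the table `c s tᵀ` to a table. -/
def addRankOne (c : Fin (2 * m)) (s t : Bits n) (e : Table m n) : Table m n :=
  fun k l => if s k = 1 ∧ t l = 1 then e k l + c else e k l

/-- The step of `innerE`: the exponent `c`, with the sign that is given by the phase `p` and the
weight of `v`, is added to the entry that `v` determines. -/
def addEntry (p : Fin 4) (v : Bits n) (c : Fin (2 * m)) (e : Table m n) : Table m n :=
  addRankOne (signed (List.ofFn v) (if p = 2 then -c else c)) (firstBit v) (lastBit v) e

/-- Run through rows of bits together with exponents; the sum of the rows so far determines the
entry to which an exponent is added. -/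
def innerE : Fin 4 → Bits n → Table m n → List (Bits n × Fin (2 * m)) → Table m n
  | _, _, e, [] => e
  | p, v, e, (r, c) :: l => innerE (p + 2) (v + r) (addEntry (p + 2) (v + r) c e) l

/-- Apply `innerE` to the part of every row of a table that lies on or above the diagonal. -/
def outerE : ℕ → Table m n → List (Bits n) → LTable m → Table m n
  | _, e, _, [] => e
  | k, e, rs, er :: ers => outerE (k + 1) (innerE 0 0 e (rs.zip (er.drop k))) rs.tail ers

/-- The product of two descriptions. -/
def mulDesc (d d' : Desc m n) : Desc m n where
  expo := outerE 0 d.expo (List.ofFn fun i => (d.xImg i).xBits)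
    (List.ofFn fun k => List.ofFn (d'.expo k))
  xImg i := conjWord d (d'.xImg i)
  zImg i := conjWord d (d'.zImg i)

/-! ### The product of descriptions in terms of lists -/

theorem zipWith_ofFn {α β γ : Type*} {N : ℕ} (h : α → β → γ) (f : Fin N → α) (g : Fin N → β) :
    List.zipWith h (List.ofFn f) (List.ofFn g) = List.ofFn fun i => h (f i) (g i) := by
  apply List.ext_getElem <;> simp

/-- The word as a phase and a list of bits. -/
def PauliWord.toL (P : PauliWord n) : LWord := (P.phase, List.ofFn P.xBits ++ List.ofFn P.zBits)

/-- The table as the list of its rows. -/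
def ltable (e : Table m n) : LTable m := List.ofFn fun k => List.ofFn (e k)

theorem addBits_eq_zipWith (b : Fin 2) (xs cs : List (Fin 2)) (h : xs.length = cs.length) :
    addBits b xs cs = List.zipWith (fun x c => x + b * c) xs cs := by
  induction cs generalizing xs with
  | nil => cases xs <;> simp_all [addBits]
  | cons c cs ih =>
    cases xs with
    | nil => simp at h
    | cons x xs => simp [addBits, ih xs (by simpa using h)]

theorem addBits_nil (b : Fin 2) (cs : List (Fin 2)) :
    addBits b [] cs = addBits b (List.replicate cs.length 0) cs := by
  induction cs with
  | nil => rfl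
  | cons c cs ih => simp [addBits, List.replicate_succ, ih]

theorem addBits_ofFn {N : ℕ} (b : Fin 2) (f g : Fin N → Fin 2) :
    addBits b (List.ofFn f) (List.ofFn g) = List.ofFn (f + b • g) := by
  rw [addBits_eq_zipWith _ _ _ (by simp), zipWith_ofFn]
  rfl

theorem foldRows_ofFn {N : ℕ} (bs : List (Fin 2)) (rs : List (Fin 4 × (Fin N → Fin 2)))
    (p : Fin 4) (v : Fin N → Fin 2) :
    foldRows (p, List.ofFn v) bs (rs.map fun r => (r.1, List.ofFn r.2)) =
      (p + (List.zipWith (fun b r => if b = 1 then r.1 else 0) bs rs).sum,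
        List.ofFn (v + (List.zipWith (fun b r => b • r.2) bs rs).sum)) := by
  induction bs generalizing rs p v with
  | nil => simp [foldRows]
  | cons b bs ih =>
    cases rs with
    | nil => simp [foldRows]
    | cons r rs =>
      rw [List.map_cons, foldRows, addLWord]
      simp only [addBits_ofFn]
      rw [ih]
      simp only [List.zipWith_cons_cons, List.sum_cons, Prod.mk.injEq, ← add_assoc, and_true]
      split_ifs <;> simp

theorem foldRows_nil_ofFn {N : ℕ} (bs : List (Fin 2)) (rs : List (Fin 4 × (Fin N → Fin 2)))
    (p : Fin 4) (hbs : bs ≠ []) (hrs : rs ≠ []) :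
    foldRows (p, []) bs (rs.map fun r => (r.1, List.ofFn r.2)) =
      (p + (List.zipWith (fun b r => if b = 1 then r.1 else 0) bs rs).sum,
        List.ofFn (List.zipWith (fun b r => b • r.2) bs rs).sum) := by
  have h := foldRows_ofFn bs rs p 0
  rw [zero_add] at h
  rw [← h]
  cases bs with
  | nil => exact absurd rfl hbs
  | cons b bs =>
    cases rs with
    | nil => exact absurd rfl hrs
    | cons r rs =>
      have h2 : addBits b [] (List.ofFn r.2) =
          addBits b (List.ofFn (0 : Fin N → Fin 2)) (List.ofFn r.2) := by
        rw [addBits_nil, List.length_ofFn, ← List.ofFn_const]; rfl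
      simp only [List.map_cons, foldRows, addLWord, h2]

theorem append_add_append {α : Type*} [Add α] {M N : ℕ} (f f' : Fin M → α) (g g' : Fin N → α) :
    Fin.append f g + Fin.append f' g' = Fin.append (f + f') (g + g') := by
  funext i
  refine Fin.addCases (fun i => ?_) (fun i => ?_) i <;> simp

theorem sum_append' {ι α : Type*} [AddCommMonoid α] {M N : ℕ} (s : Finset ι) (f : ι → Fin M → α)
    (g : ι → Fin N → α) :
    ∑ i ∈ s, Fin.append (f i) (g i) = Fin.append (∑ i ∈ s, f i) (∑ i ∈ s, g i) := by
  funext i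
  refine Fin.addCases (fun i => ?_) (fun i => ?_) i <;> simp [Finset.sum_apply]

theorem smul_append {α : Type*} [Mul α] {M N : ℕ} (b : α) (f : Fin M → α) (g : Fin N → α) :
    b • Fin.append f g = Fin.append (b • f) (b • g) := by
  funext i
  refine Fin.addCases (fun i => ?_) (fun i => ?_) i <;> simp

theorem conjLWord_toL (d : Desc m n) (w : PauliWord n) :
    conjLWord ((List.ofFn d.xImg).map PauliWord.toL ++ (List.ofFn d.zImg).map PauliWord.toL)
      w.toL = (conjWord d w).toL := by
  have h1 : (List.ofFn d.xImg).map PauliWord.toL ++ (List.ofFn d.zImg).map PauliWord.toL =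
      (List.ofFn (fun a => ((d.xImg a).phase, Fin.append (d.xImg a).xBits (d.xImg a).zBits)) ++
        List.ofFn (fun a => ((d.zImg a).phase, Fin.append (d.zImg a).xBits (d.zImg a).zBits))).map
        fun r => (r.1, List.ofFn r.2) := by
    simp only [List.map_append, List.map_ofFn]
    congr 2 <;> funext a <;> exact Prod.ext rfl (List.ofFn_fin_append _ _).symm
  rw [conjLWord, h1, PauliWord.toL, foldRows_nil_ofFn _ _ _ (by simp) (by simp),
    List.zipWith_append (by simp only [List.length_ofFn]),
    List.zipWith_append (by simp only [List.length_ofFn])]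
  simp only [zipWith_ofFn, List.sum_append, List.sum_ofFn, smul_append, sum_append',
    append_add_append]
  refine Prod.ext ?_ ?_
  · simp only [PauliWord.toL, conjWord, add_assoc]
  · rw [List.ofFn_fin_append, PauliWord.toL]
    simp only
    congr 2 <;> funext b <;> simp [conjWord, Finset.sum_apply]

theorem firstOne_ofFn (u : Bits n) : firstOne (List.ofFn u) = List.ofFn (firstBit u) :=
  List.ext_getElem (by rw [firstOne_length, List.length_ofFn, List.length_ofFn]) fun i h h' => by
    rw [List.getElem_ofFn]; rfl

theorem lastOne_ofFn (u : Bits n) : lastOne (List.ofFn u) = List.ofFn (lastBit u) :=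
  List.ext_getElem (by rw [lastOne_length, List.length_ofFn, List.length_ofFn]) fun i h h' => by
    rw [List.getElem_ofFn]; rfl

theorem rankOne_ofFn (c : Fin (2 * m)) (s t : Bits n) (e : Table m n) :
    rankOne c (List.ofFn s) (List.ofFn t) (ltable e) = ltable (addRankOne c s t e) := by
  simp only [rankOne, ltable, zipWith_ofFn, addRowL]
  rfl

theorem innerL_ofFn (l : List (Bits n × Fin (2 * m))) :
    ∀ (p : Fin 4) (v : Bits n) (e : Table m n),
      innerL p (List.ofFn v) (ltable e) (l.map fun x => (List.ofFn x.1, x.2)) =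
        ltable (innerE p v e l) := by
  induction l with
  | nil => intro p v e; rfl
  | cons a l ih =>
    intro p v e
    simp only [List.map_cons, innerL, addBits_ofFn, firstOne_ofFn, lastOne_ofFn, rankOne_ofFn,
      one_smul]
    exact ih _ _ _

theorem innerL_nil_ofFn (l : List (Bits n × Fin (2 * m))) (p : Fin 4) (e : Table m n) :
    innerL p [] (ltable e) (l.map fun x => (List.ofFn x.1, x.2)) = ltable (innerE p 0 e l) := by
  rw [← innerL_ofFn]
  cases l with
  | nil => rfl
  | cons a l =>
    have : addBits 1 [] (List.ofFn a.1) = addBits 1 (List.ofFn (0 : Bits n)) (List.ofFn a.1) := by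
      rw [addBits_nil, List.length_ofFn, ← List.ofFn_const]; rfl
    simp only [List.map_cons, innerL, this]

theorem outerL_ofFn (ers : LTable m) : ∀ (k : ℕ) (e : Table m n) (rs : List (Bits n)),
    outerL k (ltable e) (rs.map List.ofFn) ers = ltable (outerE k e rs ers) := by
  induction ers with
  | nil => intro k e rs; rfl
  | cons er ers ih =>
    intro k e rs
    rw [outerL, outerE, ← List.map_tail, ← ih, ← innerL_nil_ofFn, List.zip_map_left]
    rfl

theorem encodePauli_eq (P : PauliWord n) : encodePauli m P = wordS m P.toL := by
  simp [encodePauli, wordS, bitsS, PauliWord.toL]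

theorem encodeDesc_eq (d : Desc m n) :
    encodeDesc m ⟨n, d⟩ = ticks m n ++ Sym.sep :: (tableS (ltable d.expo) ++
      wordsS m ((List.ofFn d.xImg).map PauliWord.toL ++ (List.ofFn d.zImg).map PauliWord.toL)) := by
  have h1 : ∀ f : Fin (n + 1) → PauliWord n, (List.finRange (n + 1)).flatMap
      (fun i => encodePauli m (f i)) = ((List.ofFn f).map PauliWord.toL).flatMap (wordS m) := by
    intro f
    rw [List.ofFn_eq_map, List.map_map, List.flatMap_map]
    exact List.flatMap_congr fun i _ => encodePauli_eq _
  have h2 : (List.finRange (n + 1)).flatMap (fun k => (List.ofFn (d.expo k)).map Sym.expo) =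
      tableS (ltable d.expo) := by
    rw [tableS, ltable, List.ofFn_eq_map, List.flatMap_map]
  rw [encodeDesc]
  simp only [h1, h2, wordsS, List.flatMap_append, List.append_assoc, ticks]

end QubitBraid

/-! ### The machine that multiplies descriptions -/

namespace QubitBraid

open StackProg Turing

variable {m n : ℕ}

/-- The part of the written form of a description that lists the images of the Pauli operators. -/
def descWords (d : Desc m n) : List LWord :=
  (List.ofFn d.xImg).map PauliWord.toL ++ (List.ofFn d.zImg).map PauliWord.toL

theorem encodeDesc_eq' (d : Desc m n) :
    encodeDesc m ⟨n, d⟩ = ticks m n ++ Sym.sep :: (tableS (ltable d.expo) ++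
      wordsS m (descWords d)) := encodeDesc_eq d

@[simp] theorem toL_length (P : PauliWord n) : P.toL.2.length = 2 * (n + 1) := by
  rw [PauliWord.toL, List.length_append, List.length_ofFn, List.length_ofFn]; ring

theorem descWords_length (d : Desc m n) : (descWords d).length = 2 * (n + 1) := by
  rw [descWords, List.length_append, List.length_map, List.length_map, List.length_ofFn,
    List.length_ofFn]; ring

theorem length_of_mem_descWords (d : Desc m n) : ∀ w ∈ descWords d, w.2.length = 2 * (n + 1) := by
  intro w hw
  simp only [descWords, List.mem_append, List.mem_map] at hw
  rcases hw with ⟨P, _, rfl⟩ | ⟨P, _, rfl⟩ <;> exact toL_length P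

theorem ltable_length (e : Table m n) : (ltable e).length = n + 1 := List.length_ofFn

theorem length_of_mem_ltable (e : Table m n) : ∀ r ∈ ltable e, r.length = n + 1 := by
  intro r hr
  obtain ⟨k, rfl⟩ := (List.mem_ofFn' _ _).1 hr
  exact List.length_ofFn

theorem encodeDesc_length_le (d : Desc m n) :
    (encodeDesc m ⟨n, d⟩).length ≤ 8 * (n + 1) ^ 2 := by
  rw [encodeDesc_eq', List.length_append, List.length_cons, List.length_append,
    wordsS_length _ _ (length_of_mem_descWords d), descWords_length,
    tableS_length (n + 1) _ (length_of_mem_ltable _), ltable_length, ticks, List.length_replicate]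
  nlinarith

/-- Multiplication of the descriptions that are written in the registers. -/
theorem exec_mulCore_desc (d d' : Desc m n) (σ : Regs (Sym m)) (hσ : Idle σ)
    (hc : σ.cnt = ticks m (n + 1)) (hl : σ.len = ticks m (n + 1))
    (hp : σ.pauli = wordsS m (descWords d)) (hp' : σ.pauli' = wordsS m (descWords d'))
    (hx : σ.expo = tableS (ltable d.expo)) (hx' : σ.expo' = tableS (ltable d'.expo)) :
    ExecR mulCore σ
      { σ with
        expo := tableS (ltable (mulDesc d d').expo)
        expo' := []
        pauli := wordsS m (descWords (mulDesc d d'))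
        pauli' := [] } (200 * (n + 2) ^ 4) := by
  have hrs : ((List.ofFn fun i => ((d.xImg i).phase, List.ofFn (d.xImg i).xBits,
      List.ofFn (d.xImg i).zBits)).map fun r => (r.1, r.2.1 ++ r.2.2)) =
        (List.ofFn d.xImg).map PauliWord.toL := by
    simp only [List.map_ofFn]; rfl
  have hrs' : ((List.ofFn fun i => ((d.xImg i).phase, List.ofFn (d.xImg i).xBits,
      List.ofFn (d.xImg i).zBits)).map fun r => r.2.1) =
        (List.ofFn fun i => (d.xImg i).xBits).map List.ofFn := by
    simp only [List.map_ofFn]; rfl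
  have h := exec_mulCore (n + 1) (List.ofFn fun i => ((d.xImg i).phase, List.ofFn (d.xImg i).xBits,
      List.ofFn (d.xImg i).zBits)) ((List.ofFn d.zImg).map PauliWord.toL) (descWords d')
    (ltable d.expo) (ltable d'.expo) σ hσ List.length_ofFn
    (by rw [List.length_map, List.length_ofFn])
    (by
      intro r hr
      obtain ⟨k, rfl⟩ := (List.mem_ofFn' _ _).1 hr
      exact ⟨List.length_ofFn, List.length_ofFn⟩)
    (by
      intro r hr
      obtain ⟨P, -, rfl⟩ := List.mem_map.1 hr
      exact toL_length P)
    (length_of_mem_descWords d') (descWords_length d') (ltable_length _) (length_of_mem_ltable _)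
    (ltable_length _) (length_of_mem_ltable _) hc hl (by rw [hrs]; exact hp) hp' hx hx'
  rw [hrs, hrs', outerL_ofFn] at h
  have hw : (descWords d').map (conjLWord ((List.ofFn d.xImg).map PauliWord.toL ++
      (List.ofFn d.zImg).map PauliWord.toL)) = descWords (mulDesc d d') := by
    rw [descWords, descWords, List.map_append, List.map_map, List.map_map]
    simp only [List.map_ofFn]
    have h2 := conjLWord_toL d
    simp only [List.map_ofFn] at h2
    congr 2 <;> funext i <;> exact h2 _
  rw [hw] at h
  exact h

/-- Write the description that is stored in the registers on the output stack. -/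
def print : Prog Reg (Sym m) :=
  move .pauli .acc ;; move .acc .out ;; move .expo .acc ;; move .acc .out ;; .push .out .sep ;;
    .pop .cnt (fun _ => .skip) ;; move .cnt .acc ;; move .acc .out ;; clear .len

theorem exec_print (d : Desc m n) (σ : Regs (Sym m)) (hσ : Idle σ)
    (hc : σ.cnt = ticks m (n + 1)) (hl : σ.len = ticks m (n + 1))
    (hp : σ.pauli = wordsS m (descWords d)) (hx : σ.expo = tableS (ltable d.expo))
    (ho : σ.out = []) :
    ExecR print σ
      { σ with
        cnt := []
        len := []
        expo := []
        pauli := []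
        out := encodeDesc m ⟨n, d⟩ } (32 * (n + 1) ^ 2 + 2 * (n + 1) + 10) := by
  have hlen := encodeDesc_length_le d
  rw [encodeDesc_eq'] at hlen ⊢
  have hc' : σ.cnt = Sym.tick :: ticks m n := hc
  have ha := hσ.acc
  refine ExecR.congr (ExecR.seq (exec_move (by decide) _) (ExecR.seq
    (exec_move (by decide) _) (ExecR.seq (exec_move (by decide) _) (ExecR.seq
    (exec_move (by decide) _) (ExecR.seq (ExecR.push _ _ _) (ExecR.seq
    (ExecR.pop_cons (l := ticks m n) (a := Sym.tick) hc' ExecR.skip) (ExecR.seq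
    (exec_move (by decide) _) (ExecR.seq
    (exec_move (by decide) _) (exec_clear _ _))))))))) ?_ ?_
  · cases σ; simp_all
  · simp only [Regs.get, Regs.set, ha, hl, hp, hx, List.append_nil, List.length_reverse,
      List.length_append, List.length_cons] at hlen ⊢
    simp only [ticks, List.length_replicate] at hlen ⊢
    omega

/-! #### Reading the input -/

theorem Regs.set_set {A : Type} (σ : Regs A) (k : Reg) (x y : List A) :
    (σ.set k x).set k y = σ.set k y := by
  apply Regs.ext_get
  simp only [← Regs.update_get, Function.update_idem]

theorem Regs.set_comm {A : Type} (σ : Regs A) {j k : Reg} (h : j ≠ k) (x y : List A) :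
    (σ.set j x).set k y = (σ.set k y).set j x := by
  apply Regs.ext_get
  simp only [← Regs.update_get, Function.update_comm h]

/-- A loop that treats the symbols of a stack one by one. -/
theorem exec_loop_foldl {A : Type} (k : Reg) (body : A → Prog Reg A) (step : Regs A → A → Regs A)
    (C : ℕ) (hstep : ∀ σ a x, step (σ.set k x) a = (step σ a).set k x)
    (hbody : ∀ σ a, ExecR (body a) σ (step σ a) C) (l : List A) :
    ∀ σ : Regs A, σ.get k = l →
      ExecR (.loop k always body) σ (l.foldl step (σ.set k [])) (l.length * (C + 1) + 1) := by
  induction l with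
  | nil =>
    intro σ hl
    refine ExecR.congr (ExecR.loop_nil hl) ?_ (by simp)
    rw [List.foldl_nil, ← hl, Regs.set_get_self]
  | cons a l ih =>
    intro σ hl
    refine ExecR.congr (ExecR.loop_cons hl rfl (hbody _ a) (ih _ ?_)) ?_ ?_
    · rw [hstep, Regs.get_set_self]
    · rw [List.foldl_cons, ← hstep, Regs.set_set]
    · simp only [List.length_cons]; ring_nf; omega

theorem foldl_push {A : Type} (k : Reg) (step : Regs A → A → Regs A) (P : Regs A → Prop)
    (hP : ∀ σ x, P σ → P (σ.set k x)) (l : List A)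
    (h : ∀ a ∈ l, ∀ σ, P σ → step σ a = σ.set k (a :: σ.get k)) :
    ∀ σ, P σ → l.foldl step σ = σ.set k (l.reverse ++ σ.get k) := by
  induction l with
  | nil => intro σ _; exact (Regs.set_get_self σ k).symm
  | cons a l ih =>
    intro σ hσ
    rw [List.foldl_cons, h a (by simp) σ hσ, ih (fun a ha => h a (by simp [ha])) _ (hP _ _ hσ),
      Regs.get_set_self, Regs.set_set, List.reverse_cons, List.append_assoc,
      List.singleton_append]

/-- The stack for a symbol of a description. The descriptions are read backwards, and the flag
tells whether this symbol belongs to the second one or, for a tick, to the first one. -/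
def target (flag : Bool) : Sym m → Reg
  | .tick => if flag then .cnt else .len
  | .expo _ => if flag then .expo' else .expo
  | _ => if flag then .pauli' else .pauli

/-- Put a symbol of the input on its stack. The stack `marks` serves as the flag, which a
separator toggles. -/
def sortSym (y : Sym m) : Prog Reg (Sym m) :=
  .pop .marks fun o =>
    if y = .sep then o.elim (.push .marks y) fun _ => .skip
    else o.elim (.push (target true y) y) fun x => .push .marks x ;; .push (target false y) y

/-- The effect of `sortSym`. -/
def sortStep (σ : Regs (Sym m)) (y : Sym m) : Regs (Sym m) :=
  if y = .sep then { σ with marks := if σ.marks = [] then [y] else σ.marks.tail }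
  else σ.set (target (σ.marks = []) y) (y :: σ.get (target (σ.marks = []) y))

theorem exec_sortSym (σ : Regs (Sym m)) (y : Sym m) :
    ExecR (sortSym y) σ (sortStep σ y) 3 := by
  cases hm : σ.marks with
  | nil =>
    by_cases hy : y = .sep
    · subst hy
      exact ExecR.congr (ExecR.pop_nil hm (by
        rw [if_pos rfl]; exact ExecR.push ..)) (by simp [sortStep, hm]) (by norm_num)
    · exact ExecR.congr (ExecR.pop_nil hm (by
        rw [if_neg hy]; exact ExecR.push ..))
          (by simp only [sortStep, hm, hy, if_false, decide_true]) (by norm_num)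
  | cons x l =>
    by_cases hy : y = .sep
    · subst hy
      exact ExecR.congr (ExecR.pop_cons hm (by
        rw [if_pos rfl]; exact ExecR.skip)) (by simp [sortStep, hm]) (by norm_num)
    · refine ExecR.congr (ExecR.pop_cons hm (by
        rw [if_neg hy]; exact ExecR.seq (ExecR.push ..) (ExecR.push ..))) ?_ (by norm_num)
      have h : ({ σ with marks := l } : Regs (Sym m)).set .marks (x :: l) = σ := by
        cases σ; simp_all
      simp only [sortStep, hm, hy, if_false, reduceCtorEq, decide_false]
      change ((({ σ with marks := l } : Regs (Sym m)).set .marks (x :: l))).set _ _ = _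
      rw [h]
      change σ.set _ (y :: ((({ σ with marks := l } : Regs (Sym m)).set .marks (x :: l))).get _) = _
      rw [h]

theorem sortStep_set_inp (σ : Regs (Sym m)) (y : Sym m) (x : List (Sym m)) :
    sortStep (σ.set .inp x) y = (sortStep σ y).set .inp x := by
  by_cases hy : y = .sep
  · simp [sortStep, hy]
  · have h : ∀ flag, target flag y ≠ .inp := by
      intro flag; cases y <;> cases flag <;> simp [target]
    rw [sortStep, sortStep, if_neg hy, if_neg hy]
    change (σ.set .inp x).set (target (σ.marks = []) y) _ = _
    rw [Regs.get_set_ne _ (h _), ← Regs.set_comm _ (h _).symm]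
    rfl

theorem foldl_sortStep (flag : Bool) (k : Reg) (hk : k ≠ .marks) (l : List (Sym m))
    (h : ∀ y ∈ l, y ≠ .sep ∧ target flag y = k) (σ : Regs (Sym m))
    (hσ : decide (σ.marks = []) = flag) :
    l.foldl sortStep σ = σ.set k (l.reverse ++ σ.get k) := by
  refine foldl_push k sortStep (fun σ => decide (σ.marks = []) = flag) ?_ l ?_ σ hσ
  · intro σ x hσ
    have : (σ.set k x).marks = σ.marks := Regs.get_set_ne σ hk.symm x
    rwa [this]
  · intro y hy σ hσ
    rw [sortStep, if_neg (h y hy).1, hσ, (h y hy).2]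

theorem mem_tableS (e : LTable m) : ∀ y ∈ (tableS e).reverse, ∃ c, y = Sym.expo c := by
  intro y hy
  simp only [tableS, List.mem_reverse, List.mem_flatMap, List.mem_map] at hy
  obtain ⟨_, _, c, _, rfl⟩ := hy
  exact ⟨c, rfl⟩

theorem mem_wordsS (ws : List LWord) :
    ∀ y ∈ (wordsS m ws).reverse, (∃ p, y = Sym.phase p) ∨ ∃ b, y = Sym.bit b := by
  intro y hy
  simp only [wordsS, wordS, bitsS, List.mem_reverse, List.mem_flatMap, List.mem_cons,
    List.mem_map] at hy
  obtain ⟨_, _, rfl | ⟨b, _, rfl⟩⟩ := hy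
  · exact .inl ⟨_, rfl⟩
  · exact .inr ⟨b, rfl⟩

/-- Reading one description backwards. -/
theorem foldl_sortStep_desc (flag : Bool) (d : Desc m n) (σ : Regs (Sym m))
    (hσ : decide (σ.marks = []) = flag) (hm : σ.marks = [] ∨ σ.marks = [.sep]) :
    (encodeDesc m ⟨n, d⟩).reverse.foldl sortStep σ =
      if flag then
        { σ with
          pauli' := wordsS m (descWords d) ++ σ.pauli'
          expo' := tableS (ltable d.expo) ++ σ.expo'
          marks := [.sep]
          len := ticks m n ++ σ.len }
      else
        { σ with
          pauli := wordsS m (descWords d) ++ σ.pauli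
          expo := tableS (ltable d.expo) ++ σ.expo
          marks := []
          cnt := ticks m n ++ σ.cnt } := by
  have ht : (ticks m n).reverse = ticks m n := by simp [ticks]
  have h1 : ∀ (flag : Bool), ∀ y ∈ (wordsS m (descWords d)).reverse,
      y ≠ .sep ∧ target flag y = if flag then .pauli' else .pauli := by
    intro flag y hy
    rcases mem_wordsS _ y hy with ⟨p, rfl⟩ | ⟨b, rfl⟩ <;> simp [target]
  have h2 : ∀ (flag : Bool), ∀ y ∈ (tableS (ltable d.expo)).reverse,
      y ≠ .sep ∧ target flag y = if flag then .expo' else .expo := by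
    intro flag y hy
    obtain ⟨p, rfl⟩ := mem_tableS _ y hy; simp [target]
  have h3 : ∀ (flag : Bool), ∀ y ∈ ticks m n,
      y ≠ .sep ∧ target flag y = if flag then .cnt else .len := by
    intro flag y hy
    obtain rfl := List.eq_of_mem_replicate hy; simp [target]
  rw [encodeDesc_eq']
  simp only [List.reverse_append, List.reverse_cons, List.foldl_append, List.foldl_cons,
    List.foldl_nil, ht]
  cases flag with
  | true =>
    obtain hm := of_decide_eq_true hσ
    rw [foldl_sortStep true _ (by simp) _ (h1 true) σ hσ]
    rw [foldl_sortStep true _ (by simp) _ (h2 true) _ (by simpa using hm)]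
    rw [foldl_sortStep false _ (by simp) _ (h3 false) _ (by simp [sortStep, hm])]
    simp [sortStep, hm, ht]
  | false =>
    obtain hm : σ.marks = [.sep] := by simpa [of_decide_eq_false hσ] using hm
    rw [foldl_sortStep false _ (by simp) _ (h1 false) σ hσ]
    rw [foldl_sortStep false _ (by simp) _ (h2 false) _ (by simp [hm])]
    rw [foldl_sortStep true _ (by simp) _ (h3 true) _ (by simp [sortStep, hm])]
    simp [sortStep, hm, ht]

/-- Read two descriptions and write down their product. -/
def mulProg (m : ℕ) : Prog Reg (Sym m) :=
  .loop .inp always sortSym ;; .push .cnt .tick ;; .push .len .tick ;; mulCore ;; print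

theorem exec_mulProg (p : Σ n, Desc m n × Desc m n) :
    ExecR (mulProg m) (Regs.empty.set .inp (encodePair m p).reverse)
      (Regs.empty.set .out (encodeDesc m ⟨p.1, mulDesc p.2.1 p.2.2⟩))
      (200 * (p.1 + 2) ^ 4 + 32 * (p.1 + 1) ^ 2 + 2 * (p.1 + 1) + 13 +
        4 * (encodePair m p).length) := by
  obtain ⟨n, d, d'⟩ := p
  have h1 := exec_loop_foldl .inp sortSym sortStep 3 (fun σ a x => sortStep_set_inp σ a x)
    exec_sortSym (encodePair m ⟨n, d, d'⟩).reverse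
    (Regs.empty.set .inp (encodePair m ⟨n, d, d'⟩).reverse) rfl
  have h2 : (encodePair m ⟨n, d, d'⟩).reverse.foldl sortStep
      ((Regs.empty.set .inp (encodePair m ⟨n, d, d'⟩).reverse).set .inp []) =
      { (Regs.empty : Regs (Sym m)) with
        cnt := ticks m n
        len := ticks m n
        expo := tableS (ltable d.expo)
        pauli := wordsS m (descWords d)
        expo' := tableS (ltable d'.expo)
        pauli' := wordsS m (descWords d') } := by
    simp only [encodePair, List.reverse_append, List.foldl_append]
    rw [foldl_sortStep_desc true d' _ rfl (.inl rfl),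
      foldl_sortStep_desc false d _ rfl (.inr rfl)]
    simp [Regs.empty]
  rw [h2] at h1
  have h3 := exec_mulCore_desc d d'
    { (Regs.empty : Regs (Sym m)) with
      cnt := ticks m (n + 1)
      len := ticks m (n + 1)
      expo := tableS (ltable d.expo)
      pauli := wordsS m (descWords d)
      expo' := tableS (ltable d'.expo)
      pauli' := wordsS m (descWords d') }
    ⟨rfl, rfl, rfl, rfl, rfl, rfl, rfl, rfl, rfl, rfl, rfl, rfl, rfl, rfl⟩ rfl rfl rfl rfl rfl rfl
  have h4 := exec_print (mulDesc d d')
    { (Regs.empty : Regs (Sym m)) with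
      cnt := ticks m (n + 1)
      len := ticks m (n + 1)
      expo := tableS (ltable (mulDesc d d').expo)
      pauli := wordsS m (descWords (mulDesc d d')) }
    ⟨rfl, rfl, rfl, rfl, rfl, rfl, rfl, rfl, rfl, rfl, rfl, rfl, rfl, rfl⟩ rfl rfl rfl rfl rfl
  refine ExecR.congr (ExecR.seq h1 (ExecR.seq (ExecR.push ..) (ExecR.seq (ExecR.push ..)
    (ExecR.seq h3 h4)))) ?_ ?_
  · simp [Regs.empty]
  · rw [List.length_reverse]; simp only; omega

theorem length_le_encodePair (p : Σ n, Desc m n × Desc m n) : p.1 ≤ (encodePair m p).length := by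
  simp only [encodePair, encodeDesc, List.length_append, List.length_replicate]; omega

/-- The quartic term comes from the exponents: each of the `O(n²)` exponents of the second factor
costs one sweep over the `O(n²)` entries of the first table. -/
theorem mul_computable (m : ℕ) :
    Nonempty (TM2ComputableInPolyTime (encodePair m) (encodeDesc m)
      (fun p => ⟨p.1, mulDesc p.2.1 p.2.2⟩)) := by
  refine Exec.computable id (mulProg m) .inp .out (encodePair m) (encodeDesc m) _
    (200 * (.X + 2) ^ 4 + 32 * (.X + 1) ^ 2 + 2 * (.X + 1) + 13 + 4 * .X) fun p => ?_
  have h := exec_mulProg p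
  have hl := length_le_encodePair p
  rw [ExecR, ← Regs.update_get, ← Regs.update_get, Regs.get_empty] at h
  rw [List.map_id]
  refine h.mono ?_
  simp only [Polynomial.eval_add, Polynomial.eval_mul, Polynomial.eval_pow, Polynomial.eval_X,
    Polynomial.eval_ofNat, Polynomial.eval_one]
  gcongr

end QubitBraid

/-! ### Writing down the description of a generator -/

namespace QubitBraid

open StackProg Turing

variable {m n : ℕ}

/-- The description of `exp(π i S_{c,c} / m) ^ e` times a Clifford generator with centre `c`. The
function `t` takes the value `2` at the centre, `1` at its neighbours and `0` elsewhere; if it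
vanishes, then this describes the identity. -/
def genDesc [NeZero m] (t : Fin (n + 1) → Fin 4) (e : Fin (2 * m)) : Desc m n where
  expo k l := if t k = 2 ∧ t l = 2 then e else 0
  xImg i := ⟨if m = 3 ∧ t i = 1 then 2 else 0,
    fun a => if i = a ∨ (t i = 1 ∧ t a = 2) then 1 else 0, 0⟩
  zImg i := ⟨0, 0, fun a => if i = a ∨ (t i = 2 ∧ t a = 1) then 1 else 0⟩

/-- The number in a phase symbol. -/
def level : Sym m → Fin 4
  | .phase p => p
  | _ => 0

/-- Move the stack `j` to the stack `k`, and write its image under `g` to the stack `dst`. -/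
def copyMap (j k dst : Reg) (g : Fin 4 → Sym m) : Prog Reg (Sym m) :=
  .loop j always fun s => .push k s ;; .push dst (g (level s))

theorem exec_copyMap {j k dst : Reg} (hjk : j ≠ k) (hj : j ≠ dst) (hk : k ≠ dst)
    (g : Fin 4 → Sym m) (l : List (Fin 4)) :
    ∀ σ : Regs (Sym m), σ.get j = l.map Sym.phase →
      ExecR (copyMap j k dst g) σ
        (((σ.set j []).set k ((l.map Sym.phase).reverse ++ σ.get k)).set dst
          ((l.map g).reverse ++ σ.get dst)) (3 * l.length + 1) := by
  induction l with
  | nil =>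
    intro σ hl
    refine ExecR.congr (ExecR.loop_nil hl) ?_ (by simp)
    have h1 : σ.set j [] = σ := by
      have := Regs.set_get_self σ j
      rwa [hl] at this
    rw [h1]
    simp only [List.map_nil, List.reverse_nil, List.nil_append, Regs.set_get_self]
  | cons a l ih =>
    intro σ hl
    refine ExecR.congr (ExecR.loop_cons hl rfl (ExecR.seq (ExecR.push ..) (ExecR.push ..))
      (ih _ ?_)) ?_ ?_
    · rw [Regs.get_set_ne _ hj, Regs.get_set_ne _ hjk, Regs.get_set_self]
    · apply Regs.ext_get
      funext i
      simp only [← Regs.update_get, Function.update_apply, List.map_cons, List.reverse_cons,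
        List.append_assoc, List.singleton_append, level, hk, hk.symm, hjk.symm, hj.symm, if_false,
        if_true]
      split_ifs <;> rfl
    · simp only [List.length_cons]; omega

/-- The row that `g` gives: the marks before the current one are listed backwards in `A`, those
after it in `B`. -/
def rowL (g : Fin 4 → Bool → Sym m) (A : List (Fin 4)) (t : Fin 4) (B : List (Fin 4)) :
    List (Sym m) :=
  A.reverse.map (g · false) ++ g t true :: B.map (g · false)

/-- Write the row that `g` gives. -/
def emitRow (dst : Reg) (g : Fin 4 → Bool → Sym m) (t : Fin 4) : Prog Reg (Sym m) :=
  move .pre .acc ;; copyMap .acc .pre dst (g · false) ;; .push dst (g t true) ;;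
    copyMap .marks .acc dst (g · false) ;; move .acc .marks

/-- The stacks to which descriptions are written. -/
def IsTarget (dst : Reg) : Prop := dst = .expo' ∨ dst = .pauli'

theorem exec_emitRow {dst : Reg} (hd : IsTarget dst) (g : Fin 4 → Bool → Sym m) (t : Fin 4)
    (A B : List (Fin 4)) (σ : Regs (Sym m)) (hA : σ.marks = A.map Sym.phase)
    (hB : σ.pre = B.map Sym.phase) (ha : σ.acc = []) :
    ExecR (emitRow dst g t) σ (σ.set dst (rowL g A t B ++ σ.get dst))
      (5 * (A.length + B.length) + 5) := by
  have h1 := exec_move (j := .pre) (k := .acc) (by decide) σ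
  have h2 := exec_copyMap (j := .acc) (k := .pre) (dst := dst) (by decide)
    (by rcases hd with rfl | rfl <;> decide) (by rcases hd with rfl | rfl <;> decide) (g · false)
    B.reverse ((σ.set .pre []).set .acc ((σ.get .pre).reverse ++ σ.get .acc))
    (by simp [hB, ha])
  refine ExecR.congr (ExecR.seq h1 (ExecR.seq h2 (ExecR.seq (ExecR.push ..) (ExecR.seq
    (exec_copyMap (j := .marks) (k := .acc) (dst := dst) (by decide)
    (by rcases hd with rfl | rfl <;> decide) (by rcases hd with rfl | rfl <;> decide) (g · false)
    A _ ?_) (exec_move (by decide) _))))) ?_ ?_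
  · rcases hd with rfl | rfl <;> simpa using hA
  · rcases hd with rfl | rfl <;> cases σ <;> simp_all [rowL]
  · rcases hd with rfl | rfl <;> simp [hB] <;> omega

/-- Concatenate what `F` gives for every position in a list of marks. -/
def blocks (F : List (Fin 4) → Fin 4 → List (Fin 4) → List (Sym m)) :
    List (Fin 4) → List (Fin 4) → List (Sym m)
  | [], _ => []
  | t :: A, B => blocks F A (t :: B) ++ F A t B

/-- Run `blk` for every mark. -/
def emitBlocks (blk : Fin 4 → Prog Reg (Sym m)) : Prog Reg (Sym m) :=
  .loop .marks always (fun s => blk (level s) ;; .push .pre s) ;; move .pre .marks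

theorem exec_emitBlocks {dst : Reg} (hd : IsTarget dst) (blk : Fin 4 → Prog Reg (Sym m))
    (F : List (Fin 4) → Fin 4 → List (Fin 4) → List (Sym m)) (N C : ℕ)
    (hblk : ∀ (A : List (Fin 4)) (t : Fin 4) (B : List (Fin 4)) (σ : Regs (Sym m)),
      σ.marks = A.map Sym.phase → σ.pre = B.map Sym.phase → σ.acc = [] →
      A.length + B.length + 1 = N →
      ExecR (blk t) σ (σ.set dst (F A t B ++ σ.get dst)) C)
    (T : List (Fin 4)) (hT : T.length = N) (σ : Regs (Sym m)) (hm : σ.marks = T.map Sym.phase)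
    (hp : σ.pre = []) (ha : σ.acc = []) :
    ExecR (emitBlocks blk) σ (σ.set dst (blocks F T [] ++ σ.get dst)) (N * (C + 4) + 2) := by
  have key : ∀ (A B : List (Fin 4)) (σ : Regs (Sym m)), σ.marks = A.map Sym.phase →
      σ.pre = B.map Sym.phase → σ.acc = [] → A.length + B.length = N →
      ExecR (.loop .marks always (fun s => blk (level s) ;; .push .pre s)) σ
        (({ σ with marks := [], pre := (A.reverse ++ B).map Sym.phase } : Regs (Sym m)).set dst
          (blocks F A B ++ σ.get dst)) (A.length * (C + 2) + 1) := by
    intro A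
    induction A with
    | nil =>
      intro B σ hA hB ha _
      refine ExecR.congr (ExecR.loop_nil hA) ?_ (by simp)
      rcases hd with rfl | rfl <;> cases σ <;> simp_all [blocks]
    | cons t A ih =>
      intro B σ hA hB ha hN
      rw [List.length_cons] at hN
      refine ExecR.congr (ExecR.loop_cons hA rfl (ExecR.seq
        (hblk A t B _ rfl hB ha (by omega)) (ExecR.push ..)) (ih (t :: B) _ ?_ ?_ ?_ ?_)) ?_ ?_
      · rcases hd with rfl | rfl <;> rfl
      · rcases hd with rfl | rfl <;> simp [hB]
      · rcases hd with rfl | rfl <;> simp [ha]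
      · rw [List.length_cons]; omega
      · rcases hd with rfl | rfl <;> simp [blocks]
      · simp only [List.length_cons]; ring_nf; omega
  have h1 := key T [] σ hm hp ha (by simpa using hT)
  refine ExecR.congr (ExecR.seq h1 (exec_move (by decide) _)) ?_ ?_
  · rcases hd with rfl | rfl <;> cases σ <;> simp_all
  · rcases hd with rfl | rfl <;> simp [hT] <;> ring_nf <;> omega

/-- A bit that is set on the diagonal, and where the marks are `p` and `q`. -/
def markBit (p q t s : Fin 4) (diag : Bool) : Fin 2 := if diag =
    true ∨ (t = p ∧ s = q) then 1 else 0

/-- Write the image of a Pauli operator `X`. -/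
def emitX (t : Fin 4) : Prog Reg (Sym m) :=
  emitRow .pauli' (fun _ _ => .bit 0) t ;;
    emitRow .pauli' (fun s diag => .bit (markBit 1 2 t s diag)) t ;;
    .push .pauli' (.phase (if m = 3 ∧ t = 1 then 2 else 0))

/-- Write the image of a Pauli operator `Z`. -/
def emitZ (t : Fin 4) : Prog Reg (Sym m) :=
  emitRow .pauli' (fun s diag => .bit (markBit 2 1 t s diag)) t ;;
    emitRow .pauli' (fun _ _ => .bit 0) t ;; .push .pauli' (.phase 0)

/-- The exponent in the table of a generator. -/
def markExpo [NeZero m] (e : Fin (2 * m)) (t s : Fin 4) : Fin (2 * m) :=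
  if t = 2 ∧ s = 2 then e else 0

/-- Write the description of a generator whose marks are given. -/
def emit [NeZero m] (e : Fin (2 * m)) : Prog Reg (Sym m) :=
  emitBlocks emitZ ;; emitBlocks emitX ;;
    emitBlocks fun t => emitRow .expo' (fun s _ => .expo (markExpo e t s)) t

theorem exec_emit [NeZero m] (e : Fin (2 * m)) (N : ℕ) (T : List (Fin 4)) (hT : T.length = N)
    (σ : Regs (Sym m)) (hm : σ.marks = T.map Sym.phase) (hp : σ.pre = []) (ha : σ.acc = []) :
    ExecR (emit e) σ
      { σ with
        expo' := blocks (fun A t B => rowL (fun s _ => .expo (markExpo e t s)) A t B) T [] ++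
          σ.expo'
        pauli' := blocks (fun A t B => .phase (if m = 3 ∧ t = 1 then 2 else 0) ::
              (rowL (fun s diag => .bit (markBit 1 2 t s diag)) A t B ++
                rowL (fun _ _ => .bit 0) A t B)) T [] ++
            (blocks (fun A t B => .phase 0 :: (rowL (fun _ _ => .bit 0) A t B ++
                rowL (fun s diag => .bit (markBit 2 1 t s diag)) A t B)) T [] ++ σ.pauli') }
      (25 * N ^ 2 + 14 * N + 6) := by
  have hZ := exec_emitBlocks (m := m) (dst := .pauli') (.inr rfl) emitZ
    (fun A t B => .phase 0 :: (rowL (fun _ _ => .bit 0) A t B ++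
      rowL (fun s diag => .bit (markBit 2 1 t s diag)) A t B)) N (10 * N + 1) (by
        intro A t B σ hA hB ha hN
        refine ExecR.congr (ExecR.seq (exec_emitRow (.inr rfl) _ t A B σ hA hB ha) (ExecR.seq
          (exec_emitRow (.inr rfl) _ t A B _ hA hB ha) (ExecR.push ..))) ?_ ?_
        · simp
        · omega) T hT
  have hX := exec_emitBlocks (m := m) (dst := .pauli') (.inr rfl) emitX
    (fun A t B => .phase (if m = 3 ∧ t = 1 then 2 else 0) ::
      (rowL (fun s diag => .bit (markBit 1 2 t s diag)) A t B ++
        rowL (fun _ _ => .bit 0) A t B)) N (10 * N + 1) (by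
        intro A t B σ hA hB ha hN
        refine ExecR.congr (ExecR.seq (exec_emitRow (.inr rfl) _ t A B σ hA hB ha) (ExecR.seq
          (exec_emitRow (.inr rfl) _ t A B _ hA hB ha) (ExecR.push ..))) ?_ ?_
        · simp
        · omega) T hT
  have hE := exec_emitBlocks (m := m) (dst := .expo') (.inl rfl)
    (fun t => emitRow .expo' (fun s _ => .expo (markExpo e t s)) t)
    (fun A t B => rowL (fun s _ => .expo (markExpo e t s)) A t B) N (5 * N) (by
        intro A t B σ hA hB ha hN
        exact ExecR.congr (exec_emitRow (.inl rfl) _ t A B σ hA hB ha) rfl (by omega)) T hT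
  refine ExecR.congr (ExecR.seq (hZ σ hm hp ha) (ExecR.seq (hX _ hm hp ha) (hE _ hm hp ha))) ?_ ?_
  · simp
  · ring_nf; omega

/-! #### The emitted strings are the descriptions of the generators -/

theorem rowL_ofFn {α : Type*} (N : ℕ) (τ : Fin N → Fin 4) (g : Fin 4 → Bool → α) (i : Fin N)
    (A B : List (Fin 4)) (hA : A.reverse = (List.ofFn τ).take i)
    (hB : B = (List.ofFn τ).drop (i + 1)) :
    A.reverse.map (g · false) ++ g (τ i) true :: B.map (g · false) =
      List.ofFn fun j => g (τ j) (decide (i = j)) := by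
  have hl : A.length = i := by
    have := congrArg List.length hA
    simpa [i.isLt.le] using this
  subst hB
  rw [hA]
  apply List.ext_getElem
  · simp; omega
  · intro j h1 h2
    simp only [List.length_ofFn] at h2
    rw [List.getElem_ofFn, List.getElem_append]
    split_ifs with h
    · simp only [List.length_map, List.length_take, List.length_ofFn] at h
      have hne : ¬ i = ⟨j, h2⟩ := by intro h'; rw [Fin.ext_iff] at h'; simp at h'; omega
      simp [hne]
    · simp only [List.length_map, List.length_take, List.length_ofFn] at h
      rw [List.getElem_cons]
      split_ifs with h'
      · simp only [List.length_map, List.length_take, List.length_ofFn] at h'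
        have he : i = ⟨j, h2⟩ := by rw [Fin.ext_iff]; simp; omega
        simp [← he]
      · simp only [List.length_map, List.length_take, List.length_ofFn] at h'
        have hne : ¬ i = ⟨j, h2⟩ := by intro h'; rw [Fin.ext_iff] at h'; simp at h'; omega
        have hj : i.val + 1 + (j - i.val - 1) = j := by omega
        simp [hne, hj]

theorem blocks_ofFn (N : ℕ) (τ : Fin N → Fin 4)
    (F : List (Fin 4) → Fin 4 → List (Fin 4) → List (Sym m)) (f : Fin N → List (Sym m))
    (hF : ∀ (i : Fin N) (A B : List (Fin 4)), A.reverse = (List.ofFn τ).take i →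
      B = (List.ofFn τ).drop (i + 1) → F A (τ i) B = f i) :
    blocks F (List.ofFn τ).reverse [] = (List.finRange N).flatMap f := by
  have key : ∀ k ≤ N, blocks F ((List.ofFn τ).take k).reverse ((List.ofFn τ).drop k) =
      ((List.finRange N).take k).flatMap f := by
    intro k
    induction k with
    | zero => simp [blocks]
    | succ k ih =>
      intro hk
      have h1 : (List.ofFn τ).take (k + 1) = (List.ofFn τ).take k ++ [τ ⟨k, hk⟩] := by
        rw [List.take_succ_eq_append_getElem (by simpa using hk), List.getElem_ofFn]
      have h2 : (List.finRange N).take (k + 1) = (List.finRange N).take k ++ [⟨k, hk⟩] := by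
        rw [List.take_succ_eq_append_getElem (by simpa using hk), List.getElem_finRange]
        rfl
      have h3 : τ ⟨k, hk⟩ :: (List.ofFn τ).drop (k + 1) = (List.ofFn τ).drop k := by
        rw [List.drop_eq_getElem_cons (i := k) (by simpa using hk), List.getElem_ofFn]
      rw [h1, h2, List.reverse_append, List.reverse_singleton, List.singleton_append, blocks, h3,
        ih (by omega), List.flatMap_append,
        hF ⟨k, hk⟩ _ _ (List.reverse_reverse _) rfl]
      simp
  have := key N le_rfl
  rwa [List.take_of_length_le (by simp), List.take_of_length_le (by simp),
    List.drop_of_length_le (by simp)] at this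

theorem flatMap_ofFn {α β : Type*} {N : ℕ} (f : Fin N → α) (g : α → List β) :
    (List.ofFn f).flatMap g = (List.finRange N).flatMap fun i => g (f i) := by
  rw [List.ofFn_eq_map, List.flatMap_map]

theorem exec_emit_genDesc [NeZero m] (e : Fin (2 * m)) (τ : Fin (n + 1) → Fin 4)
    (σ : Regs (Sym m)) (hm : σ.marks = (List.ofFn τ).reverse.map Sym.phase) (hp : σ.pre = [])
    (ha : σ.acc = []) (hx : σ.expo' = []) (hq : σ.pauli' = []) :
    ExecR (emit e) σ
      { σ with
        expo' := tableS (ltable (genDesc τ e).expo)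
        pauli' := wordsS m (descWords (genDesc τ e)) } (25 * (n + 1) ^ 2 + 14 * (n + 1) + 6) := by
  have h := exec_emit e (n + 1) (List.ofFn τ).reverse
    (by rw [List.length_reverse, List.length_ofFn]) σ hm hp ha
  refine ExecR.congr h ?_ le_rfl
  have h0 : ∀ (i : Fin (n + 1)) (A B : List (Fin 4)), A.reverse = (List.ofFn τ).take i →
      B = (List.ofFn τ).drop (i + 1) →
      rowL (fun _ _ => (.bit 0 : Sym m)) A (τ i) B =
        (List.ofFn (0 : Fin (n + 1) → Fin 2)).map Sym.bit := by
    intro i A B hA hB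
    rw [rowL, rowL_ofFn (n + 1) τ (fun _ _ => (.bit 0 : Sym m)) i A B hA hB, List.map_ofFn]
    rfl
  have h1 : ∀ (p q : Fin 4) (i : Fin (n + 1)) (A B : List (Fin 4)),
      A.reverse = (List.ofFn τ).take i → B = (List.ofFn τ).drop (i + 1) →
      rowL (fun s diag => (.bit (markBit p q (τ i) s diag) : Sym m)) A (τ i) B =
        (List.ofFn fun a => if i = a ∨ (τ i = p ∧ τ a = q) then (1 : Fin 2) else 0).map Sym.bit :=
          by
    intro p q i A B hA hB
    rw [rowL, rowL_ofFn (n + 1) τ (fun s diag => (.bit (markBit p q (τ i) s diag) : Sym m)) i A B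
      hA hB, List.map_ofFn]
    congr 1
    funext a
    simp [markBit]
  rw [hx, hq, List.append_nil, List.append_nil]
  congr 1
  · rw [tableS, ltable, flatMap_ofFn]
    apply blocks_ofFn
    intro i A B hA hB
    rw [rowL, rowL_ofFn (n + 1) τ (fun s _ => (.expo (markExpo e (τ i) s) : Sym m)) i A B hA hB,
      List.map_ofFn]
    rfl
  · rw [wordsS, descWords, List.flatMap_append, List.flatMap_map, List.flatMap_map, flatMap_ofFn,
      flatMap_ofFn]
    congr 1
    · apply blocks_ofFn
      intro i A B hA hB
      rw [h0 i A B hA hB, h1 1 2 i A B hA hB]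
      simp only [wordS, bitsS, PauliWord.toL, List.map_append]
      rfl
    · apply blocks_ofFn
      intro i A B hA hB
      rw [h0 i A B hA hB, h1 2 1 i A B hA hB]
      simp only [wordS, bitsS, PauliWord.toL, List.map_append]
      rfl

end QubitBraid

/-! ### The machine that evaluates braids -/

namespace QubitBraid

open StackProg Turing

variable {m n : ℕ}

/-- The marks for the generator `σ_{i+1}`: its Clifford part has its centre at the qubit with index
`i + 1`, counted from `0`. -/
def genMarks (i : Fin (n - 1)) (a : Fin (n + 1)) : Fin 4 :=
  if a.val = i.val + 1 then 2 else if a.val = i.val ∨ a.val = i.val + 2 then 1 else 0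

/-- The description of a braid, where `e true` and `e false` are the exponents for a generator and
its inverse. -/
def imgDesc [NeZero m] (e : Bool → Fin (2 * m)) (w : BraidWord n) : Desc m n :=
  w.foldl (fun d p => mulDesc d (genDesc (genMarks p.1) (e p.2))) (genDesc (fun _ => 0) 0)

/-- Push the mark `0` on `marks` for every symbol of `j`. -/
def pushZeros (j : Reg) : Prog Reg (Sym m) := .loop j always fun _ => .push .marks (.phase 0)

/-- Set up the marks for the identity. -/
def zeroMarks : Prog Reg (Sym m) :=
  (.loop .cnt always fun y => .push .cnt' y ;; .push .marks (.phase 0)) ;; move .cnt' .cnt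

theorem exec_zeroMarks (N : ℕ) (σ : Regs (Sym m)) (hc : σ.cnt = ticks m N) (hc' : σ.cnt' = [])
    (hm : σ.marks = []) :
    ExecR zeroMarks σ { σ with marks := (List.replicate N (Sym.phase 0)) } (6 * N + 3) := by
  have key : ∀ (N : ℕ) (σ : Regs (Sym m)), σ.cnt = ticks m N →
      ExecR (.loop .cnt always fun y => .push .cnt' y ;; .push .marks (.phase 0)) σ
        { σ with
          cnt := []
          cnt' := ticks m N ++ σ.cnt'
          marks := List.replicate N (Sym.phase 0) ++ σ.marks } (3 * N + 1) := by
    intro N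
    induction N with
    | zero =>
      intro σ hc
      refine ExecR.congr (ExecR.loop_nil hc) ?_ (by simp)
      cases σ; simp_all [ticks]
    | succ N ih =>
      intro σ hc
      have hc' : σ.cnt = Sym.tick :: ticks m N := hc
      refine ExecR.congr (ExecR.loop_cons hc' rfl (ExecR.seq (ExecR.push ..) (ExecR.push ..))
        (ih _ rfl)) ?_ ?_
      · simp [ticks, List.replicate_succ']
      · ring_nf; omega
  refine ExecR.congr (ExecR.seq (key N σ hc) (exec_move (by decide) _)) ?_ ?_
  · cases σ; simp_all [ticks]
  · simp [hc', ticks]; ring_nf; omega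

/-- Drop a symbol. -/
def drop (k : Reg) : Prog Reg (Sym m) := .pop k fun _ => .skip

/-- Set up the marks for a generator whose index is in `idx`. -/
def setMarks : Prog Reg (Sym m) :=
  (.loop .cnt always fun y => .push .cnt' y ;; .push .skip y) ;; move .cnt' .cnt ;; drop .idx ;;
    (.loop .idx always fun _ => .push .marks (.phase 0) ;; drop .skip) ;;
    .push .marks (.phase 1) ;; .push .marks (.phase 2) ;; .push .marks (.phase 1) ;;
    drop .skip ;; drop .skip ;; drop .skip ;; pushZeros .skip

theorem exec_pushZeros (N : ℕ) : ∀ (σ : Regs (Sym m)), σ.skip = ticks m N →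
    ExecR (pushZeros .skip) σ
      { σ with skip := [], marks := List.replicate N (Sym.phase 0) ++ σ.marks } (2 * N + 1) := by
  induction N with
  | zero =>
    intro σ hc
    refine ExecR.congr (ExecR.loop_nil hc) ?_ (by simp)
    cases σ; simp_all [ticks]
  | succ N ih =>
    intro σ hc
    have hc' : σ.skip = Sym.tick :: ticks m N := hc
    refine ExecR.congr (ExecR.loop_cons hc' rfl (ExecR.push ..) (ih _ rfl)) ?_ ?_
    · simp [List.replicate_succ']
    · ring_nf; omega

theorem exec_setMarks (i N : ℕ) (σ : Regs (Sym m)) (hc : σ.cnt = ticks m (i + N + 3))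
    (hc' : σ.cnt' = []) (hm : σ.marks = []) (hs : σ.skip = []) (hi : σ.idx = ticks m (i + 1)) :
    ExecR setMarks σ
      { σ with
        idx := []
        marks := List.replicate N (Sym.phase 0) ++
          .phase 1 :: .phase 2 :: .phase 1 :: List.replicate i (Sym.phase 0) }
      (10 * (i + N + 3) + 20) := by
  have key : ∀ (N : ℕ) (σ : Regs (Sym m)), σ.cnt = ticks m N →
      ExecR (.loop .cnt always fun y => .push .cnt' y ;; .push .skip y) σ
        { σ with
          cnt := []
          cnt' := ticks m N ++ σ.cnt'
          skip := ticks m N ++ σ.skip } (3 * N + 1) := by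
    intro N
    induction N with
    | zero =>
      intro σ hc
      refine ExecR.congr (ExecR.loop_nil hc) ?_ (by simp)
      cases σ; simp_all [ticks]
    | succ N ih =>
      intro σ hc
      have hc' : σ.cnt = Sym.tick :: ticks m N := hc
      refine ExecR.congr (ExecR.loop_cons hc' rfl (ExecR.seq (ExecR.push ..) (ExecR.push ..))
        (ih _ rfl)) ?_ ?_
      · simp [ticks, List.replicate_succ']
      · ring_nf; omega
  have key' : ∀ (i M : ℕ) (σ : Regs (Sym m)), σ.idx = ticks m i → σ.skip = ticks m (i + M) →
      ExecR (.loop .idx always fun _ => .push .marks (.phase 0) ;; drop .skip) σ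
        { σ with
          idx := []
          skip := ticks m M
          marks := List.replicate i (Sym.phase 0) ++ σ.marks } (4 * i + 1) := by
    intro i
    induction i with
    | zero =>
      intro M σ hc hs
      refine ExecR.congr (ExecR.loop_nil hc) ?_ (by simp)
      cases σ; simp_all [ticks]
    | succ i ih =>
      intro M σ hc hs
      have hc' : σ.idx = Sym.tick :: ticks m i := hc
      have hs' : σ.skip = Sym.tick :: ticks m (i + M) := by
        rw [hs, show i + 1 + M = (i + M) + 1 by ring]; rfl
      refine ExecR.congr (ExecR.loop_cons hc' rfl (ExecR.seq (ExecR.push ..)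
        (ExecR.pop_cons (l := ticks m (i + M)) (a := Sym.tick) hs' ExecR.skip))
        (ih M _ rfl rfl)) ?_ ?_
      · simp [List.replicate_succ']
      · ring_nf; omega
  have h2 := key' i (N + 3) { σ with skip := ticks m (i + N + 3), idx := ticks m i } rfl rfl
  refine ExecR.congr (ExecR.seq (key _ σ hc) (ExecR.seq (ExecR.congr
    (υ := { σ with skip := ticks m (i + N + 3) }) (exec_move (by decide) _) ?_ le_rfl) (ExecR.seq
    (ExecR.pop_cons (l := ticks m i) (a := Sym.tick) hi ExecR.skip) (ExecR.seq h2 (ExecR.seq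
    (ExecR.push ..) (ExecR.seq (ExecR.push ..) (ExecR.seq (ExecR.push ..) (ExecR.seq
    (ExecR.pop_cons (l := ticks m (N + 2)) (a := Sym.tick) rfl ExecR.skip) (ExecR.seq
    (ExecR.pop_cons (l := ticks m (N + 1)) (a := Sym.tick) rfl ExecR.skip) (ExecR.seq
    (ExecR.pop_cons (l := ticks m N) (a := Sym.tick) rfl ExecR.skip)
    (exec_pushZeros N _ rfl))))))))))) ?_ ?_
  · cases σ; simp_all [ticks]
  · simp [hm, hs]
  · simp [hc', ticks]; ring_nf; omega

theorem genMarks_ofFn (i : Fin (n - 1)) (N : ℕ) (h : i.val + N + 3 = n + 1) :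
    (List.ofFn (genMarks i)).reverse.map (Sym.phase : Fin 4 → Sym m) =
      List.replicate N (Sym.phase 0) ++
          .phase 1 :: .phase 2 :: .phase 1 :: List.replicate i.val (Sym.phase 0) := by
  have h1 : List.ofFn (genMarks i) = List.replicate i.val 0 ++ 1 :: 2 :: 1 :: List.replicate N 0 :=
    by
    apply List.ext_getElem
    · simp; omega
    · intro j h1 h2
      simp only [List.getElem_ofFn, genMarks, List.getElem_append, List.length_replicate,
        List.getElem_replicate, List.getElem_cons]
      split_ifs <;> first | rfl | omega
  rw [h1]
  simp

/-- Multiply the description in `expo` and `pauli` by that of the generator in `idx`. -/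
def applyGen [NeZero m] (e : Fin (2 * m)) : Prog Reg (Sym m) :=
  setMarks ;; emit e ;; clear .marks ;; mulCore

theorem exec_applyGen [NeZero m] (e : Fin (2 * m)) (i : Fin (n - 1)) (d : Desc m n)
    (σ : Regs (Sym m)) (hσ : Idle σ) (hm : σ.marks = []) (hpre : σ.pre = [])
    (hc : σ.cnt = ticks m (n + 1)) (hl : σ.len = ticks m (n + 1))
    (hi : σ.idx = ticks m (i.val + 1))
    (hp : σ.pauli = wordsS m (descWords d)) (hp' : σ.pauli' = [])
    (hx : σ.expo = tableS (ltable d.expo)) (hx' : σ.expo' = []) :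
    ExecR (applyGen e) σ
      { σ with
        idx := []
        expo := tableS (ltable (mulDesc d (genDesc (genMarks i) e)).expo)
        pauli := wordsS m (descWords (mulDesc d (genDesc (genMarks i) e))) }
      (260 * (n + 2) ^ 4) := by
  obtain ⟨N, hN⟩ : ∃ N, i.val + N + 3 = n + 1 := ⟨n - 2 - i.val, by omega⟩
  have h1 := exec_setMarks i.val N σ (hN ▸ hc) hσ.cnt' hm hσ.skip hi
  rw [← genMarks_ofFn i N hN] at h1
  have h2 := exec_emit_genDesc e (genMarks i) ({ σ with
        idx := []
        marks := (List.ofFn (genMarks i)).reverse.map Sym.phase }) rfl hpre hσ.acc hx' hp'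
  have h3 := exec_mulCore_desc d (genDesc (genMarks i) e)
    { σ with
      idx := []
      expo' := tableS (ltable (genDesc (genMarks i) e).expo)
      pauli' := wordsS m (descWords (genDesc (genMarks i) e)) }
    ⟨hσ.cnt', hσ.len', hσ.done, hσ.acc, hσ.acc', hσ.res, hσ.skip, hσ.skip', hσ.coef, hσ.first,
      hσ.first', hσ.last, hσ.last', hσ.expoDone⟩ hc hl hp rfl hx rfl
  refine ExecR.congr (ExecR.seq h1 (ExecR.seq h2 (ExecR.seq (ExecR.congr (exec_clear _ _)
    (υ := { σ with
      idx := []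
      expo' := tableS (ltable (genDesc (genMarks i) e).expo)
      pauli' := wordsS m (descWords (genDesc (genMarks i) e)) }) ?_ le_rfl) h3))) ?_ ?_
  · simp [hm]
  · simp [hp', hx']
  · simp only [Regs.get, List.length_map, List.length_reverse, List.length_ofFn, hN]
    have : n ^ 4 + 8 * n ^ 3 + 24 * n ^ 2 + 32 * n + 16 = (n + 2) ^ 4 := by ring
    nlinarith

/-- Treat all the letters of the braid. -/
def applyWord [NeZero m] (e : Bool → Fin (2 * m)) : Prog Reg (Sym m) :=
  .loop .word always fun y =>
    if y = .tick then .push .idx .tick else applyGen (e (decide (y = .bit 1)))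

/-- The symbol for a letter. -/
def letterSym (m : ℕ) (b : Bool) : Sym m := .bit (if b then 1 else 0)

/-- The letters of a braid word, as they are stored in the machine. -/
def wordSyms (m : ℕ) (w : BraidWord n) : List (Sym m) :=
  w.flatMap fun p => ticks m (p.1.val + 1) ++ [letterSym m p.2]

theorem exec_applyWord_ticks [NeZero m] (e : Bool → Fin (2 * m)) (l : List (Sym m)) (k : ℕ) :
    ∀ (σ τ : Regs (Sym m)) (T : ℕ), σ.word = ticks m k ++ l →
      ExecR (applyWord e) { σ with word := l, idx := ticks m k ++ σ.idx } τ T →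
      ExecR (applyWord e) σ τ (T + 2 * k) := by
  induction k with
  | zero =>
    intro σ τ T hw h
    have : ({ σ with word := l, idx := ticks m 0 ++ σ.idx } : Regs (Sym m)) = σ := by
      cases σ; simp_all [ticks]
    rwa [this] at h
  | succ k ih =>
    intro σ τ T hw h
    have hw' : σ.word = Sym.tick :: (ticks m k ++ l) := hw
    refine ExecR.congr (ExecR.loop_cons hw' rfl (by rw [if_pos rfl]; exact ExecR.push ..)
      (ih _ τ T rfl ?_)) rfl (by ring_nf; omega)
    convert h using 1
    simp [ticks, List.replicate_succ']

theorem exec_applyWord [NeZero m] (e : Bool → Fin (2 * m)) (w : BraidWord n) :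
    ∀ (d : Desc m n) (σ : Regs (Sym m)), Idle σ → σ.marks = [] → σ.pre = [] →
      σ.cnt = ticks m (n + 1) → σ.len = ticks m (n + 1) → σ.idx = [] →
      σ.pauli = wordsS m (descWords d) → σ.pauli' = [] →
      σ.expo = tableS (ltable d.expo) → σ.expo' = [] → σ.word = wordSyms m w →
      ExecR (applyWord e) σ
        { σ with
          word := []
          expo := tableS (ltable
            (w.foldl (fun d p => mulDesc d (genDesc (genMarks p.1) (e p.2))) d).expo)
          pauli := wordsS m (descWords
            (w.foldl (fun d p => mulDesc d (genDesc (genMarks p.1) (e p.2))) d)) }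
        (w.length * (262 * (n + 2) ^ 4) + 1) := by
  induction w with
  | nil =>
    intro d σ hσ hm hpre hc hl hi hp hp' hx hx' hw
    refine ExecR.congr (ExecR.loop_nil hw) ?_ (by simp)
    simp only [wordSyms, List.flatMap_nil] at hw
    rw [List.foldl_nil, ← hp, ← hx, ← hw]
  | cons p w ih =>
    intro d σ hσ hm hpre hc hl hi hp hp' hx hx' hw
    have hw' : σ.word = ticks m (p.1.val + 1) ++ (letterSym m p.2 :: wordSyms m w) := by
      rw [hw]; simp [wordSyms]
    have hb : decide (letterSym m p.2 = .bit 1) = p.2 := by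
      cases p.2 <;> simp [letterSym]
    have hgen := exec_applyGen (e p.2) p.1 d
      { σ with word := wordSyms m w, idx := ticks m (p.1.val + 1) }
      ⟨hσ.cnt', hσ.len', hσ.done, hσ.acc, hσ.acc', hσ.res, hσ.skip, hσ.skip', hσ.coef, hσ.first,
        hσ.first', hσ.last, hσ.last', hσ.expoDone⟩ hm hpre hc hl rfl hp hp' hx hx'
    have hrest := ih (mulDesc d (genDesc (genMarks p.1) (e p.2)))
      { σ with
        word := wordSyms m w
        idx := []
        expo := tableS (ltable (mulDesc d (genDesc (genMarks p.1) (e p.2))).expo)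
        pauli := wordsS m (descWords (mulDesc d (genDesc (genMarks p.1) (e p.2)))) }
      ⟨hσ.cnt', hσ.len', hσ.done, hσ.acc, hσ.acc', hσ.res, hσ.skip, hσ.skip', hσ.coef, hσ.first,
        hσ.first', hσ.last, hσ.last', hσ.expoDone⟩ hm hpre hc hl rfl rfl hp' rfl hx' rfl
    refine ExecR.congr (exec_applyWord_ticks e _ _ σ _ _ hw' (ExecR.loop_cons
      (σ := { σ with
        word := letterSym m p.2 :: wordSyms m w, idx := ticks m (p.1.val + 1) ++ σ.idx })
      rfl rfl (τ := { σ with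
        word := wordSyms m w
        idx := []
        expo := tableS (ltable (mulDesc d (genDesc (genMarks p.1) (e p.2))).expo)
        pauli := wordsS m (descWords (mulDesc d (genDesc (genMarks p.1) (e p.2)))) })
      (T := 260 * (n + 2) ^ 4) ?_ hrest)) ?_ ?_
    · rw [if_neg (by simp [letterSym]), hb, hi, List.append_nil]
      exact hgen
    · rw [List.foldl_cons, ← hi]
    · rw [List.length_cons]
      have h1 : p.1.val + 1 ≤ n := by omega
      have h2 : n ^ 4 + 8 * n ^ 3 + 24 * n ^ 2 + 32 * n + 16 = (n + 2) ^ 4 := by ring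
      nlinarith

/-! #### Reading the braid -/

/-- Put a symbol of the input on its stack. -/
def sortLetter (y : Sym m) : Prog Reg (Sym m) :=
  .pop .marks fun o =>
    if y = .sep then .push .marks y
    else o.elim (.push .word y) fun x => .push .marks x ;; .push .cnt y ;; .push .len y

/-- The effect of `sortLetter`. -/
def sortLetterStep (σ : Regs (Sym m)) (y : Sym m) : Regs (Sym m) :=
  if y = .sep then { σ with marks := y :: σ.marks.tail }
  else if σ.marks = [] then { σ with word := y :: σ.word }
  else { σ with cnt := y :: σ.cnt, len := y :: σ.len }

theorem exec_sortLetter (σ : Regs (Sym m)) (y : Sym m) :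
    ExecR (sortLetter y) σ (sortLetterStep σ y) 4 := by
  cases hm : σ.marks with
  | nil =>
    by_cases hy : y = .sep
    · subst hy
      exact ExecR.congr (ExecR.pop_nil hm (by
        rw [if_pos rfl]; exact ExecR.push ..)) (by simp [sortLetterStep, hm]) (by norm_num)
    · exact ExecR.congr (ExecR.pop_nil hm (by
        rw [if_neg hy]; exact ExecR.push ..)) (by simp [sortLetterStep, hm, hy]) (by norm_num)
  | cons x l =>
    by_cases hy : y = .sep
    · subst hy
      exact ExecR.congr (ExecR.pop_cons hm (by
        rw [if_pos rfl]; exact ExecR.push ..)) (by simp [sortLetterStep, hm]) (by norm_num)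
    · exact ExecR.congr (ExecR.pop_cons hm (by
        rw [if_neg hy]; exact ExecR.seq (ExecR.push ..) (ExecR.seq (ExecR.push ..)
          (ExecR.push ..)))) (by cases σ; simp_all [sortLetterStep]) (by norm_num)

theorem foldl_word (l : List (Sym m)) (hl : ∀ y ∈ l, y ≠ .sep) :
    ∀ σ : Regs (Sym m), σ.marks = [] →
      l.foldl sortLetterStep σ = { σ with word := l.reverse ++ σ.word } := by
  induction l with
  | nil => intro σ _; rfl
  | cons y l ih =>
    intro σ hσ
    rw [List.foldl_cons, sortLetterStep, if_neg (hl y (by simp)), if_pos hσ]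
    refine (ih (fun y hy => hl y (by simp [hy])) { σ with word := y :: σ.word } hσ).trans ?_
    simp

theorem foldl_ticks (k : ℕ) :
    ∀ σ : Regs (Sym m), σ.marks ≠ [] →
      (ticks m k).foldl sortLetterStep σ =
        { σ with cnt := ticks m k ++ σ.cnt, len := ticks m k ++ σ.len } := by
  induction k with
  | zero => intro σ _; rfl
  | succ k ih =>
    intro σ hσ
    have : ticks m (k + 1) = .tick :: ticks m k := rfl
    rw [this, List.foldl_cons, sortLetterStep, if_neg (by simp), if_neg hσ]
    refine (ih { σ with cnt := .tick :: σ.cnt, len := .tick :: σ.len } hσ).trans ?_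
    simp [ticks, ← List.replicate_succ, List.replicate_succ']

/-- Translate the symbols of braid words. -/
def trSym (m : ℕ) : BraidSym → Sym m
  | .tick => .tick
  | .sep => .sep
  | .letter b => letterSym m b

theorem map_encodeBraid (w : BraidWord n) :
    (encodeBraid ⟨n, w⟩).map (trSym m) = ticks m n ++ .sep :: wordSyms m w := by
  simp [encodeBraid, wordSyms, ticks, trSym, List.map_flatMap]

/-- Read a braid and write down the description of its image. -/
def braidProg [NeZero m] (e : Bool → Fin (2 * m)) : Prog Reg (Sym m) :=
  .loop .inp always sortLetter ;; drop .marks ;; .push .cnt .tick ;; .push .len .tick ;;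
    zeroMarks ;; emit 0 ;; clear .marks ;; move .expo' .acc ;; move .acc .expo ;;
    move .pauli' .acc ;; move .acc .pauli ;; applyWord e ;; print

theorem desc_lengths (d : Desc m n) :
    (tableS (ltable d.expo)).length + (wordsS m (descWords d)).length ≤ 8 * (n + 1) ^ 2 := by
  have := encodeDesc_length_le d
  rw [encodeDesc_eq', List.length_append, List.length_cons, List.length_append] at this
  omega

theorem exec_braidProg [NeZero m] (e : Bool → Fin (2 * m)) (b : Σ n, BraidWord n) :
    ExecR (braidProg e) (Regs.empty.set .inp ((encodeBraid b).map (trSym m)).reverse)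
      (Regs.empty.set .out (encodeDesc m ⟨b.1, imgDesc e b.2⟩))
      (b.2.length * (262 * (b.1 + 2) ^ 4) + 5 * (encodeBraid b).length +
        120 * (b.1 + 1) ^ 2 + 40) := by
  obtain ⟨n, w⟩ := b
  have h1 := exec_loop_foldl .inp sortLetter sortLetterStep 4
    (fun σ a x => by
      by_cases h1 : a = .sep <;> by_cases h2 : σ.marks = [] <;> simp [sortLetterStep, h1, h2])
    exec_sortLetter ((encodeBraid ⟨n, w⟩).map (trSym m)).reverse
    (Regs.empty.set .inp ((encodeBraid ⟨n, w⟩).map (trSym m)).reverse) rfl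
  have h2 : ((encodeBraid ⟨n, w⟩).map (trSym m)).reverse.foldl sortLetterStep
      ((Regs.empty.set .inp ((encodeBraid ⟨n, w⟩).map (trSym m)).reverse).set .inp []) =
      { (Regs.empty : Regs (Sym m)) with
        cnt := ticks m n
        len := ticks m n
        marks := [.sep]
        word := wordSyms m w } := by
    rw [map_encodeBraid, List.reverse_append, List.reverse_cons, List.append_assoc,
      List.foldl_append, List.singleton_append, List.foldl_cons,
        foldl_word (wordSyms m w).reverse _ _ rfl]
    · rw [show (ticks m n).reverse = ticks m n by simp [ticks], foldl_ticks]
      · simp [sortLetterStep, Regs.empty]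
      · simp [sortLetterStep]
    · intro y hy
      simp only [wordSyms, List.mem_reverse, List.mem_flatMap, List.mem_append,
        List.mem_singleton] at hy
      obtain ⟨p, -, hy | rfl⟩ := hy
      · rw [List.eq_of_mem_replicate hy]; simp
      · simp [letterSym]
  rw [h2] at h1
  have h3 := exec_zeroMarks (n + 1)
    { (Regs.empty : Regs (Sym m)) with
      cnt := ticks m (n + 1)
      len := ticks m (n + 1)
      word := wordSyms m w } rfl rfl rfl
  have h4 := exec_emit_genDesc (n := n) (0 : Fin (2 * m)) (fun _ => 0)
    { (Regs.empty : Regs (Sym m)) with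
      cnt := ticks m (n + 1)
      len := ticks m (n + 1)
      marks := List.replicate (n + 1) (.phase 0)
      word := wordSyms m w } (by
        rw [List.ofFn_const, List.reverse_replicate, List.map_replicate]) rfl rfl rfl rfl
  have h5 := exec_applyWord e w (genDesc (fun _ => 0) 0)
    { (Regs.empty : Regs (Sym m)) with
      cnt := ticks m (n + 1)
      len := ticks m (n + 1)
      word := wordSyms m w
      expo := tableS (ltable (genDesc (n := n) (fun _ => 0) (0 : Fin (2 * m))).expo)
      pauli := wordsS m (descWords (genDesc (n := n) (fun _ => 0) (0 : Fin (2 * m)))) }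
    ⟨rfl, rfl, rfl, rfl, rfl, rfl, rfl, rfl, rfl, rfl, rfl, rfl, rfl, rfl⟩ rfl rfl rfl rfl rfl rfl
    rfl rfl rfl rfl
  have h6 := exec_print (imgDesc e w)
    { (Regs.empty : Regs (Sym m)) with
      cnt := ticks m (n + 1)
      len := ticks m (n + 1)
      expo := tableS (ltable (imgDesc e w).expo)
      pauli := wordsS m (descWords (imgDesc e w)) }
    ⟨rfl, rfl, rfl, rfl, rfl, rfl, rfl, rfl, rfl, rfl, rfl, rfl, rfl, rfl⟩ rfl rfl rfl rfl rfl
  have hlen := desc_lengths (genDesc (n := n) (fun _ => 0) (0 : Fin (2 * m)))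
  generalize tableS (ltable (genDesc (n := n) (fun _ => 0) (0 : Fin (2 * m))).expo) = X at *
  generalize wordsS m (descWords (genDesc (n := n) (fun _ => 0) (0 : Fin (2 * m)))) = Y at *
  refine ExecR.congr (ExecR.seq h1 (ExecR.seq
    (ExecR.pop_cons (l := []) (a := Sym.sep) rfl ExecR.skip) (ExecR.seq (ExecR.push ..) (ExecR.seq
    (ExecR.push ..) (ExecR.seq h3 (ExecR.seq h4 (ExecR.seq (exec_clear ..) (ExecR.seq
    (exec_move (by decide) _) (ExecR.seq (exec_move (by decide) _) (ExecR.seq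
    (exec_move (by decide) _) (ExecR.seq (ExecR.congr (exec_move (by decide) _)
    (υ := { (Regs.empty : Regs (Sym m)) with
      cnt := ticks m (n + 1)
      len := ticks m (n + 1)
      word := wordSyms m w
      expo := X
      pauli := Y }) ?_ le_rfl) (ExecR.seq h5 h6)))))))))))) ?_ ?_
  · simp [Regs.empty]
  · simp [Regs.empty]
  · simp [Regs.empty]
    nlinarith

theorem length_encodeBraid (b : Σ n, BraidWord n) :
    (encodeBraid b).length = b.1 + 1 + (b.2.map fun p => p.1.val + 2).sum := by
  simp [encodeBraid, List.length_flatMap, add_assoc, add_comm, add_left_comm]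

/-- One multiplication of descriptions per letter; the intermediate descriptions do not grow, because
the exponents are reduced modulo `2 m`. -/
theorem braid_computable [NeZero m] (e : Bool → Fin (2 * m)) :
    Nonempty (TM2ComputableInPolyTime encodeBraid (encodeDesc m)
      (fun b => ⟨b.1, imgDesc e b.2⟩)) := by
  refine Exec.computable (trSym m) (braidProg e) .inp .out encodeBraid (encodeDesc m) _
    (.X * (262 * (.X + 2) ^ 4) + 5 * .X + 120 * (.X + 1) ^ 2 + 40) fun b => ?_
  have h := exec_braidProg e b
  have hl := length_encodeBraid b
  have hw : b.2.length ≤ (b.2.map fun p => p.1.val + 2).sum := by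
    generalize b.2 = l
    induction l with
    | nil => simp
    | cons p l ih => simp only [List.length_cons, List.map_cons, List.sum_cons]; omega
  have h1 : b.1 ≤ (encodeBraid b).length := by omega
  have h2 : b.2.length ≤ (encodeBraid b).length := by omega
  rw [ExecR, ← Regs.update_get, ← Regs.update_get, Regs.get_empty] at h
  refine h.mono ?_
  simp only [Polynomial.eval_add, Polynomial.eval_mul, Polynomial.eval_pow, Polynomial.eval_X,
    Polynomial.eval_ofNat, Polynomial.eval_one]
  gcongr

theorem length_encodeBraid_le (n : ℕ) (w : BraidWord n) :
    (encodeBraid ⟨n, w⟩).length ≤ (n + w.length + 1) ^ 2 := by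
  rw [length_encodeBraid]
  have h : (w.map fun p => p.1.val + 2).sum ≤ w.length * (n + 1) := by
    induction w with
    | nil => simp
    | cons p l ih =>
      simp only [List.length_cons, List.map_cons, List.sum_cons]
      have := p.1.isLt
      have h' : p.1.val + 2 ≤ n + 1 := by omega
      nlinarith
  nlinarith

end QubitBraid

/-! ### Bit strings and signed permutation matrices -/

namespace QubitBraid

open scoped Fin.CommRing

variable {m n : ℕ}

theorem bits_add_self (x : Bits n) : x + x = 0 := by
  funext a
  have : ∀ b : Fin 2, b + b = 0 := by decide
  exact this _

/-- The sign `(-1) ^ b`. -/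
noncomputable def chi (b : Fin 2) : ℂ := if b = 0 then 1 else -1

theorem chi_add (a b : Fin 2) : chi (a + b) = chi a * chi b := by
  fin_cases a <;> fin_cases b <;> simp [chi]

theorem chi_mul_self (a : Fin 2) : chi a * chi a = 1 := by
  fin_cases a <;> simp [chi]

@[simp] theorem chi_zero : chi 0 = 1 := by simp [chi]

@[simp] theorem chi_one : chi 1 = -1 := by simp [chi]

theorem chi_injective : Function.Injective chi := by
  intro a b
  fin_cases a <;> fin_cases b <;> norm_num [chi]

theorem star_chi (a : Fin 2) : star (chi a) = chi a := by
  fin_cases a <;> simp [chi]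

/-- The bit string with a single `1`, at position `j`. -/
def unit (n j : ℕ) : Bits n := addBit 0 j 1

/-- The sum of the two neighbours of the bit `x_j`. -/
def nbr (x : Bits n) (j : ℕ) : Fin 2 := bitAt x (j - 1) + bitAt x (j + 1)

theorem addBit_eq (x : Bits n) (j : ℕ) (b : Fin 2) : addBit x j b = x + b • unit n j := by
  funext a
  simp only [addBit, unit, Pi.add_apply, Pi.smul_apply, Pi.zero_apply]
  split_ifs <;> simp

theorem bitAt_add (x y : Bits n) (j : ℕ) : bitAt (x + y) j = bitAt x j + bitAt y j := by
  simp only [bitAt]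
  split_ifs <;> simp

theorem bitAt_smul (b : Fin 2) (x : Bits n) (j : ℕ) : bitAt (b • x) j = b * bitAt x j := by
  simp only [bitAt]
  split_ifs <;> simp

theorem bitAt_unit {j : ℕ} (h1 : 1 ≤ j) (h2 : j ≤ n + 1) (k : ℕ) :
    bitAt (unit n j) k = if k = j then 1 else 0 := by
  simp only [bitAt, unit, addBit]
  split_ifs <;> first | rfl | omega

theorem bitAt_succ (x : Bits n) (a : Fin (n + 1)) : bitAt x (a.val + 1) = x a := by
  rw [bitAt, dif_pos ⟨by omega, by omega⟩]
  rfl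

theorem nbr_add (x y : Bits n) (j : ℕ) : nbr (x + y) j = nbr x j + nbr y j := by
  simp only [nbr, bitAt_add]; ring

theorem nbr_smul (b : Fin 2) (x : Bits n) (j : ℕ) : nbr (b • x) j = b * nbr x j := by
  simp only [nbr, bitAt_smul]; ring

theorem nbr_unit {j k : ℕ} (h1 : 1 ≤ j) (h2 : j ≤ n + 1) (hk : 1 ≤ k) :
    nbr (unit n j) k = if k = j + 1 ∨ k + 1 = j then 1 else 0 := by
  simp only [nbr, bitAt_unit h1 h2]
  split_ifs <;> first | rfl | omega

/-- The function whose parity is the sign by which the permutation matrices are twisted. For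
`m ≥ 5` it is the quadratic form of the reflections that the gates `NOT_j` induce. -/
def quad (m : ℕ) (x : Bits n) : Fin 2 :=
  ∑ k ∈ Finset.range (n + 2), bitAt x k +
    if m = 3 then 0 else ∑ k ∈ Finset.range (n + 2), bitAt x k * bitAt x (k + 1)

theorem quad_addBit (m : ℕ) (x : Bits n) {j : ℕ} (h1 : 1 ≤ j) (h2 : j ≤ n + 1) (b : Fin 2) :
    quad m (addBit x j b) = quad m x + b + if m = 3 then 0 else b * nbr x j := by
  have hb : ∀ k, bitAt (addBit x j b) k = bitAt x k + if k = j then b else 0 := by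
    intro k
    rw [addBit_eq, bitAt_add, bitAt_smul, bitAt_unit h1 h2]
    split_ifs <;> simp
  have e1 : ∑ k ∈ Finset.range (n + 2), (if k = j then b else 0) = b := by
    rw [Finset.sum_ite_eq' _ j fun _ => b, if_pos (by simp; omega)]
  have e2 : ∑ k ∈ Finset.range (n + 2), (bitAt x k + if k = j then b else 0) *
      (bitAt x (k + 1) + if k + 1 = j then b else 0) =
      ∑ k ∈ Finset.range (n + 2), bitAt x k * bitAt x (k + 1) + b * nbr x j := by
    have : ∀ k, (bitAt x k + if k = j then b else 0) *
        (bitAt x (k + 1) + if k + 1 = j then b else 0) = bitAt x k * bitAt x (k + 1) +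
          ((if k = j then b * bitAt x (k + 1) else 0) +
            if k = j - 1 then b * bitAt x k else 0) := by
      intro k
      have h : k + 1 = j ↔ k = j - 1 := by omega
      simp only [h]
      split_ifs with h3 h4 <;> first | omega | ring
    rw [Finset.sum_congr rfl fun k _ => this k, Finset.sum_add_distrib, Finset.sum_add_distrib,
      Finset.sum_ite_eq' _ j fun k => b * bitAt x (k + 1),
      Finset.sum_ite_eq' _ (j - 1) fun k => b * bitAt x k, if_pos (by simp; omega),
      if_pos (by simp; omega), nbr]
    ring
  simp only [quad, hb, e2, Finset.sum_add_distrib, e1]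
  split_ifs <;> ring

/-- The diagonal signs. -/
noncomputable def sgn (m : ℕ) (x : Bits n) : ℂ := chi (quad m x)

theorem sgn_mul_self (m : ℕ) (x : Bits n) : sgn m x * sgn m x = 1 := chi_mul_self _

/-- The permutation matrix of `π`, conjugated by the diagonal matrix of the signs. -/
noncomputable def signedPerm (m : ℕ) (π : Equiv.Perm (Bits n)) : Op n :=
  Matrix.of fun y x => if y = π x then sgn m y * sgn m x else 0

theorem signedPerm_one (m : ℕ) : signedPerm m (1 : Equiv.Perm (Bits n)) = 1 := by
  ext y x
  by_cases h : y = x <;> simp [signedPerm, h, sgn_mul_self, Matrix.one_apply]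

theorem signedPerm_mul (m : ℕ) (π τ : Equiv.Perm (Bits n)) :
    signedPerm m (π * τ) = signedPerm m π * signedPerm m τ := by
  ext y x
  rw [Matrix.mul_apply, Finset.sum_eq_single (τ x)]
  · simp only [signedPerm, Matrix.of_apply, if_true]
    by_cases h : y = π (τ x)
    · rw [if_pos h, if_pos (by exact h)]
      linear_combination (-sgn m y * sgn m x) * sgn_mul_self m (τ x)
    · rw [if_neg h, if_neg (by exact h), zero_mul]
  · intro z _ hz
    simp [signedPerm, hz]
  · simp

theorem star_signedPerm (m : ℕ) (π : Equiv.Perm (Bits n)) :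
    star (signedPerm m π) = signedPerm m π⁻¹ := by
  ext y x
  rw [Matrix.star_apply]
  simp only [signedPerm, Matrix.of_apply, Equiv.Perm.eq_inv_iff_eq, eq_comm (a := x)]
  split_ifs
  · rw [star_mul', sgn, sgn, star_chi, star_chi, mul_comm]
  · simp

/-- The signed permutation matrices as a representation of the permutations by unitary
operators. -/
noncomputable def permU (m : ℕ) : Equiv.Perm (Bits n) →* UOp n where
  toFun π := ⟨signedPerm m π, by
    rw [Matrix.mem_unitaryGroup_iff, star_signedPerm, ← signedPerm_mul, mul_inv_cancel,
      signedPerm_one]⟩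
  map_one' := Subtype.ext (signedPerm_one m)
  map_mul' π τ := Subtype.ext (signedPerm_mul m π τ)

theorem coe_permU (m : ℕ) (π : Equiv.Perm (Bits n)) : (permU m π : Op n) = signedPerm m π := rfl

theorem sgn_ne_zero (m : ℕ) (x : Bits n) : sgn m x ≠ 0 := by
  intro h
  have := sgn_mul_self m x
  simp [h] at this

theorem permU_injective (m : ℕ) : Function.Injective (permU (n := n) m) := by
  intro π τ h
  ext1 x
  have h1 : signedPerm m π (π x) x = signedPerm m τ (π x) x := by
    rw [← coe_permU, ← coe_permU, h]
  simp only [signedPerm, Matrix.of_apply, if_true] at h1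
  by_contra hne
  rw [if_neg hne] at h1
  exact mul_ne_zero (sgn_ne_zero _ _) (sgn_ne_zero _ _) h1

/-! ### The Pauli operators and the Clifford generators as signed permutations -/

/-- Addition of `u`, as a signed permutation matrix. -/
noncomputable def shift (m : ℕ) (u : Bits n) : Op n := signedPerm m (Equiv.addRight u)

theorem shift_zero (m : ℕ) : shift m (0 : Bits n) = 1 := by
  rw [shift, ← signedPerm_one m]
  congr 1
  ext1 x
  exact add_zero x

theorem shift_add (m : ℕ) (u v : Bits n) : shift m (u + v) = shift m u * shift m v := by
  rw [shift, shift, shift, ← signedPerm_mul]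
  congr 1
  ext1 x
  simp [add_assoc, add_comm v u]

theorem opZ_eq (n j : ℕ) : opZ n j = Matrix.diagonal fun x => chi (bitAt x j) := rfl

theorem opX_apply (n j : ℕ) (y x : Bits n) : opX n j y x = if y = addBit x j 1 then 1 else 0 := rfl

theorem sgn_addBit (m : ℕ) (x : Bits n) {j : ℕ} (h1 : 1 ≤ j) (h2 : j ≤ n + 1) :
    sgn m (addBit x j 1) = -sgn m x * if m = 3 then 1 else chi (nbr x j) := by
  rw [sgn, quad_addBit m x h1 h2 1, sgn]
  split_ifs <;> simp [chi_add]

/-- Twisted by the signs, the operators `H_j` become translations for every `m`, up to the factor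
`-1`; this is what the choice of `quad` achieves. -/
theorem opH_eq (m : ℕ) {j : ℕ} (h1 : 1 ≤ j) (h2 : j ≤ n + 1) :
    opH m n j = -shift m (unit n j) := by
  ext y x
  have ha : Equiv.addRight (unit n j) x = addBit x j 1 := by
    rw [addBit_eq, one_smul]; rfl
  have hs := sgn_mul_self m x
  have hX := opX_apply n j y x
  have hg := sgn_addBit m x h1 h2
  rw [shift, signedPerm, Matrix.neg_apply, Matrix.of_apply, ha]
  by_cases hm : m = 3
  · rw [opH, if_pos hm, hX]
    rw [if_pos hm] at hg
    by_cases h : y = addBit x j 1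
    · rw [if_pos h, if_pos h, h, hg]
      linear_combination -hs
    · rw [if_neg h, if_neg h, neg_zero]
  · rw [opH, if_neg hm, opZ_eq, opZ_eq, Matrix.mul_diagonal, Matrix.diagonal_mul, hX]
    rw [if_neg hm] at hg
    by_cases h : y = addBit x j 1
    · have e1 : bitAt (addBit x j 1) (j - 1) = bitAt x (j - 1) := by
        rw [addBit_eq, bitAt_add, one_smul, bitAt_unit h1 h2, if_neg (by omega), add_zero]
      rw [if_pos h, if_pos h, h, hg, e1, nbr, chi_add]
      linear_combination (-chi (bitAt x (j - 1)) * chi (bitAt x (j + 1))) * hs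
    · rw [if_neg h, if_neg h]; ring

theorem nbr_addBit_nbr (j : ℕ) (hj : 1 ≤ j) (x : Bits n) :
    nbr (addBit x j (nbr x j)) j = nbr x j := by
  by_cases h2 : j ≤ n + 1
  · rw [addBit_eq, nbr_add, nbr_smul, nbr_unit hj h2 hj, if_neg (by omega), mul_zero, add_zero]
  · have : addBit x j (nbr x j) = x := by
      funext a
      simp only [addBit]
      rw [if_neg (by omega)]
    rw [this]

/-- The permutation of the basis labels that `NOT_{j+1}` induces. -/
def reflect (j : Fin (n + 1)) : Equiv.Perm (Bits n) where
  toFun x := addBit x (j.val + 1) (nbr x (j.val + 1))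
  invFun x := addBit x (j.val + 1) (nbr x (j.val + 1))
  left_inv x := by
    change addBit (addBit x _ _) _ (nbr (addBit x _ _) _) = x
    rw [nbr_addBit_nbr _ (by omega), addBit_eq, addBit_eq, add_assoc, bits_add_self, add_zero]
  right_inv x := by
    change addBit (addBit x _ _) _ (nbr (addBit x _ _) _) = x
    rw [nbr_addBit_nbr _ (by omega), addBit_eq, addBit_eq, add_assoc, bits_add_self, add_zero]

theorem reflect_apply (j : Fin (n + 1)) (x : Bits n) :
    reflect j x = x + nbr x (j.val + 1) • unit n (j.val + 1) := addBit_eq _ _ _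

theorem reflect_inv (j : Fin (n + 1)) : (reflect j)⁻¹ = reflect j := rfl

/-- For `m ≠ 3` the reflections preserve `quad`; for `m = 3` the change is the sign of the factor
`Z_{j-1} Z_{j+1}` of the Clifford generator. -/
theorem quad_reflect (m : ℕ) (j : Fin (n + 1)) (x : Bits n) :
    quad m (reflect j x) = quad m x + if m = 3 then nbr x (j.val + 1) else 0 := by
  have h := quad_addBit m x (j := j.val + 1) (by omega) (by omega) (nbr x (j.val + 1))
  have h2 : ∀ b : Fin 2, b + b * b = 0 := by decide
  change quad m (addBit _ _ _) = _
  rw [h]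
  split_ifs
  · rw [add_zero]
  · rw [add_assoc, h2]

/-- In the same twisted form, the Clifford generators are permutation matrices of linear maps. -/
theorem cliffordGen_eq (m : ℕ) (j : Fin (n + 1)) :
    cliffordGen m n (j.val + 1) = signedPerm m (reflect j) := by
  ext y x
  have hN : opNot n (j.val + 1) y x = if y = reflect j x then 1 else 0 := rfl
  have hs := sgn_mul_self m x
  have hg : sgn m (reflect j x) = sgn m x * if m = 3 then chi (nbr x (j.val + 1)) else 1 := by
    rw [sgn, quad_reflect, sgn]
    split_ifs <;> simp [chi_add]
  rw [signedPerm, Matrix.of_apply, cliffordGen]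
  by_cases hm : m = 3
  · rw [if_pos hm, opZ_eq, opZ_eq, Matrix.diagonal_mul_diagonal, Matrix.diagonal_mul, hN]
    rw [if_pos hm] at hg
    by_cases h : y = reflect j x
    · have e1 : nbr y (j.val + 1) = nbr x (j.val + 1) := by
        rw [h]; exact nbr_addBit_nbr _ (by omega) x
      rw [if_pos h, if_pos h, ← chi_add]
      change chi (nbr y (j.val + 1)) * 1 = _
      rw [e1, h, hg]
      linear_combination -chi (nbr x (j.val + 1)) * hs
    · rw [if_neg h, if_neg h, mul_zero]
  · rw [if_neg hm, hN]
    rw [if_neg hm] at hg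
    by_cases h : y = reflect j x
    · rw [if_pos h, if_pos h, h, hg]
      linear_combination -hs
    · rw [if_neg h, if_neg h]

/-- The group of the permutations that the elements of `H` induce on the basis labels. -/
def reflGroup (n : ℕ) : Subgroup (Equiv.Perm (Bits n)) := Subgroup.closure (Set.range reflect)

theorem groupH_eq (m n : ℕ) : groupH m n = (reflGroup n).map (permU m) := by
  rw [reflGroup, MonoidHom.map_closure, groupH]
  congr 1
  ext u
  simp only [Set.mem_ofPred_eq, Set.mem_image, Set.exists_range_iff]
  constructor
  · rintro ⟨j, h1, h2, h⟩
    refine ⟨⟨j - 1, by omega⟩, Subtype.ext ?_⟩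
    rw [coe_permU, h, ← cliffordGen_eq]
    simp only [Nat.sub_add_cancel h1]
  · rintro ⟨j, rfl⟩
    exact ⟨j.val + 1, by omega, by omega, (cliffordGen_eq m j).symm⟩

end QubitBraid

/-! ### Intervals and the reflection group -/

namespace QubitBraid

open scoped Fin.CommRing

variable {m n : ℕ}

/-- The indicator of an interval. -/
def ivl (k l : Fin (n + 1)) : Bits n := fun a => if k ≤ a ∧ a ≤ l then 1 else 0

/-- The bit string is the indicator of a nonempty interval. -/
def IsIvl (v : Bits n) : Prop := ∃ k l : Fin (n + 1), k ≤ l ∧ v = ivl k l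

theorem bitAt_ivl (k l : Fin (n + 1)) (t : ℕ) :
    bitAt (ivl k l) t = if k.val + 1 ≤ t ∧ t ≤ l.val + 1 then 1 else 0 := by
  simp only [bitAt, ivl, Fin.le_def]
  split_ifs <;> first | rfl | omega

theorem unit_apply (j a : Fin (n + 1)) : unit n (j.val + 1) a = if a = j then 1 else 0 := by
  simp [unit, addBit, Fin.ext_iff]

/-- The indicators of intervals are the positive roots of type `A_{n+1}` modulo `2`, so the
reflections permute them. -/
theorem isIvl_reflect (j : Fin (n + 1)) {v : Bits n} (hv : IsIvl v) : IsIvl (reflect j v) := by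
  obtain ⟨k, l, hkl, rfl⟩ := hv
  have h : ∀ a, reflect j (ivl k l) a = ivl k l a +
      ((if k.val + 1 ≤ j.val ∧ j.val ≤ l.val + 1 then 1 else 0) +
        (if k.val + 1 ≤ j.val + 2 ∧ j.val + 2 ≤ l.val + 1 then 1 else 0)) *
      if a = j then 1 else 0 := by
    intro a
    rw [reflect_apply, Pi.add_apply, Pi.smul_apply, nbr, bitAt_ivl, bitAt_ivl, unit_apply]
    simp
  rw [Fin.le_def] at hkl
  have two : (1 : Fin 2) + 1 = 0 := rfl
  have hj := j.isLt
  have hk := k.isLt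
  have hl := l.isLt
  by_cases h1 : k.val + 1 ≤ j.val ∧ j.val ≤ l.val + 1
  · by_cases h2 : k.val + 1 ≤ j.val + 2 ∧ j.val + 2 ≤ l.val + 1
    · refine ⟨k, l, hkl, funext fun a => ?_⟩
      rw [h, if_pos h1, if_pos h2, two, zero_mul, add_zero]
    · by_cases h3 : j.val = l.val
      · refine ⟨k, ⟨l.val - 1, by omega⟩, by rw [Fin.le_def]; simp only; omega,
          funext fun a => ?_⟩
        rw [h, if_pos h1, if_neg h2]
        simp only [ivl, Fin.le_def, Fin.ext_iff]
        split_ifs <;> first | rfl | omega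
      · refine ⟨k, j, by rw [Fin.le_def]; omega, funext fun a => ?_⟩
        rw [h, if_pos h1, if_neg h2]
        simp only [ivl, Fin.le_def, Fin.ext_iff]
        split_ifs <;> first | rfl | omega
  · by_cases h2 : k.val + 1 ≤ j.val + 2 ∧ j.val + 2 ≤ l.val + 1
    · by_cases h3 : j.val = k.val
      · refine ⟨⟨k.val + 1, by omega⟩, l, by rw [Fin.le_def]; simp only; omega,
          funext fun a => ?_⟩
        rw [h, if_neg h1, if_pos h2]
        simp only [ivl, Fin.le_def, Fin.ext_iff]
        split_ifs <;> first | rfl | omega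
      · refine ⟨j, l, by rw [Fin.le_def]; omega, funext fun a => ?_⟩
        rw [h, if_neg h1, if_pos h2]
        simp only [ivl, Fin.le_def, Fin.ext_iff]
        split_ifs <;> first | rfl | omega
    · refine ⟨k, l, hkl, funext fun a => ?_⟩
      rw [h, if_neg h1, if_neg h2, add_zero, zero_mul, add_zero]

theorem reflGroup_induction {p : Equiv.Perm (Bits n) → Prop} (h1 : p 1)
    (hmul : ∀ j π, p π → p (reflect j * π)) {π : Equiv.Perm (Bits n)} (hπ : π ∈ reflGroup n) :
    p π := by
  have key : ∀ π ∈ reflGroup n, ∀ τ, p τ → p (π * τ) := by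
    intro π hπ
    induction hπ using Subgroup.closure_induction'' with
    | one => intro τ h; rwa [one_mul]
    | mem x hx => obtain ⟨j, rfl⟩ := hx; exact hmul j
    | inv_mem x hx =>
      obtain ⟨j, rfl⟩ := hx
      rw [reflect_inv]; exact hmul j
    | mul x y _ _ hx hy => intro τ h; rw [mul_assoc]; exact hx _ (hy _ h)
  simpa using key π hπ 1 h1

theorem reflGroup_add {π : Equiv.Perm (Bits n)} (hπ : π ∈ reflGroup n) (x y : Bits n) :
    π (x + y) = π x + π y := by
  refine reflGroup_induction (p := fun π => ∀ x y, π (x + y) = π x + π y) (fun _ _ => rfl)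
    (fun j π h x y => ?_) hπ x y
  rw [Equiv.Perm.mul_apply, h, Equiv.Perm.mul_apply, Equiv.Perm.mul_apply, reflect_apply,
    reflect_apply, reflect_apply, nbr_add, add_smul]
  abel

/-- An element of the reflection group, as an additive map. -/
def reflHom {π : Equiv.Perm (Bits n)} (hπ : π ∈ reflGroup n) : Bits n →+ Bits n :=
  AddMonoidHom.mk' π (reflGroup_add hπ)

theorem reflGroup_isIvl {π : Equiv.Perm (Bits n)} (hπ : π ∈ reflGroup n) {v : Bits n}
    (hv : IsIvl v) : IsIvl (π v) :=
  reflGroup_induction (p := fun π => IsIvl (π v)) hv (fun j _ h => isIvl_reflect j h) hπ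

theorem reflGroup_quad (hm : m ≠ 3) {π : Equiv.Perm (Bits n)} (hπ : π ∈ reflGroup n)
    (x : Bits n) : quad m (π x) = quad m x := by
  refine reflGroup_induction (p := fun π => quad m (π x) = quad m x) rfl (fun j π h => ?_) hπ
  rw [Equiv.Perm.mul_apply, quad_reflect, if_neg hm, add_zero, h]

/-! ### The operators `S_{k,l}` and their exponentials -/

/-- The parity of the number of ones. -/
def parity (x : Bits n) : Fin 2 := ∑ a, x a

theorem parity_add (x y : Bits n) : parity (x + y) = parity x + parity y := Finset.sum_add_distrib

theorem parity_unit (j : Fin (n + 1)) : parity (unit n (j.val + 1)) = 1 := by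
  simp [parity, unit_apply]

theorem opS_aux (m k : ℕ) : ∀ len : ℕ, k + len ≤ n + 1 →
    ((List.range' (k + 1) len).map (opH m n)).prod =
      chi (parity fun a : Fin (n + 1) => if k ≤ a.val ∧ a.val < k + len then (1 : Fin 2) else 0) •
        shift m fun a : Fin (n + 1) => if k ≤ a.val ∧ a.val < k + len then 1 else 0 := by
  intro len
  induction len with
  | zero =>
    intro _
    have : (fun a : Fin (n + 1) => if k ≤ a.val ∧ a.val < k + 0 then (1 : Fin 2) else 0) = 0 := by
      funext a
      rw [if_neg (by omega)]; rfl
    rw [this, shift_zero]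
    simp [parity]
  | succ len ih =>
    intro h
    have hu : (fun a : Fin (n + 1) => if k ≤ a.val ∧ a.val < k + (len + 1) then (1 : Fin 2) else 0)
        = (fun a : Fin (n + 1) => if k ≤ a.val ∧ a.val < k + len then (1 : Fin 2) else 0) +
          unit n ((⟨k + len, by omega⟩ : Fin (n + 1)).val + 1) := by
      funext a
      rw [Pi.add_apply, unit_apply]
      simp only [Fin.ext_iff]
      split_ifs <;> first | rfl | omega
    rw [List.range'_1_concat, List.map_append, List.prod_append, ih (by omega), hu, parity_add,
      parity_unit, shift_add, chi_add, chi_one, List.map_singleton, List.prod_singleton,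
      show k + 1 + len = k + len + 1 by ring, opH_eq m (by omega) (by omega)]
    simp

/-- `S_{k,l}` is the translation by the indicator of `[k, l]`, up to the sign `(-1) ^ (l - k + 1)`. -/
theorem opS_eq (m : ℕ) {k l : Fin (n + 1)} (h : k ≤ l) :
    opS m n (k.val + 1) (l.val + 1) = chi (parity (ivl k l)) • shift m (ivl k l) := by
  rw [Fin.le_def] at h
  have hu : (fun a : Fin (n + 1) => if k.val ≤ a.val ∧ a.val < k.val + (l.val + 1 - k.val)
      then (1 : Fin 2) else 0) = ivl k l := by
    funext a
    simp only [ivl, Fin.le_def]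
    split_ifs <;> first | rfl | omega
  rw [opS, show l.val + 1 + 1 - (k.val + 1) = l.val + 1 - k.val by omega,
    opS_aux m k.val _ (by omega), hu]

/-- Euler's formula for an involution. -/
theorem exp_involution (S : Op n) (hS : S * S = 1) (t : ℝ) :
    NormedSpace.exp (((t : ℂ) * Complex.I) • S) =
      (Real.cos t : ℂ) • (1 : Op n) + ((Real.sin t : ℂ) * Complex.I) • S := by
  let _ : NormedRing (Op n) := Matrix.linftyOpNormedRing
  let _ : NormedAlgebra ℂ (Op n) := Matrix.linftyOpNormedAlgebra
  -- the exponential is transported from `ℂ × ℂ`, whose factors are the eigenspaces of `S`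
  let φ : ℂ × ℂ →+* Op n :=
    { toFun := fun z => ((z.1 + z.2) / 2) • (1 : Op n) + ((z.1 - z.2) / 2) • S
      map_one' := by simp
      map_zero' := by simp
      map_add' := fun z w => by
        simp only [Prod.fst_add, Prod.snd_add]
        module
      map_mul' := fun z w => by
        simp only [Prod.fst_mul, Prod.snd_mul, add_mul, mul_add, smul_mul_assoc, mul_smul_comm,
          one_mul, mul_one, hS]
        module }
  have hφ : Continuous φ := by
    change Continuous fun z : ℂ × ℂ => ((z.1 + z.2) / 2) • (1 : Op n) + ((z.1 - z.2) / 2) • S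
    fun_prop
  have h := NormedSpace.map_exp φ hφ ((t : ℂ) * Complex.I, -((t : ℂ) * Complex.I))
  have h1 : φ ((t : ℂ) * Complex.I, -((t : ℂ) * Complex.I)) = ((t : ℂ) * Complex.I) • S := by
    change (((t : ℂ) * Complex.I + -((t : ℂ) * Complex.I)) / 2) • (1 : Op n) +
      (((t : ℂ) * Complex.I - -((t : ℂ) * Complex.I)) / 2) • S = _
    module
  rw [h1] at h
  refine h.symm.trans ?_
  change (((NormedSpace.exp ((t : ℂ) * Complex.I, -((t : ℂ) * Complex.I))).1 +
    (NormedSpace.exp ((t : ℂ) * Complex.I, -((t : ℂ) * Complex.I))).2) / 2) • (1 : Op n) +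
    (((NormedSpace.exp ((t : ℂ) * Complex.I, -((t : ℂ) * Complex.I))).1 -
    (NormedSpace.exp ((t : ℂ) * Complex.I, -((t : ℂ) * Complex.I))).2) / 2) • S = _
  rw [Prod.fst_exp, Prod.snd_exp, ← Complex.exp_eq_exp_ℂ]
  simp only
  rw [show -((t : ℂ) * Complex.I) = ((-t : ℝ) : ℂ) * Complex.I by push_cast; ring,
    Complex.exp_mul_I, Complex.exp_mul_I, Complex.ofReal_cos, Complex.ofReal_sin]
  push_cast
  rw [Complex.cos_neg, Complex.sin_neg]
  module

/-! ### Rotations in the group algebra of the bit strings -/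

/-- The rotation `cos t + i sin t [u]` in the group algebra. -/
noncomputable def rotR (t : ℝ) (u : Bits n) : AddMonoidAlgebra ℂ (Bits n) :=
  .single 0 (Real.cos t : ℂ) + .single u ((Real.sin t : ℂ) * Complex.I)

theorem rotR_add (s t : ℝ) (u : Bits n) : rotR (s + t) u = rotR s u * rotR t u := by
  simp only [rotR, add_mul, mul_add, AddMonoidAlgebra.single_mul_single, add_zero, zero_add,
    bits_add_self, Real.cos_add, Real.sin_add]
  have key : ∀ a b c d : ℂ, AddMonoidAlgebra.single (0 : Bits n) a + AddMonoidAlgebra.single u b +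
      (AddMonoidAlgebra.single u c + AddMonoidAlgebra.single 0 d) =
        AddMonoidAlgebra.single 0 (a + d) + AddMonoidAlgebra.single u (b + c) := by
    intro a b c d
    rw [AddMonoidAlgebra.single_add, AddMonoidAlgebra.single_add]
    abel
  rw [key]
  push_cast
  congr 2
  · linear_combination (-(Complex.sin s * Complex.sin t)) * Complex.I_mul_I
  · ring

theorem rotR_zero (u : Bits n) : rotR 0 u = 1 := by
  simp [rotR, AddMonoidAlgebra.one_def]

theorem rotR_add_period (t : ℝ) (k : ℕ) (u : Bits n) :
    rotR (t + k * (2 * Real.pi)) u = rotR t u := by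
  simp only [rotR, Real.cos_add_nat_mul_two_pi, Real.sin_add_nat_mul_two_pi]

/-- The rotation by `c π / m`. -/
noncomputable def rot (c : Fin (2 * m)) (u : Bits n) : AddMonoidAlgebra ℂ (Bits n) :=
  rotR (c.val * (Real.pi / m)) u

theorem rot_add [NeZero m] (c d : Fin (2 * m)) (u : Bits n) : rot (c + d) u = rot c u * rot d u :=
    by
  have hm : (m : ℝ) ≠ 0 := by exact_mod_cast NeZero.ne m
  have h := Nat.mod_add_div (c.val + d.val) (2 * m)
  rw [← Fin.val_add] at h
  rw [rot, rot, rot, ← rotR_add, ← rotR_add_period _ ((c.val + d.val) / (2 * m))]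
  congr 1
  have h' := congrArg (Nat.cast (R := ℝ)) h
  push_cast at h'
  rw [← add_mul, ← h']
  field_simp

theorem rot_zero [NeZero m] (u : Bits n) : rot (0 : Fin (2 * m)) u = 1 := by
  simp [rot, rotR_zero]

theorem rot_neg_mul [NeZero m] (c : Fin (2 * m)) (u : Bits n) : rot (-c) u * rot c u = 1 := by
  rw [← rot_add, neg_add_cancel, rot_zero]

theorem rot_nsmul [NeZero m] (k : ℕ) (c : Fin (2 * m)) (u : Bits n) : rot (k • c) u =
    rot c u ^ k := by
  induction k with
  | zero => simp [rot_zero]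
  | succ k ih => rw [succ_nsmul, rot_add, ih, pow_succ]

theorem rot_neg [NeZero m] (c : Fin (2 * m)) (u : Bits n) : rot (-c) u =
    rotR (-(c.val * (Real.pi / m))) u := by
  have h : rotR (-(c.val * (Real.pi / m))) u * rot c u = 1 := by
    rw [rot, ← rotR_add, neg_add_cancel, rotR_zero]
  have := rot_neg_mul c u
  calc rot (-c) u = rot (-c) u * (rotR (-(c.val * (Real.pi / m))) u * rot c u) := by
        rw [h, mul_one]
    _ = (rot (-c) u * rot c u) * rotR (-(c.val * (Real.pi / m))) u := by ring
    _ = _ := by rw [this, one_mul]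

/-- The action of the group algebra on the qubits. -/
noncomputable def rep (m n : ℕ) : AddMonoidAlgebra ℂ (Bits n) →ₐ[ℂ] Op n :=
  AddMonoidAlgebra.lift ℂ (Op n) (Bits n)
    { toFun := fun u => shift m u.toAdd
      map_one' := shift_zero m
      map_mul' := fun u v => shift_add m u.toAdd v.toAdd }

theorem rep_rotR (t : ℝ) (u : Bits n) :
    rep m n (rotR t u) = (Real.cos t : ℂ) • (1 : Op n) +
      ((Real.sin t : ℂ) * Complex.I) • shift m u := by
  rw [rotR, map_add, rep, AddMonoidAlgebra.lift_single, AddMonoidAlgebra.lift_single]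
  simp [shift_zero]

/-- Negate `c` if the bit is set. -/
def flip (b : Fin 2) (c : Fin (2 * m)) : Fin (2 * m) := if b = 1 then -c else c

theorem flip_add [NeZero m] (b : Fin 2) (c d : Fin (2 * m)) : flip b (c + d) = flip b c +
    flip b d := by
  rw [flip, flip, flip]
  split_ifs
  · rw [neg_add]
  · rfl

theorem flip_flip (a b : Fin 2) (c : Fin (2 * m)) : flip a (flip b c) = flip (a + b) c := by
  fin_cases a <;> fin_cases b <;> simp [flip]

theorem flip_nsmul [NeZero m] (b : Fin 2) (k : ℕ) (c : Fin (2 * m)) : flip b (k • c) =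
    k • flip b c := by
  rw [flip, flip]
  split_ifs
  · rw [smul_neg]
  · rfl

theorem expS_eq [NeZero m] (k l : Fin (n + 1)) (h : k ≤ l) :
    expS m n (k.val + 1) (l.val + 1) =
      rep m n (rot (flip (parity (ivl k l)) (1 : Fin (2 * m))) (ivl k l)) := by
  have hm : 1 ≤ m := NeZero.one_le
  have h1 : ((1 : Fin (2 * m)) : ℕ) = 1 := by
    rw [Fin.val_one', Nat.mod_eq_of_lt (by omega)]
  have hT : shift m (ivl k l) * shift m (ivl k l) = 1 := by
    rw [← shift_add, bits_add_self, shift_zero]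
  have hc := chi_mul_self (parity (ivl k l))
  have hS : opS m n (k.val + 1) (l.val + 1) * opS m n (k.val + 1) (l.val + 1) = 1 := by
    rw [opS_eq m h, smul_mul_smul_comm, hc, hT, one_smul]
  rw [expS, show (Real.pi : ℂ) * Complex.I / m = ((Real.pi / m : ℝ) : ℂ) * Complex.I by
    push_cast; ring, exp_involution _ hS, opS_eq m h]
  have hb : parity (ivl k l) = 0 ∨ parity (ivl k l) = 1 := by
    generalize parity (ivl k l) = b
    revert b; decide
  rcases hb with hb | hb
  · rw [hb, flip, if_neg (by decide), rot, rep_rotR, h1]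
    simp
  · rw [hb, flip, if_pos rfl, rot_neg, rep_rotR, h1]
    simp

end QubitBraid

/-! ### The semidirect product -/

namespace QubitBraid

open scoped Fin.CommRing

variable {m n : ℕ}

theorem star_shift (m : ℕ) (u : Bits n) : star (shift m u) = shift m u := by
  rw [shift, star_signedPerm]
  congr 1
  rw [inv_eq_iff_mul_eq_one]
  ext1 x
  simp [add_assoc, bits_add_self]

theorem star_rep_rotR (t : ℝ) (u : Bits n) :
    star (rep m n (rotR t u)) = rep m n (rotR (-t) u) := by
  rw [rep_rotR, rep_rotR, star_add, star_smul, star_smul, star_one, star_shift, Real.cos_neg,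
    Real.sin_neg]
  congr 2
  · exact Complex.conj_ofReal _
  · rw [star_mul', Complex.star_def, Complex.conj_ofReal, Complex.conj_I]
    push_cast
    ring

/-- The rotation by `c π / m`, as a unitary operator. -/
noncomputable def rotU [NeZero m] (c : Fin (2 * m)) (u : Bits n) : UOp n :=
  ⟨rep m n (rot c u), by
    rw [Matrix.mem_unitaryGroup_iff', rot, star_rep_rotR, ← rot, ← rot_neg, ← map_mul,
      rot_neg_mul, map_one]⟩

theorem coe_rotU [NeZero m] (c : Fin (2 * m)) (u : Bits n) :
    (rotU c u : Op n) = rep m n (rot c u) := rfl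

theorem rotU_nsmul [NeZero m] (k : ℕ) (c : Fin (2 * m)) (u : Bits n) :
    rotU (k • c) u = rotU c u ^ k := by
  apply Subtype.ext
  rw [coe_rotU, rot_nsmul, map_pow]
  rfl

/-- The exponential `exp(π i S / m) ^ c` for the signed shift `S` by an interval. -/
noncomputable def ivlRot [NeZero m] (c : Fin (2 * m)) (v : Bits n) :
    AddMonoidAlgebra ℂ (Bits n) := rot (flip (parity v) c) v

theorem val_nsmul_one [NeZero m] (c : Fin (2 * m)) : c.val • (1 : Fin (2 * m)) = c := by
  rw [nsmul_one, Fin.cast_val_eq_self]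

theorem rep_ivlRot [NeZero m] {k l : Fin (n + 1)} (h : k ≤ l) (c : Fin (2 * m)) :
    rep m n (ivlRot c (ivl k l)) = expS m n (k.val + 1) (l.val + 1) ^ c.val := by
  rw [expS_eq k l h, ← map_pow, ← rot_nsmul, ← flip_nsmul, val_nsmul_one, ivlRot]

/-- The sign of `S_{k,l}` does not matter for membership in `G`. -/
theorem rotU_mem [NeZero m] {v : Bits n} (hv : IsIvl v) (c : Fin (2 * m)) :
    rotU c v ∈ groupG m n := by
  obtain ⟨k, l, hkl, rfl⟩ := hv
  have h : rotU c (ivl k l) =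
      rotU (flip (parity (ivl k l)) (1 : Fin (2 * m))) (ivl k l) ^
        (flip (parity (ivl k l)) c).val := by
    rw [← rotU_nsmul, ← flip_nsmul, val_nsmul_one, flip_flip]
    have : ∀ b : Fin 2, b + b = 0 := by decide
    rw [this, flip, if_neg (by decide)]
  rw [h]
  have hkl' : k.val ≤ l.val := hkl
  refine Subgroup.pow_mem _ (Subgroup.subset_closure ?_) _
  exact ⟨k.val + 1, l.val + 1, by omega, by omega, by omega, (expS_eq k l hkl).symm⟩

/-- Elements of `G` are products of rotations. -/
theorem groupG_induction [NeZero m] {p : UOp n → Prop} (h1 : p 1)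
    (hmul : ∀ g h, p g → p h → p (g * h)) (hinv : ∀ g, p g → p g⁻¹)
    (hrot : ∀ k l : Fin (n + 1), k ≤ l → ∀ g : UOp n,
      (g : Op n) = expS m n (k.val + 1) (l.val + 1) → p g) {g : UOp n} (hg : g ∈ groupG m n) :
    p g := by
  induction hg using Subgroup.closure_induction with
  | one => exact h1
  | mul x y _ _ hx hy => exact hmul x y hx hy
  | inv x _ hx => exact hinv x hx
  | mem x hx =>
    obtain ⟨k, l, hk, hkl, hl, hx⟩ := hx
    refine hrot ⟨k - 1, by omega⟩ ⟨l - 1, by omega⟩ (by rw [Fin.le_def]; simp only; omega) x ?_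
    simp only [Nat.sub_add_cancel hk, Nat.sub_add_cancel (hk.trans hkl)]
    exact hx

theorem signedPerm_mul_shift {π : Equiv.Perm (Bits n)} (hπ : π ∈ reflGroup n) (u : Bits n) :
    signedPerm m π * shift m u = shift m (π u) * signedPerm m π := by
  rw [shift, shift, ← signedPerm_mul, ← signedPerm_mul]
  congr 1
  ext1 x
  exact reflGroup_add hπ x u

/-- Conjugation by an element of `H` turns the rotation along `u` into the rotation along `π u`. -/
theorem signedPerm_mul_rep_rot {π : Equiv.Perm (Bits n)} (hπ : π ∈ reflGroup n)
    (c : Fin (2 * m)) (u : Bits n) :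
    signedPerm m π * rep m n (rot c u) = rep m n (rot c (π u)) * signedPerm m π := by
  rw [rot, rot, rep_rotR, rep_rotR, mul_add, add_mul, mul_smul_comm, mul_smul_comm, smul_mul_assoc,
    smul_mul_assoc, signedPerm_mul_shift hπ, mul_one, one_mul]

theorem conj_mem_groupG [NeZero m] {π : Equiv.Perm (Bits n)} (hπ : π ∈ reflGroup n) {g : UOp n}
    (hg : g ∈ groupG m n) : permU m π * g * (permU m π)⁻¹ ∈ groupG m n := by
  refine groupG_induction (m := m) (p := fun g => permU m π * g * (permU m π)⁻¹ ∈ groupG m n) ?_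
    ?_ ?_ ?_ hg
  · simp [one_mem]
  · intro g h hg hh
    simpa [mul_assoc] using mul_mem hg hh
  · intro g hg
    simpa [mul_assoc] using inv_mem hg
  · intro k l hkl g hg
    have : permU m π * g * (permU m π)⁻¹ =
        rotU (flip (parity (ivl k l)) (1 : Fin (2 * m))) (π (ivl k l)) := by
      rw [mul_inv_eq_iff_eq_mul]
      apply Subtype.ext
      rw [Submonoid.coe_mul, Submonoid.coe_mul, hg, coe_permU, expS_eq k l hkl,
        signedPerm_mul_rep_rot hπ, coe_rotU]
    rw [this]
    exact rotU_mem (reflGroup_isIvl hπ ⟨k, l, hkl, rfl⟩) _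

/-- Conjugation by an element of `H` permutes the rotations along intervals. -/
theorem groupH_le_normalizer [NeZero m] (n : ℕ) :
    groupH m n ≤ Subgroup.normalizer (groupG m n : Set (UOp n)) := by
  have key : ∀ h ∈ groupH m n, ∀ g ∈ groupG m n, h * g * h⁻¹ ∈ groupG m n := by
    intro h hh g hg
    rw [groupH_eq] at hh
    obtain ⟨π, hπ, rfl⟩ := hh
    exact conj_mem_groupG hπ hg
  intro h hh
  rw [Subgroup.mem_normalizer_iff]
  intro g
  refine ⟨key h hh g, fun hg => ?_⟩
  simpa [mul_assoc] using key h⁻¹ (inv_mem hh) _ hg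

/-- The elements of `G` commute with all shifts. -/
theorem groupG_comm_shift [NeZero m] {g : UOp n} (hg : g ∈ groupG m n) (u : Bits n) :
    g * permU m (Equiv.addRight u) = permU m (Equiv.addRight u) * g := by
  refine groupG_induction (m := m) (p := fun g => g * permU m (Equiv.addRight u) =
    permU m (Equiv.addRight u) * g) ?_ ?_ ?_ ?_ hg
  · rw [one_mul, mul_one]
  · intro g h hg hh
    exact Commute.mul_left (show Commute g _ from hg) hh
  · intro g hg
    exact Commute.inv_left (show Commute g _ from hg)
  · intro k l hkl g hg
    apply Subtype.ext
    have hs : (permU m (Equiv.addRight u) : Op n) = rep m n (.single u 1) := by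
      rw [rep, AddMonoidAlgebra.lift_single, one_smul]; rfl
    rw [Submonoid.coe_mul, Submonoid.coe_mul, hg, expS_eq k l hkl, hs, ← map_mul, ← map_mul,
      mul_comm]

theorem reflGroup_zero {π : Equiv.Perm (Bits n)} (hπ : π ∈ reflGroup n) : π 0 = 0 :=
  map_zero (reflHom hπ)

/-- An element of both groups is the signed permutation matrix of a linear map that commutes with
all translations; evaluation at `0` shows that it is the identity. -/
theorem groupG_inf_groupH [NeZero m] (n : ℕ) : groupG m n ⊓ groupH m n = ⊥ := by
  rw [eq_bot_iff]
  rintro g ⟨hG, hH⟩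
  rw [SetLike.mem_coe, groupH_eq] at hH
  obtain ⟨π, hπ, rfl⟩ := hH
  have : π = 1 := by
    ext1 u
    have h := groupG_comm_shift hG u
    rw [← map_mul, ← map_mul] at h
    have h' := DFunLike.congr_fun (permU_injective m h) 0
    simpa [reflGroup_zero hπ] using h'
  rw [this, map_one]
  exact one_mem _

/-! ### Tables of exponents -/

/-- The product of the powers that a table of exponents lists, in the group algebra. -/
noncomputable def expA [NeZero m] (e : Table m n) : AddMonoidAlgebra ℂ (Bits n) :=
  ∏ k, ∏ l, if k ≤ l then ivlRot (e k l) (ivl k l) else 1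

theorem ivlRot_add [NeZero m] (c d : Fin (2 * m)) (v : Bits n) :
    ivlRot (c + d) v = ivlRot c v * ivlRot d v := by
  rw [ivlRot, flip_add, rot_add]; rfl

theorem ivlRot_zero [NeZero m] (v : Bits n) : ivlRot (0 : Fin (2 * m)) v = 1 := by
  rw [ivlRot, flip, neg_zero, ite_self, rot_zero]

theorem expA_add [NeZero m] (e f : Table m n) : expA (e + f) = expA e * expA f := by
  rw [expA, expA, expA, ← Finset.prod_mul_distrib]
  refine Finset.prod_congr rfl fun k _ => ?_
  rw [← Finset.prod_mul_distrib]
  refine Finset.prod_congr rfl fun l _ => ?_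
  split_ifs
  · exact ivlRot_add _ _ _
  · rw [one_mul]

theorem expA_zero [NeZero m] : expA (0 : Table m n) = 1 := by
  rw [expA]
  refine Finset.prod_eq_one fun k _ => Finset.prod_eq_one fun l _ => ?_
  simp [ivlRot_zero]

theorem rep_expA [NeZero m] (e : Table m n) : rep m n (expA e) = expProd m n e := by
  rw [expA, ← List.prod_ofFn, map_list_prod, List.map_ofFn, expProd]
  congr 2
  funext k
  rw [Function.comp_apply, ← List.prod_ofFn, map_list_prod, List.map_ofFn]
  congr 2
  funext l
  rw [Function.comp_apply]
  split_ifs with h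
  · exact rep_ivlRot h _
  · exact map_one _

theorem exists_groupG_of_table [NeZero m] (e : Table m n) :
    ∃ A ∈ groupG m n, (A : Op n) = rep m n (expA e) := by
  let p : AddMonoidAlgebra ℂ (Bits n) → Prop := fun a => ∃ A ∈ groupG m n, (A : Op n) = rep m n a
  have hmul : ∀ a b, p a → p b → p (a * b) := by
    rintro a b ⟨A, hA, ha⟩ ⟨B, hB, hb⟩
    exact ⟨A * B, mul_mem hA hB, by rw [Submonoid.coe_mul, ha, hb, map_mul]⟩
  have hone : p 1 := ⟨1, one_mem _, by rw [map_one]; rfl⟩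
  refine Finset.prod_induction _ p hmul hone fun k _ =>
    Finset.prod_induction _ p hmul hone fun l _ => ?_
  split_ifs with h
  · exact ⟨rotU _ _, rotU_mem ⟨k, l, h, rfl⟩ _, rfl⟩
  · exact hone

/-- The table with a single entry. -/
def cell [NeZero m] (k l : Fin (n + 1)) (c : Fin (2 * m)) : Table m n :=
  fun a b => if a = k ∧ b = l then c else 0

theorem expA_cell [NeZero m] {k l : Fin (n + 1)} (h : k ≤ l) (c : Fin (2 * m)) :
    expA (cell k l c) = ivlRot c (ivl k l) := by
  rw [expA, Finset.prod_eq_single k, Finset.prod_eq_single l]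
  · rw [if_pos h, cell, if_pos ⟨rfl, rfl⟩]
  · intro b _ hb
    simp [cell, hb, ivlRot_zero]
  · simp
  · intro a _ ha
    refine Finset.prod_eq_one fun b _ => ?_
    simp [cell, ha, ivlRot_zero]
  · simp

/-- `G` is commutative and its generators have order dividing `2 m`, so that tables with entries
modulo `2 m` exhaust it. -/
theorem exists_table_of_groupG [NeZero m] {g : UOp n} (hg : g ∈ groupG m n) :
    ∃ e : Table m n, (g : Op n) = rep m n (expA e) := by
  refine groupG_induction (m := m) (p := fun g => ∃ e : Table m n, (g : Op n) = rep m n (expA e))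
    ?_ ?_ ?_ ?_ hg
  · exact ⟨0, by rw [expA_zero, map_one]; rfl⟩
  · rintro g h ⟨e, he⟩ ⟨f, hf⟩
    exact ⟨e + f, by rw [Submonoid.coe_mul, he, hf, expA_add, map_mul]⟩
  · rintro g ⟨e, he⟩
    refine ⟨-e, ?_⟩
    have h1 : (g : Op n) * rep m n (expA (-e)) = 1 := by
      rw [he, ← map_mul, ← expA_add, add_neg_cancel, expA_zero, map_one]
    have h2 : ((g⁻¹ : UOp n) : Op n) * (g : Op n) = 1 := by
      rw [← Submonoid.coe_mul, inv_mul_cancel]; rfl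
    calc ((g⁻¹ : UOp n) : Op n) = ((g⁻¹ : UOp n) : Op n) * ((g : Op n) * rep m n (expA (-e))) := by
          rw [h1, mul_one]
      _ = _ := by rw [← mul_assoc, h2, one_mul]
  · intro k l hkl g hg
    refine ⟨cell k l 1, ?_⟩
    rw [hg, expA_cell hkl, expS_eq k l hkl, ivlRot]

/-! ### Updating a table -/

theorem firstOne_getElem? (l : List (Fin 2)) : ∀ i : ℕ,
    (firstOne l)[i]? = some 1 ↔ l[i]? = some 1 ∧ ∀ j < i, l[j]? = some 0 := by
  induction l with
  | nil => intro i; simp [firstOne]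
  | cons b l ih =>
    intro i
    rw [firstOne]
    split_ifs with hb
    · subst hb
      cases i with
      | zero => simp
      | succ i =>
        rw [List.getElem?_cons_succ, ih, List.getElem?_cons_succ, Nat.forall_lt_succ_left]
        simp
    · cases i with
      | zero => simp; omega
      | succ i =>
        rw [Nat.forall_lt_succ_left]
        simp [hb, List.getElem?_replicate]

theorem firstBit_eq_one (v : Bits n) (a : Fin (n + 1)) :
    firstBit v a = 1 ↔ v a = 1 ∧ ∀ b < a, v b = 0 := by
  have h := firstOne_getElem? (List.ofFn v) a
  have hlt : a.val < (firstOne (List.ofFn v)).length := by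
    rw [firstOne_length, List.length_ofFn]; exact a.isLt
  rw [List.getElem?_eq_getElem hlt, Option.some_inj] at h
  refine h.trans ?_
  rw [List.getElem?_eq_getElem (by rw [List.length_ofFn]; exact a.isLt), List.getElem_ofFn,
    Option.some_inj]
  refine and_congr_right fun _ => ⟨fun h b hb => ?_, fun h j hj => ?_⟩
  · have := h b.val hb
    rwa [List.getElem?_eq_getElem (by rw [List.length_ofFn]; exact b.isLt), List.getElem_ofFn,
      Option.some_inj] at this
  · rw [List.getElem?_eq_getElem (by rw [List.length_ofFn]; omega), List.getElem_ofFn,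
      Option.some_inj]
    exact h ⟨j, by omega⟩ hj

/-- The endpoints of an interval can be read off from its indicator. -/
theorem firstBit_ivl {k l : Fin (n + 1)} (h : k ≤ l) (a : Fin (n + 1)) :
    firstBit (ivl k l) a = 1 ↔ a = k := by
  rw [firstBit_eq_one]
  simp only [ivl]
  constructor
  · rintro ⟨h1, h2⟩
    split_ifs at h1 with h3
    · by_contra hne
      have := h2 k (lt_of_le_of_ne h3.1 (Ne.symm hne))
      rw [if_pos ⟨le_rfl, h⟩] at this
      exact absurd this (by decide)
    · exact absurd h1 (by decide)
  · rintro rfl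
    exact ⟨if_pos ⟨le_rfl, h⟩, fun b hb => if_neg fun h' => absurd h'.1 (not_le.2 hb)⟩

theorem lastBit_eq (v : Bits n) (a : Fin (n + 1)) :
    lastBit v a = firstBit (fun b => v b.rev) a.rev := by
  have h : (List.ofFn v).reverse = List.ofFn fun b : Fin (n + 1) => v b.rev := by
    apply List.ext_getElem
    · simp only [List.length_reverse, List.length_ofFn]
    · intro i h1 h2
      rw [List.getElem_reverse, List.getElem_ofFn, List.getElem_ofFn]
      congr 1
      rw [Fin.ext_iff, Fin.val_rev]
      simp only [List.length_ofFn]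
      omega
  simp only [lastBit, firstBit, lastOne, h, List.getElem_reverse, firstOne_length,
    List.length_ofFn, Fin.val_rev]
  congr 1
  omega

theorem lastBit_ivl {k l : Fin (n + 1)} (h : k ≤ l) (a : Fin (n + 1)) :
    lastBit (ivl k l) a = 1 ↔ a = l := by
  have hr : (fun b : Fin (n + 1) => ivl k l b.rev) = ivl l.rev k.rev := by
    funext b
    simp only [ivl, Fin.le_rev_iff, Fin.rev_le_iff]
    exact if_congr and_comm rfl rfl
  rw [lastBit_eq, hr, firstBit_ivl (Fin.rev_le_rev.2 h), Fin.rev_inj]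

theorem signed_ofFn [NeZero m] (v : Bits n) (c : Fin (2 * m)) :
    signed (List.ofFn v) c = flip (parity v) c := by
  rw [parity, ← List.sum_ofFn, signed]
  generalize List.ofFn v = l
  induction l generalizing c with
  | nil => simp [flip]
  | cons b l ih =>
    rw [List.foldl_cons, ih, List.sum_cons, add_comm, ← flip_flip]
    rfl

/-- Twice a bit, as a phase. -/
def dbl (b : Fin 2) : Fin 4 := if b = 1 then 2 else 0

theorem dbl_add (a b : Fin 2) : dbl (a + b) = dbl a + dbl b := by
  revert a b; decide

/-- The table is updated in such a way that the operator gains the rotation by `± c π / m` along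
the interval `v`. -/
theorem expA_addEntry [NeZero m] (b : Fin 2) {v : Bits n} (hv : IsIvl v) (c : Fin (2 * m))
    (e : Table m n) : expA (addEntry (dbl b) v c e) = expA e * rot (flip b c) v := by
  obtain ⟨k, l, hkl, rfl⟩ := hv
  have hb : (if dbl b = 2 then -c else c) = flip b c := by
    fin_cases b <;> rfl
  have h : addEntry (dbl b) (ivl k l) c e =
      e + cell k l (flip (parity (ivl k l)) (flip b c)) := by
    funext a a'
    rw [addEntry, addRankOne, Pi.add_apply, Pi.add_apply, cell, signed_ofFn, hb]
    simp only [firstBit_ivl hkl, lastBit_ivl hkl]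
    split_ifs
    · rfl
    · rw [add_zero]
  have two : ∀ b : Fin 2, b + b = 0 := by decide
  rw [h, expA_add, expA_cell hkl, ivlRot, flip_flip, two]
  rfl

end QubitBraid

/-! ### The product of descriptions describes the product -/

namespace QubitBraid

open scoped Fin.CommRing

variable {m n : ℕ}

/-- The indicator of the half-open interval from `k` to `t`. -/
def seg (n k t : ℕ) : Bits n := fun a => if k ≤ a.val ∧ a.val < t then 1 else 0

theorem seg_self (k : ℕ) : seg n k k = 0 := by
  funext a
  exact if_neg (by omega)

theorem seg_succ {k : ℕ} (t : Fin (n + 1)) (h : k ≤ t.val) :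
    seg n k (t.val + 1) = seg n k t.val + unit n (t.val + 1) := by
  funext a
  rw [Pi.add_apply, unit_apply]
  simp only [seg, Fin.ext_iff]
  split_ifs <;> first | rfl | omega

theorem seg_succ_eq_ivl (k t : Fin (n + 1)) : seg n k.val (t.val + 1) = ivl k t := by
  funext a
  simp only [seg, ivl, Fin.le_def, Nat.lt_succ_iff]

theorem drop_ofFn {α : Type*} {N : ℕ} (f : Fin N → α) (t : Fin N) :
    (List.ofFn f).drop t.val = f t :: (List.ofFn f).drop (t.val + 1) := by
  rw [List.drop_eq_getElem_cons (by rw [List.length_ofFn]; exact t.isLt), List.getElem_ofFn]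

theorem prod_ge_split {M : Type*} [CommMonoid M] {N : ℕ} (G : Fin N → M) (t : Fin N) :
    ∏ l, (if t.val ≤ l.val then G l else 1) =
      G t * ∏ l, if t.val + 1 ≤ l.val then G l else 1 := by
  have h : ∀ l : Fin N, (if t.val ≤ l.val then G l else 1) =
      (if l = t then G l else 1) * if t.val + 1 ≤ l.val then G l else 1 := by
    intro l
    by_cases h1 : l = t
    · subst h1
      rw [if_pos le_rfl, if_pos rfl, if_neg (by omega), mul_one]
    · rw [if_neg h1, one_mul]
      have : l.val ≠ t.val := fun h => h1 (Fin.ext h)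
      exact if_congr (by omega) rfl rfl
  rw [Finset.prod_congr rfl fun l _ => h l, Finset.prod_mul_distrib, Finset.prod_ite_eq' _ t G,
    if_pos (Finset.mem_univ _)]

/-- One factor of the image of the table `e` under conjugation by `π`. -/
noncomputable def conjFactor [NeZero m] (π : Equiv.Perm (Bits n)) (e : Table m n)
    (k l : Fin (n + 1)) : AddMonoidAlgebra ℂ (Bits n) :=
  rot (flip (parity (ivl k l)) (e k l)) (π (ivl k l))

/-- Invariant of the inner loop: before step `t` the phase is twice the parity of the segment from
`k` to `t`, and the accumulated string is the image of this segment. -/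
theorem expA_innerE [NeZero m] {π : Equiv.Perm (Bits n)} (hπ : π ∈ reflGroup n) (e' : Table m n)
    (k : Fin (n + 1)) : ∀ (d t : ℕ) (e : Table m n), t + d = n + 1 → k.val ≤ t →
      expA (innerE (dbl (parity (seg n k t))) (π (seg n k t)) e
        ((List.ofFn fun l : Fin (n + 1) => (π (unit n (l.val + 1)), e' k l)).drop t)) =
      expA e * ∏ l : Fin (n + 1), if t ≤ l.val then conjFactor π e' k l else 1 := by
  intro d
  induction d with
  | zero =>
    intro t e ht _
    rw [List.drop_of_length_le (by rw [List.length_ofFn]; omega), innerE,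
      Finset.prod_eq_one fun l _ => if_neg (by omega), mul_one]
  | succ d ih =>
    intro t e ht hk
    have hlt : t < n + 1 := by omega
    have hs : seg n k.val (t + 1) = seg n k.val t + unit n (t + 1) :=
      seg_succ (k := k.val) ⟨t, hlt⟩ hk
    have hi : seg n k.val (t + 1) = ivl k ⟨t, hlt⟩ := seg_succ_eq_ivl k ⟨t, hlt⟩
    have hd : dbl (parity (seg n k.val t)) + 2 = dbl (parity (seg n k.val (t + 1))) := by
      rw [hs, parity_add, dbl_add, parity_unit (⟨t, hlt⟩ : Fin (n + 1))]
      rfl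
    have hv : π (seg n k.val t) + π (unit n (t + 1)) = π (seg n k.val (t + 1)) := by
      rw [hs, reflGroup_add hπ]
    rw [drop_ofFn _ (⟨t, hlt⟩ : Fin (n + 1)), innerE, hd, hv, ih (t + 1) _ (by omega) (by omega),
      hi, expA_addEntry _ (reflGroup_isIvl hπ ⟨k, ⟨t, hlt⟩, hk, rfl⟩),
      prod_ge_split (conjFactor π e' k) ⟨t, hlt⟩, mul_assoc]
    rfl

theorem expA_outerE [NeZero m] {π : Equiv.Perm (Bits n)} (hπ : π ∈ reflGroup n)
    (e' : Table m n) : ∀ (d k : ℕ) (e : Table m n), k + d = n + 1 →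
      expA (outerE k e ((List.ofFn fun l : Fin (n + 1) => π (unit n (l.val + 1))).drop k)
        ((ltable e').drop k)) =
      expA e * ∏ a : Fin (n + 1), if k ≤ a.val then
        (∏ l : Fin (n + 1), if a.val ≤ l.val then conjFactor π e' a l else 1) else 1 := by
  intro d
  induction d with
  | zero =>
    intro k e hk
    rw [List.drop_of_length_le (l := ltable e') (by rw [ltable_length]; omega), outerE,
      Finset.prod_eq_one fun l _ => if_neg (by omega), mul_one]
  | succ d ih =>
    intro k e hk
    have hlt : k < n + 1 := by omega
    have hz : ((List.ofFn fun l : Fin (n + 1) => π (unit n (l.val + 1))).drop k).zip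
        ((List.ofFn (e' ⟨k, hlt⟩)).drop k) =
        (List.ofFn fun l : Fin (n + 1) => (π (unit n (l.val + 1)), e' ⟨k, hlt⟩ l)).drop k := by
      rw [List.zip, ← List.drop_zipWith, zipWith_ofFn]
    have h1 := expA_innerE hπ e' ⟨k, hlt⟩ (n + 1 - k) k e (by omega) le_rfl
    rw [seg_self, reflGroup_zero hπ, show dbl (parity (0 : Bits n)) = 0 by simp [parity, dbl]] at h1
    rw [ltable, drop_ofFn (fun k => List.ofFn (e' k)) (⟨k, hlt⟩ : Fin (n + 1)), outerE, hz,
      List.tail_drop]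
    refine (ih (k + 1) _ (by omega)).trans ?_
    rw [h1, prod_ge_split (fun a : Fin (n + 1) => ∏ l : Fin (n + 1),
      if a.val ≤ l.val then conjFactor π e' a l else 1) ⟨k, hlt⟩, mul_assoc]

theorem signedPerm_mul_rep_prod {ι : Type*} (π : Equiv.Perm (Bits n)) (s : Finset ι)
    (f g : ι → AddMonoidAlgebra ℂ (Bits n))
    (h : ∀ i ∈ s, signedPerm m π * rep m n (f i) = rep m n (g i) * signedPerm m π) :
    signedPerm m π * rep m n (∏ i ∈ s, f i) = rep m n (∏ i ∈ s, g i) * signedPerm m π := by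
  classical
  induction s using Finset.induction_on with
  | empty => simp
  | insert i s hi ih =>
    rw [Finset.prod_insert hi, Finset.prod_insert hi, map_mul, map_mul, ← mul_assoc,
      h i (by simp), mul_assoc, ih fun j hj => h j (by simp [hj]), mul_assoc]

/-- Moving `π` past the second factor changes the table of the first factor as `outerE` does. -/
theorem signedPerm_mul_rep_expA [NeZero m] {π : Equiv.Perm (Bits n)} (hπ : π ∈ reflGroup n)
    (e e' : Table m n) :
    rep m n (expA e) * (signedPerm m π * rep m n (expA e')) =
      rep m n (expA (outerE 0 e (List.ofFn fun l : Fin (n + 1) => π (unit n (l.val + 1)))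
        (ltable e'))) * signedPerm m π := by
  have h := expA_outerE hπ e' (n + 1) 0 e (by omega)
  rw [List.drop_zero, List.drop_zero] at h
  rw [h, map_mul, mul_assoc]
  congr 1
  rw [expA]
  refine signedPerm_mul_rep_prod π _ _ _ fun a _ => ?_
  rw [if_pos (Nat.zero_le _)]
  refine signedPerm_mul_rep_prod π _ _ _ fun l _ => ?_
  simp only [Fin.le_def]
  split_ifs
  · exact signedPerm_mul_rep_rot hπ _ _
  · rw [map_one, mul_one, one_mul]

/-! ### The images of the Pauli operators -/

theorem chi_sum {ι : Type*} (s : Finset ι) (f : ι → Fin 2) :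
    chi (∑ i ∈ s, f i) = ∏ i ∈ s, chi (f i) := by
  classical
  induction s using Finset.induction_on with
  | empty => simp
  | insert i s hi ih => rw [Finset.sum_insert hi, Finset.prod_insert hi, chi_add, ih]

/-- The permutation matrix of the addition of `u`, that is, a product of Pauli operators `X`. -/
noncomputable def xMat : Multiplicative (Bits n) →* Op n where
  toFun u := Matrix.of fun y x => if y = x + u.toAdd then 1 else 0
  map_one' := by
    ext y x
    simp [Matrix.one_apply]
  map_mul' u v := by
    ext y x
    rw [Matrix.mul_apply, Finset.sum_eq_single (x + v.toAdd)]
    · simp [add_comm, add_left_comm]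
    · intro z _ hz
      simp [hz]
    · simp

theorem opX_eq (a : Fin (n + 1)) : opX n (a.val + 1) = xMat (.ofAdd (unit n (a.val + 1))) := by
  ext y x
  rw [opX_apply, addBit_eq, one_smul]
  rfl

theorem sum_smul_unit (x : Bits n) : ∑ a : Fin (n + 1), x a • unit n (a.val + 1) = x := by
  funext b
  rw [Finset.sum_apply]
  simp [unit_apply]

theorem toOp_apply (P : PauliWord n) (y x : Bits n) :
    P.toOp y x = if y = x + P.xBits then Complex.I ^ P.phase.val * chi (∑ a, P.zBits a * x a)
      else 0 := by
  have hX : (List.ofFn fun j : Fin (n + 1) => if P.xBits j = 1 then opX n (j.val + 1) else 1).prod =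
      xMat (.ofAdd P.xBits) := by
    have h1 : ∀ j : Fin (n + 1), (if P.xBits j = 1 then opX n (j.val + 1) else 1) =
        xMat (.ofAdd (P.xBits j • unit n (j.val + 1))) := by
      intro j
      rcases (show P.xBits j = 0 ∨ P.xBits j = 1 by generalize P.xBits j = b; revert b; decide)
        with h | h
      · rw [h, if_neg (by decide), zero_smul]; exact (map_one xMat).symm
      · rw [h, if_pos rfl, one_smul, opX_eq]
    have h2 : (List.ofFn fun j : Fin (n + 1) => xMat (.ofAdd (P.xBits j • unit n (j.val + 1)))) =
        (List.ofFn fun j : Fin (n + 1) =>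
          Multiplicative.ofAdd (P.xBits j • unit n (j.val + 1))).map xMat := by
      rw [List.map_ofFn]; rfl
    simp only [h1]
    rw [h2, ← map_list_prod, List.prod_ofFn, ← ofAdd_sum, sum_smul_unit]
  have hZ : (List.ofFn fun j : Fin (n + 1) => if P.zBits j = 1 then opZ n (j.val + 1) else 1).prod =
      Matrix.diagonal fun x => chi (∑ a, P.zBits a * x a) := by
    have h1 : ∀ j : Fin (n + 1), (if P.zBits j = 1 then opZ n (j.val + 1) else 1) =
        Matrix.diagonalRingHom (Bits n) ℂ fun x => chi (P.zBits j * x j) := by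
      intro j
      rcases (show P.zBits j = 0 ∨ P.zBits j = 1 by generalize P.zBits j = b; revert b; decide)
        with h | h
      · rw [h, if_neg (by decide)]
        simp only [zero_mul, chi_zero]
        exact (map_one (Matrix.diagonalRingHom (Bits n) ℂ)).symm
      · rw [h, if_pos rfl, opZ_eq]
        simp only [bitAt_succ, one_mul]
        rfl
    have h2 : (List.ofFn fun j : Fin (n + 1) => Matrix.diagonalRingHom (Bits n) ℂ fun x =>
        chi (P.zBits j * x j)) = (List.ofFn fun (j : Fin (n + 1)) (x : Bits n) =>
          chi (P.zBits j * x j)).map (Matrix.diagonalRingHom (Bits n) ℂ) := by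
      rw [List.map_ofFn]; rfl
    simp only [h1]
    rw [h2, ← map_list_prod, List.prod_ofFn]
    change Matrix.diagonal _ = _
    congr 1
    funext x
    rw [Finset.prod_apply, chi_sum]
  rw [PauliWord.toOp, hX, hZ, Matrix.smul_apply, Matrix.mul_diagonal]
  change _ • ((if y = x + P.xBits then (1 : ℂ) else 0) * _) = _
  split_ifs <;> simp

theorem I_pow_injective : Function.Injective fun p : Fin 4 => Complex.I ^ p.val := by
  intro p q h
  have h1 := congrArg Complex.re h
  have h2 := congrArg Complex.im h
  fin_cases p <;> fin_cases q <;> first | rfl | (norm_num [pow_succ] at h1; done) |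
    (norm_num [pow_succ] at h2)

/-- The matrix of a Pauli word determines the word, so that there is only one description of an
element of `H`. -/
theorem toOp_injective : Function.Injective (PauliWord.toOp (n := n)) := by
  intro P Q h
  have hI : ∀ p : Fin 4, Complex.I ^ p.val ≠ 0 := fun p => pow_ne_zero _ Complex.I_ne_zero
  have hchi : ∀ b, chi b ≠ 0 := fun b hb => by
    have := chi_mul_self b
    simp [hb] at this
  have he : ∀ y x, P.toOp y x = Q.toOp y x := fun y x => by rw [h]
  have hx : P.xBits = Q.xBits := by
    have h0 := he P.xBits 0
    rw [toOp_apply, toOp_apply, zero_add, zero_add, if_pos rfl] at h0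
    by_contra hne
    rw [if_neg hne] at h0
    exact mul_ne_zero (hI _) (hchi _) h0
  have hz : ∀ x : Bits n, Complex.I ^ P.phase.val * chi (∑ a, P.zBits a * x a) =
      Complex.I ^ Q.phase.val * chi (∑ a, Q.zBits a * x a) := by
    intro x
    have h0 := he (x + P.xBits) x
    rwa [toOp_apply, toOp_apply, hx, if_pos rfl, if_pos rfl] at h0
  have hp : P.phase = Q.phase := by
    have h0 := hz 0
    simp only [Pi.zero_apply, mul_zero, Finset.sum_const_zero, chi_zero, mul_one] at h0
    exact I_pow_injective h0
  have hb : P.zBits = Q.zBits := by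
    funext b
    have h0 := hz (unit n (b.val + 1))
    rw [hp] at h0
    have h1 := chi_injective (mul_left_cancel₀ (hI _) h0)
    simpa [unit_apply] using h1
  cases P; cases Q
  simp_all

/-- The image of `X_i` under conjugation by the signed permutation matrix of `π`. -/
def canonX (m : ℕ) (π : Equiv.Perm (Bits n)) (i : Fin (n + 1)) : PauliWord n where
  phase := if m = 3 then dbl (1 + parity (π (unit n (i.val + 1)))) else 0
  xBits := π (unit n (i.val + 1))
  zBits := 0

/-- The image of `Z_i` under conjugation by the signed permutation matrix of `π`. -/
def canonZ (π : Equiv.Perm (Bits n)) (i : Fin (n + 1)) : PauliWord n where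
  phase := 0
  xBits := 0
  zBits a := π⁻¹ (unit n (a.val + 1)) i

theorem reflHom_sum {π : Equiv.Perm (Bits n)} (hπ : π ∈ reflGroup n) (y : Bits n) :
    π y = ∑ a, y a • π (unit n (a.val + 1)) := by
  have h : ∀ (b : Fin 2) (x : Bits n), π (b • x) = b • π x := by
    intro b x
    rcases (show b = 0 ∨ b = 1 by revert b; decide) with rfl | rfl
    · rw [zero_smul, zero_smul, reflGroup_zero hπ]
    · rw [one_smul, one_smul]
  conv_lhs => rw [← sum_smul_unit y]
  rw [← Finset.sum_congr rfl fun a _ => h (y a) (unit n (a.val + 1))]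
  exact map_sum (reflHom hπ) _ _

theorem quad_three (x : Bits n) : quad 3 x = parity x := by
  rw [quad, if_pos rfl, add_zero, Finset.sum_range_succ', parity,
    Finset.sum_range fun k => bitAt x (k + 1)]
  simp only [bitAt_succ]
  exact add_zero _

theorem signedPerm_mul_opX {π : Equiv.Perm (Bits n)} (hπ : π ∈ reflGroup n) (i : Fin (n + 1)) :
    signedPerm m π * opX n (i.val + 1) = (canonX m π i).toOp * signedPerm m π := by
  ext y x
  rw [Matrix.mul_apply, Matrix.mul_apply, Finset.sum_eq_single (x + unit n (i.val + 1)),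
    Finset.sum_eq_single (π x)]
  · rw [opX_apply, addBit_eq, one_smul, if_pos rfl, mul_one, toOp_apply, signedPerm,
      Matrix.of_apply, Matrix.of_apply, reflGroup_add hπ, if_pos rfl, canonX]
    simp only [Pi.zero_apply, zero_mul, Finset.sum_const_zero, chi_zero, mul_one]
    by_cases h : y = π x + π (unit n (i.val + 1))
    · rw [if_pos h, if_pos h, h, ← reflGroup_add hπ]
      by_cases hm : m = 3
      · subst hm
        rw [if_pos rfl, sgn, sgn, sgn, sgn, quad_three, quad_three, quad_three, quad_three,
          reflGroup_add hπ, parity_add, parity_add, parity_unit]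
        have : ∀ b : Fin 2, Complex.I ^ (dbl b).val = chi b := by
          intro b
          fin_cases b
          · simp [dbl]
          · simp [dbl]
        rw [this]
        simp only [chi_add, chi_one]
        ring
      · rw [if_neg hm, sgn, sgn, sgn, sgn, reflGroup_quad hm hπ, reflGroup_quad hm hπ,
          chi_mul_self, chi_mul_self]
        simp
    · rw [if_neg h, if_neg h, zero_mul]
  · intro z _ hz
    simp [signedPerm, hz]
  · simp
  · intro z _ hz
    rw [opX_apply, addBit_eq, one_smul, if_neg hz, mul_zero]
  · simp

theorem signedPerm_mul_opZ {π : Equiv.Perm (Bits n)} (hπ : π ∈ reflGroup n) (i : Fin (n + 1)) :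
    signedPerm m π * opZ n (i.val + 1) = (canonZ π i).toOp * signedPerm m π := by
  ext y x
  rw [opZ_eq, Matrix.mul_diagonal, Matrix.mul_apply, Finset.sum_eq_single y]
  · rw [toOp_apply, canonZ, if_pos (add_zero y).symm]
    simp only [signedPerm, Matrix.of_apply, bitAt_succ]
    by_cases h : y = π x
    · have hx : ∑ a, π⁻¹ (unit n (a.val + 1)) i * y a = x i := by
        have h1 := reflHom_sum (inv_mem hπ) y
        have h2 : π⁻¹ y = x := by rw [h]; exact π.symm_apply_apply x
        rw [h2] at h1
        rw [h1, Finset.sum_apply]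
        exact Finset.sum_congr rfl fun a _ => mul_comm _ _
      rw [if_pos h, hx, Fin.val_zero, pow_zero, one_mul, mul_comm]
    · rw [if_neg h, zero_mul, mul_zero]
  · intro z _ hz
    rw [toOp_apply, canonZ, if_neg (by rw [add_zero]; exact hz.symm), zero_mul]
  · simp

end QubitBraid

namespace QubitBraid

open scoped Fin.CommRing Pointwise

variable {m n : ℕ}

theorem star_mul_signedPerm (m : ℕ) (π : Equiv.Perm (Bits n)) :
    signedPerm m π * star (signedPerm m π) = 1 := by
  rw [star_signedPerm, ← signedPerm_mul, mul_inv_cancel, signedPerm_one]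

/-- The descriptions in terms of the reflection group: the images of the Pauli operators are
determined by the permutation of the basis labels. -/
theorem describes_iff [NeZero m] (d : Desc m n) (U : UOp n) :
    Describes d U ↔ ∃ π ∈ reflGroup n, (U : Op n) = rep m n (expA d.expo) * signedPerm m π ∧
      d.xImg = canonX m π ∧ d.zImg = canonZ π := by
  constructor
  · rintro ⟨A, -, C, hC, rfl, hA, hX, hZ⟩
    rw [groupH_eq] at hC
    obtain ⟨π, hπ, rfl⟩ := hC
    refine ⟨π, hπ, by rw [Submonoid.coe_mul, hA, rep_expA, coe_permU], ?_, ?_⟩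
    · funext i
      apply toOp_injective
      rw [← hX i, coe_permU, signedPerm_mul_opX hπ, mul_assoc, star_mul_signedPerm, mul_one]
    · funext i
      apply toOp_injective
      rw [← hZ i, coe_permU, signedPerm_mul_opZ hπ, mul_assoc, star_mul_signedPerm, mul_one]
  · rintro ⟨π, hπ, hU, hX, hZ⟩
    obtain ⟨A, hA, hA'⟩ := exists_groupG_of_table d.expo
    refine ⟨A, hA, permU m π, by rw [groupH_eq]; exact ⟨π, hπ, rfl⟩, Subtype.ext ?_, ?_, ?_, ?_⟩
    · rw [hU, Submonoid.coe_mul, hA', coe_permU]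
    · rw [hA', rep_expA]
    · intro i
      rw [coe_permU, signedPerm_mul_opX hπ, mul_assoc, star_mul_signedPerm, mul_one, hX]
    · intro i
      rw [coe_permU, signedPerm_mul_opZ hπ, mul_assoc, star_mul_signedPerm, mul_one, hZ]

/-- An element of the reflection group is determined by the images of the `Z_i`: these list the
entries of the matrix of its inverse. -/
theorem canonZ_injective {π τ : Equiv.Perm (Bits n)} (hπ : π ∈ reflGroup n)
    (hτ : τ ∈ reflGroup n) (h : canonZ π = canonZ τ) : π = τ := by
  have h1 : ∀ a : Fin (n + 1), π⁻¹ (unit n (a.val + 1)) = τ⁻¹ (unit n (a.val + 1)) := by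
    intro a
    funext i
    exact congrFun (congrArg PauliWord.zBits (congrFun h i)) a
  rw [← inv_inj]
  ext1 y
  rw [reflHom_sum (inv_mem hπ), reflHom_sum (inv_mem hτ)]
  simp only [h1]

theorem describes_unique [NeZero m] {d : Desc m n} {U U' : UOp n} (h : Describes d U)
    (h' : Describes d U') : U = U' := by
  rw [describes_iff] at h h'
  obtain ⟨π, hπ, hU, -, hZ⟩ := h
  obtain ⟨τ, hτ, hU', -, hZ'⟩ := h'
  obtain rfl := canonZ_injective hπ hτ (hZ.symm.trans hZ')
  exact Subtype.ext (hU.trans hU'.symm)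

theorem mem_groupGH_iff [NeZero m] (U : UOp n) :
    U ∈ groupGH m n ↔ ∃ d : Desc m n, Describes d U := by
  constructor
  · intro hU
    have hU' : U ∈ (groupG m n : Set (UOp n)) * (groupH m n : Set (UOp n)) := by
      rw [← Subgroup.coe_mul_of_right_le_normalizer_left _ _ (groupH_le_normalizer n)]
      exact hU
    obtain ⟨A, hA, C, hC, rfl⟩ := hU'
    rw [SetLike.mem_coe, groupH_eq] at hC
    obtain ⟨π, hπ, rfl⟩ := hC
    obtain ⟨e, he⟩ := exists_table_of_groupG hA
    refine ⟨⟨e, canonX m π, canonZ π⟩, (describes_iff _ _).2 ⟨π, hπ, ?_, rfl, rfl⟩⟩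
    change ((A * permU m π : UOp n) : Op n) = _
    rw [Submonoid.coe_mul, he, coe_permU]
  · rintro ⟨d, A, hA, C, hC, rfl, -⟩
    exact mul_mem ((le_sup_left : groupG m n ≤ groupGH m n) hA)
      ((le_sup_right : groupH m n ≤ groupGH m n) hC)

theorem dbl_sum (u b : Bits n) :
    ∑ a, (if u a = 1 then dbl (b a) else 0) = dbl (∑ a, u a * b a) := by
  have h : ∀ (s : Finset (Fin (n + 1))) (f : Fin (n + 1) → Fin 2),
      dbl (∑ a ∈ s, f a) = ∑ a ∈ s, dbl (f a) := by
    intro s f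
    induction s using Finset.induction_on with
    | empty => simp [dbl]
    | insert a s ha ih => rw [Finset.sum_insert ha, Finset.sum_insert ha, dbl_add, ih]
  rw [h]
  refine Finset.sum_congr rfl fun a _ => ?_
  generalize u a = x
  generalize b a = y
  revert x y; decide

theorem conjWord_canonX {π τ : Equiv.Perm (Bits n)} (hπ : π ∈ reflGroup n) (d : Desc m n)
    (hX : d.xImg = canonX m π) (i : Fin (n + 1)) :
    conjWord d (canonX m τ i) = canonX m (π * τ) i := by
  have h1 := reflHom_sum hπ (τ (unit n (i.val + 1)))
  have h3 : ∑ a : Fin (n + 1), τ (unit n (i.val + 1)) a * (1 + parity (π (unit n (a.val + 1)))) =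
      parity (τ (unit n (i.val + 1))) + parity (π (τ (unit n (i.val + 1)))) := by
    rw [h1, parity, parity]
    simp only [mul_add, mul_one, Finset.sum_add_distrib, parity, Finset.sum_apply, Pi.smul_apply,
      smul_eq_mul]
    rw [Finset.sum_comm (s := Finset.univ) (t := Finset.univ)
      (f := fun x a => τ (unit n (i.val + 1)) a * π (unit n (a.val + 1)) x)]
    simp only [Finset.mul_sum]
  rw [conjWord, hX]
  simp only [canonX, Pi.zero_apply, Equiv.Perm.mul_apply, zero_mul, Finset.sum_const_zero, mul_zero,
    add_zero, PauliWord.mk.injEq, zero_ne_one, if_false]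
  refine ⟨?_, ?_, rfl⟩
  · by_cases hm : m = 3
    · simp only [if_pos hm]
      rw [dbl_sum _ fun a => 1 + parity (π (unit n (a.val + 1))), h3, ← dbl_add]
      congr 1
      generalize parity (τ (unit n (i.val + 1))) = x
      generalize parity (π (τ (unit n (i.val + 1)))) = y
      revert x y; decide
    · simp [if_neg hm]
  · funext b
    rw [h1, Finset.sum_apply]
    rfl

theorem conjWord_canonZ {π τ : Equiv.Perm (Bits n)} (hτ : τ ∈ reflGroup n) (d : Desc m n)
    (hZ : d.zImg = canonZ π) (i : Fin (n + 1)) :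
    conjWord d (canonZ τ i) = canonZ (π * τ) i := by
  rw [conjWord, hZ]
  simp only [canonZ, Pi.zero_apply, zero_mul, Finset.sum_const_zero, mul_zero,
    add_zero, PauliWord.mk.injEq, zero_ne_one, if_false]
  refine ⟨?_, ?_, ?_⟩
  · rw [zero_add]
    exact Finset.sum_eq_zero fun a _ => ite_self _
  · rfl
  funext b
  rw [zero_add, mul_inv_rev, Equiv.Perm.mul_apply, reflHom_sum (inv_mem hτ), Finset.sum_apply]
  exact Finset.sum_congr rfl fun a _ => mul_comm _ _

/-- The product of two descriptions describes the product. -/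
theorem mulDesc_describes [NeZero m] {d d' : Desc m n} {U U' : UOp n} (h : Describes d U)
    (h' : Describes d' U') : Describes (mulDesc d d') (U * U') := by
  rw [describes_iff] at h h' ⊢
  obtain ⟨π, hπ, hU, hX, hZ⟩ := h
  obtain ⟨τ, hτ, hU', hX', hZ'⟩ := h'
  refine ⟨π * τ, mul_mem hπ hτ, ?_, ?_, ?_⟩
  · rw [Submonoid.coe_mul, hU, hU', mul_assoc, ← mul_assoc (signedPerm m π), ← mul_assoc,
      signedPerm_mul_rep_expA hπ, mul_assoc, ← signedPerm_mul, mulDesc, hX]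
    rfl
  · funext i
    rw [mulDesc, hX']
    exact conjWord_canonX hπ d hX i
  · funext i
    rw [mulDesc, hZ']
    exact conjWord_canonZ hτ d hZ i

/-! ### Generators of the braid group -/

/-- The qubit, counted from `0`, at the centre of the image of `σ_{i+1}`. -/
def centre (i : Fin (n - 1)) : Fin (n + 1) := ⟨i.val + 1, by omega⟩

/-- The exponent with which `exp(π i S_{c,c} / m)` occurs in the image of a generator. -/
def genExpo (m : ℕ) [NeZero m] : Fin (2 * m) := if m = 3 then 2 else 1

/-- The image of `σ_{i+1}`. -/
noncomputable def genU (m : ℕ) [NeZero m] (i : Fin (n - 1)) : UOp n :=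
  rotU (-genExpo m) (unit n ((centre i).val + 1)) * permU m (reflect (centre i))

theorem reflect_mem (j : Fin (n + 1)) : reflect j ∈ reflGroup n :=
  Subgroup.subset_closure ⟨j, rfl⟩

theorem ivl_self (j : Fin (n + 1)) : ivl j j = unit n (j.val + 1) := by
  funext a
  rw [unit_apply, ivl]
  exact if_congr ⟨fun h => le_antisymm h.2 h.1, fun h => ⟨h.ge, h.le⟩⟩ rfl rfl

theorem nbr_unit' (j k : Fin (n + 1)) : nbr (unit n (j.val + 1)) (k.val + 1) =
    if k.val = j.val + 1 ∨ k.val + 1 = j.val then 1 else 0 := by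
  rw [nbr_unit (by omega) (by omega) (by omega)]
  exact if_congr (by omega) rfl rfl

theorem genMarks_eq (i : Fin (n - 1)) (a : Fin (n + 1)) : genMarks i a =
    if a = centre i then 2 else if nbr (unit n (a.val + 1)) ((centre i).val + 1) = 1 then 1
      else 0 := by
  rw [nbr_unit', genMarks]
  simp only [centre, Fin.ext_iff]
  split_ifs <;> first | rfl | omega | simp_all

/-- `genDesc` describes a power of `exp(π i S_{c,c} / m)` times the Clifford generator with the same
centre; the exponents `± genExpo m` give the braid generators and their inverses. -/
theorem describes_genDesc [NeZero m] (i : Fin (n - 1)) (e : Fin (2 * m)) :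
    Describes (genDesc (genMarks i) e)
      (rotU (-e) (unit n ((centre i).val + 1)) * permU m (reflect (centre i))) := by
  have h2 : ∀ a, genMarks i a = 2 ↔ a = centre i := by
    intro a
    rw [genMarks_eq]
    split_ifs <;> simp_all
  have hn : nbr (unit n ((centre i).val + 1)) ((centre i).val + 1) = 0 := by
    rw [nbr_unit', if_neg (by omega)]
  have h1 : ∀ a, genMarks i a = 1 ↔ nbr (unit n (a.val + 1)) ((centre i).val + 1) = 1 := by
    intro a
    rw [genMarks_eq]
    by_cases ha : a = centre i
    · rw [ha, hn]; simp
    · rw [if_neg ha]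
      split_ifs <;> simp_all
  have hr : ∀ a b, reflect (centre i) (unit n (a.val + 1)) b =
      if a = b ∨ (genMarks i a = 1 ∧ genMarks i b = 2) then 1 else 0 := by
    intro a b
    simp only [h1, h2]
    rw [reflect_apply, Pi.add_apply, Pi.smul_apply, unit_apply, unit_apply, smul_eq_mul]
    rcases (show nbr (unit n (a.val + 1)) ((centre i).val + 1) = 0 ∨
      nbr (unit n (a.val + 1)) ((centre i).val + 1) = 1 by
        generalize nbr (unit n (a.val + 1)) ((centre i).val + 1) = x
        revert x; decide) with h | h
    · rw [h]; simp [eq_comm]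
    · have : a ≠ centre i := by
        rintro rfl
        rw [hn] at h
        exact absurd h (by decide)
      rw [h]
      by_cases h3 : b = centre i
      · subst h3
        simp [this, this.symm]
      · simp [h3, eq_comm]
  rw [describes_iff]
  refine ⟨_, reflect_mem (centre i), ?_, ?_, ?_⟩
  · have : (genDesc (genMarks i) e : Desc m n).expo = cell (centre i) (centre i) e := by
      funext a b
      simp only [genDesc, cell, h2]
    rw [this, expA_cell le_rfl, ivl_self, ivlRot, parity_unit, flip, if_pos rfl]
    rfl
  · funext a
    simp only [genDesc, canonX, PauliWord.mk.injEq, and_true]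
    refine ⟨?_, funext fun b => (hr a b).symm⟩
    rw [reflect_apply, parity_add, parity_unit]
    have hp : ∀ b : Fin 2, parity (b • unit n ((centre i).val + 1)) = b := by
      intro b
      have : parity (b • unit n ((centre i).val + 1)) =
          b * parity (unit n ((centre i).val + 1)) := by
        simp only [parity, Pi.smul_apply, smul_eq_mul, Finset.mul_sum]
      rw [this, parity_unit, mul_one]
    simp only [hp, h1]
    by_cases hm : m = 3
    · simp only [hm, true_and, if_true]
      generalize nbr (unit n (a.val + 1)) ((centre i).val + 1) = x
      revert x; decide
    · simp [hm]
  · funext a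
    simp only [genDesc, canonZ, PauliWord.mk.injEq, true_and]
    refine funext fun b => ?_
    rw [reflect_inv, hr b a]
    exact if_congr (or_congr eq_comm and_comm) rfl rfl

theorem describes_one [NeZero m] (n : ℕ) :
    Describes (genDesc (fun _ => 0) 0 : Desc m n) (1 : UOp n) := by
  rw [describes_iff]
  refine ⟨1, one_mem _, ?_, ?_, ?_⟩
  · have : (genDesc (fun _ => 0) 0 : Desc m n).expo = 0 := by
      funext a b
      simp [genDesc]
    rw [this, expA_zero, map_one, signedPerm_one, mul_one]
    rfl
  · funext a
    simp only [genDesc, canonX, PauliWord.mk.injEq, and_true, Equiv.Perm.one_apply, parity_unit]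
    refine ⟨by simp [dbl], funext fun b => ?_⟩
    rw [unit_apply]
    simp [eq_comm]
  · funext a
    simp only [genDesc, canonZ, PauliWord.mk.injEq, true_and, inv_one, Equiv.Perm.one_apply]
    refine funext fun b => ?_
    rw [unit_apply]
    simp

theorem permU_mul_rotU [NeZero m] {π : Equiv.Perm (Bits n)} (hπ : π ∈ reflGroup n)
    (c : Fin (2 * m)) (u : Bits n) : permU m π * rotU c u = rotU c (π u) * permU m π :=
  Subtype.ext (signedPerm_mul_rep_rot hπ c u)

theorem rotU_comm [NeZero m] (c d : Fin (2 * m)) (u v : Bits n) :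
    rotU c u * rotU d v = rotU d v * rotU c u := by
  apply Subtype.ext
  rw [Submonoid.coe_mul, Submonoid.coe_mul, coe_rotU, coe_rotU, ← map_mul, ← map_mul, mul_comm]

theorem reflect_unit_self (j : Fin (n + 1)) :
    reflect j (unit n (j.val + 1)) = unit n (j.val + 1) := by
  rw [reflect_apply, nbr_unit', if_neg (by omega), zero_smul, add_zero]

theorem genU_inv [NeZero m] (i : Fin (n - 1)) : (genU m i)⁻¹ =
    rotU (-(-genExpo m)) (unit n ((centre i).val + 1)) * permU m (reflect (centre i)) := by
  rw [inv_eq_iff_mul_eq_one, genU, mul_assoc, ← mul_assoc (permU m _),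
    permU_mul_rotU (reflect_mem _), reflect_unit_self, mul_assoc, ← map_mul,
    show reflect (centre i) * reflect (centre i) = 1 by
      nth_rewrite 1 [← reflect_inv]; exact inv_mul_cancel _, map_one, mul_one]
  apply Subtype.ext
  rw [Submonoid.coe_mul, coe_rotU, coe_rotU, ← map_mul, mul_comm, rot_neg_mul, map_one]
  rfl

theorem reflect_unit_adj {j k : Fin (n + 1)} (h : j.val + 1 = k.val ∨ k.val + 1 = j.val) :
    reflect j (unit n (k.val + 1)) = unit n (k.val + 1) + unit n (j.val + 1) := by
  rw [reflect_apply, nbr_unit', if_pos (show j.val = k.val + 1 ∨ j.val + 1 = k.val by omega),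
    one_smul]

theorem reflect_unit_far {j k : Fin (n + 1)} (h : ¬(j.val + 1 = k.val ∨ k.val + 1 = j.val)) :
    reflect j (unit n (k.val + 1)) = unit n (k.val + 1) := by
  rw [reflect_apply, nbr_unit',
    if_neg (show ¬(j.val = k.val + 1 ∨ j.val + 1 = k.val) by omega), zero_smul, add_zero]

theorem reflect_braid {j k : Fin (n + 1)} (h : j.val + 1 = k.val) :
    reflect j * reflect k * reflect j = reflect k * reflect j * reflect k := by
  ext1 x
  have e1 : nbr (unit n (j.val + 1)) (j.val + 1) = 0 := by rw [nbr_unit', if_neg (by omega)]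
  have e2 : nbr (unit n (j.val + 1)) (k.val + 1) = 1 := by rw [nbr_unit', if_pos (by omega)]
  have e3 : nbr (unit n (k.val + 1)) (j.val + 1) = 1 := by rw [nbr_unit', if_pos (by omega)]
  have e4 : nbr (unit n (k.val + 1)) (k.val + 1) = 0 := by rw [nbr_unit', if_neg (by omega)]
  simp only [Equiv.Perm.mul_apply, reflect_apply, nbr_add, nbr_smul, e1, e2, e3, e4]
  funext a
  simp only [Pi.add_apply, Pi.smul_apply, smul_eq_mul]
  generalize nbr x (j.val + 1) = p
  generalize nbr x (k.val + 1) = q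
  generalize unit n (j.val + 1) a = r
  generalize unit n (k.val + 1) a = s
  generalize x a = t
  revert p q r s t; decide

theorem reflect_comm {j k : Fin (n + 1)} (h : j.val + 2 ≤ k.val) :
    reflect j * reflect k = reflect k * reflect j := by
  ext1 x
  have e2 : nbr (unit n (j.val + 1)) (k.val + 1) = 0 := by rw [nbr_unit', if_neg (by omega)]
  have e3 : nbr (unit n (k.val + 1)) (j.val + 1) = 0 := by rw [nbr_unit', if_neg (by omega)]
  simp only [Equiv.Perm.mul_apply, reflect_apply, nbr_add, nbr_smul, e2, e3]
  rw [mul_zero, mul_zero, add_zero, add_zero, add_right_comm]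

theorem mul_mul_eq_of_conj {G : Type*} [Group G] {Ra Rb Rab Ca Cb : G} (h1 : Ca * Rb = Rab * Ca)
    (h2 : Cb * Ra = Rab * Cb) (h3 : Ca * Rab = Rb * Ca) :
    Ra * Ca * (Rb * Cb) * (Ra * Ca) = Ra * Rab * Rb * (Ca * Cb * Ca) :=
  calc Ra * Ca * (Rb * Cb) * (Ra * Ca) = Ra * (Ca * Rb) * (Cb * Ra) * Ca := by
        simp only [mul_assoc]
    _ = Ra * Rab * (Ca * Rab) * Cb * Ca := by rw [h1, h2]; simp only [mul_assoc]
    _ = Ra * Rab * Rb * (Ca * Cb * Ca) := by rw [h3]; simp only [mul_assoc]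

theorem rotU_reflect_triple [NeZero m] (c : Fin (2 * m)) {a b : Fin (n + 1)}
    (hab : a.val + 1 = b.val ∨ b.val + 1 = a.val) :
    rotU c (unit n (a.val + 1)) * permU m (reflect a) *
        (rotU c (unit n (b.val + 1)) * permU m (reflect b)) *
        (rotU c (unit n (a.val + 1)) * permU m (reflect a)) =
      rotU c (unit n (a.val + 1)) * rotU c (unit n (a.val + 1) + unit n (b.val + 1)) *
        rotU c (unit n (b.val + 1)) * permU m (reflect a * reflect b * reflect a) := by
  have e1 : reflect a (unit n (b.val + 1)) = unit n (a.val + 1) + unit n (b.val + 1) := by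
    rw [reflect_unit_adj hab, add_comm]
  have e2 : reflect b (unit n (a.val + 1)) = unit n (a.val + 1) + unit n (b.val + 1) :=
    reflect_unit_adj hab.symm
  have e3 : reflect a (unit n (a.val + 1) + unit n (b.val + 1)) = unit n (b.val + 1) := by
    rw [reflGroup_add (reflect_mem a), reflect_unit_self, e1, ← add_assoc, bits_add_self,
      zero_add]
  rw [map_mul, map_mul]
  refine mul_mul_eq_of_conj ?_ ?_ ?_
  · rw [permU_mul_rotU (reflect_mem a), e1]
  · rw [permU_mul_rotU (reflect_mem b), e2]
  · rw [permU_mul_rotU (reflect_mem a), e3]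

/-- Both sides are the product of the three commuting rotations along the positive roots of the
`A₂` system spanned by the two centres, times the same Clifford part. -/
theorem genU_braid [NeZero m] {i j : Fin (n - 1)} (h : i.val + 1 = j.val) :
    genU m i * genU m j * genU m i = genU m j * genU m i * genU m j := by
  have hc : (centre i).val + 1 = (centre j).val := by simp only [centre]; omega
  have comm : ∀ {A M B : UOp n}, A * B = B * A → A * M = M * A → M * B = B * M →
      A * M * B = B * M * A := fun hAB hAM hMB => by
    rw [mul_assoc, hMB, ← mul_assoc, hAB, mul_assoc, hAM, mul_assoc]
  have h1 := rotU_reflect_triple (-genExpo m) (.inl hc)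
  have h2 := rotU_reflect_triple (-genExpo m) (.inr hc)
  rw [add_comm (unit n ((centre j).val + 1)), ← reflect_braid hc] at h2
  exact h1.trans ((congrArg (· * _) (comm (rotU_comm _ _ _ _) (rotU_comm _ _ _ _)
    (rotU_comm _ _ _ _))).trans h2.symm)

theorem genU_comm [NeZero m] {i j : Fin (n - 1)} (h : i.val + 2 ≤ j.val) :
    genU m i * genU m j = genU m j * genU m i := by
  have hc : (centre i).val + 2 ≤ (centre j).val := by simp only [centre]; omega
  have key : ∀ (c : Fin (2 * m)) (a b : Fin (n + 1)),
      ¬ (a.val + 1 = b.val ∨ b.val + 1 = a.val) →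
      rotU c (unit n (a.val + 1)) * permU m (reflect a) *
        (rotU c (unit n (b.val + 1)) * permU m (reflect b)) =
      rotU c (unit n (a.val + 1)) * rotU c (unit n (b.val + 1)) *
        permU m (reflect a * reflect b) := by
    intro c a b hab
    rw [mul_assoc, ← mul_assoc (permU m _), permU_mul_rotU (reflect_mem a), reflect_unit_far hab,
      map_mul]
    simp only [mul_assoc]
  rw [genU, genU, key _ _ _ (by omega), key _ _ _ (by omega), reflect_comm hc, rotU_comm]

/-- The qubit representation. -/
noncomputable def qubitRep (m : ℕ) [NeZero m] (n : ℕ) : BraidGroup n →* UOp n :=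
  PresentedGroup.toGroup (f := genU m) (by
    rintro r (⟨i, j, h, rfl⟩ | ⟨i, j, h, rfl⟩)
    · simp only [map_mul, map_inv, FreeGroup.lift_apply_of]
      rw [mul_inv_eq_one, genU_braid h]
    · simp only [map_mul, map_inv, FreeGroup.lift_apply_of]
      rw [mul_inv_eq_one, genU_comm h])

theorem qubitRep_gen [NeZero m] (i : Fin (n - 1)) : qubitRep m n (braidGen i) = genU m i :=
  PresentedGroup.toGroup.of _

theorem imgDesc_describes [NeZero m] (w : BraidWord n) :
    Describes (imgDesc (fun b => if b then genExpo m else -genExpo m) w)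
      (qubitRep m n (braidOf w)) := by
  have key : ∀ (d : Desc m n) (U : UOp n), Describes d U →
      Describes (w.foldl (fun d p => mulDesc d (genDesc (genMarks p.1)
        ((fun b => if b then genExpo m else -genExpo m) p.2))) d)
        (U * qubitRep m n (braidOf w)) := by
    induction w with
    | nil => intro d U h; simpa [braidOf] using h
    | cons p w ih =>
      intro d U h
      have hp : Describes (genDesc (genMarks p.1) (if p.2 then genExpo m else -genExpo m))
          (qubitRep m n (if p.2 then braidGen p.1 else (braidGen p.1)⁻¹)) := by
        cases p.2
        · have := describes_genDesc p.1 (-genExpo m)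
          rw [← genU_inv, ← qubitRep_gen, ← map_inv] at this
          exact this
        · have : Describes (genDesc (genMarks p.1) (genExpo m)) (genU m p.1) :=
            describes_genDesc p.1 (genExpo m)
          rw [← qubitRep_gen] at this
          exact this
      have h2 := ih _ _ (mulDesc_describes h hp)
      rw [mul_assoc, ← map_mul] at h2
      simpa [braidOf] using h2
  have := key _ _ (describes_one n)
  rwa [one_mul] at this

theorem genU_mem [NeZero m] (i : Fin (n - 1)) : genU m i ∈ groupGH m n :=
  (mem_groupGH_iff _).2 ⟨_, describes_genDesc i (genExpo m)⟩

theorem qubitRep_range_le (m : ℕ) [NeZero m] (n : ℕ) : (qubitRep m n).range ≤ groupGH m n := by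
  rw [MonoidHom.range_eq_map, ← PresentedGroup.closure_range_of, MonoidHom.map_closure,
    Subgroup.closure_le]
  rintro _ ⟨_, ⟨i, rfl⟩, rfl⟩
  have := qubitRep_gen (m := m) i
  rw [braidGen] at this
  rw [SetLike.mem_coe, this]
  exact genU_mem i

end QubitBraid

namespace QubitBraid

open scoped Fin.CommRing

variable {m n : ℕ}

/-! ### The matrix of a braid generator -/

/-- `R_{Y_1}` keeps the two outer bits, and their sum selects a `2 × 2` block. -/
theorem matR_apply (m : ℕ) (p q r p' q' r' : Fin 2) :
    matR m ⟨4 * p.val + 2 * q.val + r.val, by omega⟩ ⟨4 * p'.val + 2 * q'.val + r'.val, by omega⟩ =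
      if p = p' ∧ r = r' then
        if p' + r' = 0 then
          if q = q' then (if m = 3 then -1 else 1) * (Real.cos (Real.pi / m) : ℂ)
          else Complex.I * (Real.sin (Real.pi / m) : ℂ)
        else
          if q = q' then -(Complex.I * (Real.sin (Real.pi / m) : ℂ))
          else (Real.cos (Real.pi / m) : ℂ)
      else 0 := by
  unfold matR
  generalize (Real.cos (Real.pi / m) : ℂ) = c
  generalize (Real.sin (Real.pi / m) : ℂ) = s
  generalize (if m = 3 then (-1 : ℂ) else 1) = ν
  fin_cases p <;> fin_cases q <;> fin_cases r <;> fin_cases p' <;> fin_cases q' <;>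
    fin_cases r' <;> rfl

theorem genExpo_val [NeZero m] (h3 : 3 ≤ m) : (genExpo m).val = if m = 3 then 2 else 1 := by
  rw [genExpo]
  split_ifs with h
  · subst h; rfl
  · exact Nat.mod_eq_of_lt (show 1 < 2 * m by omega)

/-- For `m = 3` the exponent `2` replaces the angle `π / 3` by `π - π / 3`, which accounts for
`ν = -1`. -/
theorem cos_genExpo [NeZero m] (h3 : 3 ≤ m) : Real.cos ((genExpo m).val * (Real.pi / m)) =
    (if m = 3 then -1 else 1) * Real.cos (Real.pi / m) := by
  rw [genExpo_val h3]
  split_ifs with h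
  · subst h
    rw [neg_one_mul, ← Real.cos_pi_sub]
    congr 1
    push_cast
    ring
  · simp

theorem sin_genExpo [NeZero m] (h3 : 3 ≤ m) : Real.sin ((genExpo m).val * (Real.pi / m)) =
    Real.sin (Real.pi / m) := by
  rw [genExpo_val h3]
  split_ifs with h
  · subst h
    rw [← Real.sin_pi_sub (Real.pi / _)]
    congr 1
    push_cast
    ring
  · simp

theorem genU_apply [NeZero m] (i : Fin (n - 1)) (y x : Bits n) :
    (genU m i : Op n) y x =
      (Real.cos ((genExpo m).val * (Real.pi / m)) : ℂ) *
        (if y = addBit x (i.val + 2) (nbr x (i.val + 2)) then sgn m y * sgn m x else 0) -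
      Complex.I * (Real.sin ((genExpo m).val * (Real.pi / m)) : ℂ) *
        (if y = addBit x (i.val + 2) (nbr x (i.val + 2) + 1) then sgn m y * sgn m x else 0) := by
  have h : (genU m i : Op n) = rep m n (rot (-genExpo m) (unit n ((centre i).val + 1))) *
      signedPerm m (reflect (centre i)) := rfl
  have h1 : reflect (centre i) x = addBit x (i.val + 2) (nbr x (i.val + 2)) := rfl
  have h2 : (Equiv.addRight (unit n ((centre i).val + 1)) * reflect (centre i)) x =
      addBit x (i.val + 2) (nbr x (i.val + 2) + 1) := by
    rw [Equiv.Perm.mul_apply, h1, addBit_eq, addBit_eq, add_smul, one_smul, ← add_assoc]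
    rfl
  rw [h, rot_neg, rep_rotR, Real.cos_neg, Real.sin_neg, add_mul, smul_mul_assoc, smul_mul_assoc,
    one_mul, shift, ← signedPerm_mul, Matrix.add_apply, Matrix.smul_apply, Matrix.smul_apply,
    signedPerm, signedPerm, Matrix.of_apply, Matrix.of_apply, h1, h2, smul_eq_mul, smul_eq_mul]
  push_cast
  ring

theorem addBit_zero (x : Bits n) (j : ℕ) : addBit x j 0 = x := by
  rw [addBit_eq, zero_smul, add_zero]

theorem addBit_injective (x : Bits n) {j : ℕ} (h1 : 1 ≤ j) (h2 : j ≤ n + 1) {b b' : Fin 2} :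
    addBit x j b = addBit x j b' ↔ b = b' := by
  refine ⟨fun h => ?_, fun h => h ▸ rfl⟩
  have := congrFun h ⟨j - 1, by omega⟩
  simp only [addBit, show j - 1 + 1 = j by omega, if_true] at this
  exact add_left_cancel this

/-- The images of the braid generators are the local operators given by `R_{Y_1}`. -/
theorem coe_genU [NeZero m] (h3 : 3 ≤ m) (i : Fin (n - 1)) :
    (genU m i : Op n) = localR m n (i.val + 1) := by
  have hi := i.isLt
  have h1 : 1 ≤ i.val + 2 := by omega
  have h2 : i.val + 2 ≤ n + 1 := by omega
  ext y x
  rw [genU_apply, cos_genExpo h3, sin_genExpo h3]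
  simp only [localR, triple, Matrix.of_apply, matR_apply]
  by_cases hy : ∃ d, y = addBit x (i.val + 2) d
  · obtain ⟨d, rfl⟩ := hy
    have hb : ∀ t, t ≠ i.val + 2 → bitAt (addBit x (i.val + 2) d) t = bitAt x t := by
      intro t ht
      rw [addBit_eq, bitAt_add, bitAt_smul, bitAt_unit h1 h2, if_neg ht, mul_zero, add_zero]
    have hc : bitAt (addBit x (i.val + 2) d) (i.val + 1 + 1) = bitAt x (i.val + 2) + d := by
      rw [addBit_eq, bitAt_add, bitAt_smul, bitAt_unit h1 h2, if_pos rfl, mul_one]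
    have hn : bitAt x (i.val + 1) + bitAt x (i.val + 1 + 2) = nbr x (i.val + 2) := rfl
    have hd : (bitAt x (i.val + 2) + d = bitAt x (i.val + 1 + 1)) ↔ d = 0 := add_eq_left
    have ha : ∀ a : Fin (n + 1), a.val + 1 < i.val + 1 ∨ i.val + 1 + 2 < a.val + 1 →
        addBit x (i.val + 2) d a = x a := by
      intro a ha
      rw [addBit, if_neg (by omega)]
    rw [hb (i.val + 1) (by omega), hb (i.val + 1 + 2) (by omega), hc, hn, if_pos ha]
    · simp only [hd, addBit_injective x h1 h2, and_self, if_true]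
      have hs := sgn_addBit m x h1 h2
      have hs' := sgn_mul_self m x
      have h01 : ∀ b : Fin 2, b = 0 ∨ b = 1 := by decide
      have h11 : (1 + 1 : Fin 2) = 0 := rfl
      generalize nbr x (i.val + 2) = b at hs ⊢
      clear ha hb hc hd hn
      rcases h01 b with rfl | rfl <;> rcases h01 d with rfl | rfl <;>
        simp only [addBit_zero, hs, hs', chi_zero, chi_one, zero_add, h11, if_true,
          if_false, zero_ne_one, one_ne_zero, ite_self] <;> split_ifs <;> push_cast <;> simp [hs']
  · have hy1 : ∀ d, y ≠ addBit x (i.val + 2) d := fun d h => hy ⟨d, h⟩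
    rw [if_neg (hy1 _), if_neg (hy1 _), mul_zero, mul_zero, sub_zero]
    symm
    refine ite_eq_right_iff.2 fun ha => if_neg fun hb => hy ⟨y (centre i) + x (centre i), ?_⟩
    have hxy : ∀ p q : Fin 2, p = q + (p + q) := by decide
    have hv : (centre i).val = i.val + 1 := rfl
    funext a
    rw [addBit]
    split_ifs with h
    · rw [show centre i = a from Fin.ext (by omega)]
      exact hxy _ _
    · rcases (show a.val = i.val ∨ a.val = i.val + 2 ∨ (a.val + 1 < i.val + 1 ∨
        i.val + 1 + 2 < a.val + 1) by omega) with h' | h' | h'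
      · rw [← bitAt_succ y, ← bitAt_succ x, h']
        exact hb.1
      · rw [← bitAt_succ y, ← bitAt_succ x, h']
        exact hb.2
      · exact ha a h'

end QubitBraid

namespace QubitBraid

/-! ### Unique readability of the encoding -/

theorem replicate_append_cons_inj {α : Type*} {a b : α} (hab : a ≠ b) :
    ∀ {k k' : ℕ} {l l' : List α},
      List.replicate k a ++ b :: l = List.replicate k' a ++ b :: l' → k = k' ∧ l = l'
  | 0, 0, _, _, h => ⟨rfl, (List.cons.inj h).2⟩
  | 0, k' + 1, _, _, h => absurd (List.cons.inj h).1.symm hab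
  | k + 1, 0, _, _, h => absurd (List.cons.inj h).1 hab
  | k + 1, k' + 1, _, _, h => by
    obtain ⟨rfl, h'⟩ := replicate_append_cons_inj hab (List.cons.inj h).2
    exact ⟨rfl, h'⟩

theorem flatMap_congr_of_eq {α β : Type*} {f g : α → List β}
    (hfg : ∀ a, (f a).length = (g a).length) :
    ∀ {l : List α}, l.flatMap f = l.flatMap g → ∀ a ∈ l, f a = g a
  | [], _, _, h => absurd h List.not_mem_nil
  | x :: l, h, a, ha => by
    rw [List.flatMap_cons, List.flatMap_cons] at h
    obtain ⟨h1, h2⟩ := List.append_inj h (hfg x)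
    rcases List.mem_cons.1 ha with rfl | ha
    · exact h1
    · exact flatMap_congr_of_eq hfg h2 a ha

theorem length_flatMap_eq {α β : Type*} {f g : α → List β}
    (hfg : ∀ a, (f a).length = (g a).length) (l : List α) :
    (l.flatMap f).length = (l.flatMap g).length := by
  simp only [List.length_flatMap, hfg]

theorem encodePauli_length (m : ℕ) {n : ℕ} (P : PauliWord n) :
    (encodePauli m P).length = 2 * (n + 1) + 1 := by
  simp [encodePauli]; ring

theorem encodePauli_injective (m n : ℕ) : Function.Injective (encodePauli m (n := n)) := by
  rintro ⟨p, x, z⟩ ⟨p', x', z'⟩ h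
  obtain ⟨h1, h⟩ := List.cons.inj h
  obtain ⟨h2, h3⟩ := List.append_inj h (by simp)
  have hbit : Function.Injective (Sym.bit (m := m)) := fun _ _ => Sym.bit.inj
  obtain rfl := Sym.phase.inj h1
  obtain rfl := List.ofFn_injective (List.map_injective_iff.2 hbit h2)
  obtain rfl := List.ofFn_injective (List.map_injective_iff.2 hbit h3)
  rfl

theorem encodeDesc_injective (m : ℕ) : Function.Injective (encodeDesc m) := by
  rintro ⟨n, e, x, z⟩ ⟨n', e', x', z'⟩ h
  obtain ⟨hn, h⟩ := replicate_append_cons_inj (by simp) h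
  dsimp only at hn
  subst hn
  have hexp : Function.Injective (Sym.expo (m := m)) := fun _ _ => Sym.expo.inj
  have hP : ∀ P Q : PauliWord n, (encodePauli m P).length = (encodePauli m Q).length :=
    fun P Q => by rw [encodePauli_length, encodePauli_length]
  have he : ∀ k, ((List.ofFn (e k)).map (Sym.expo (m := m))).length =
      ((List.ofFn (e' k)).map Sym.expo).length := fun k => by simp
  obtain ⟨h, hz⟩ := List.append_inj h (by
    rw [List.length_append, List.length_append, length_flatMap_eq he,
      length_flatMap_eq fun i => hP (x i) (x' i)])
  obtain ⟨he', hx⟩ := List.append_inj h (length_flatMap_eq he _)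
  have h1 : e = e' := funext fun k => List.ofFn_injective (List.map_injective_iff.2 hexp
    (flatMap_congr_of_eq he he' k (List.mem_finRange k)))
  have h2 : x = x' := funext fun i => encodePauli_injective m n
    (flatMap_congr_of_eq (fun i => hP (x i) (x' i)) hx i (List.mem_finRange i))
  have h3 : z = z' := funext fun i => encodePauli_injective m n
    (flatMap_congr_of_eq (fun i => hP (z i) (z' i)) hz i (List.mem_finRange i))
  rw [h1, h2, h3]

end QubitBraid

theorem mainTheorem3 (m : ℕ) (hm : Odd m) (h3 : 3 ≤ m) :
    -- `G ⋊ H` is a semidirect product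
    (∀ n : ℕ, 2 ≤ n →
      QubitBraid.groupH m n ≤ Subgroup.normalizer (QubitBraid.groupG m n : Set (QubitBraid.UOp n)) ∧
      QubitBraid.groupG m n ⊓ QubitBraid.groupH m n = ⊥) ∧
    -- the elements of `G ⋊ H` are exactly what has a description, a description determines the
    -- element, the written form determines the description, and it has `O(n²)` symbols
    (∀ n : ℕ, 2 ≤ n → ∀ U : QubitBraid.UOp n,
      U ∈ QubitBraid.groupGH m n ↔ ∃ d : QubitBraid.Desc m n, QubitBraid.Describes d U) ∧
    (∀ n : ℕ, 2 ≤ n → ∀ (d : QubitBraid.Desc m n) (U U' : QubitBraid.UOp n),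
      QubitBraid.Describes d U → QubitBraid.Describes d U' → U = U') ∧
    Function.Injective (QubitBraid.encodeDesc m) ∧
    (∃ c : ℕ, ∀ (n : ℕ) (d : QubitBraid.Desc m n),
      (QubitBraid.encodeDesc m ⟨n, d⟩).length ≤ c * (n + 1) ^ 2) ∧
    -- multiplication of descriptions in polynomial time, uniformly in `n`
    (∃ mul : ∀ n : ℕ, QubitBraid.Desc m n → QubitBraid.Desc m n → QubitBraid.Desc m n,
      Nonempty (Turing.TM2ComputableInPolyTime (QubitBraid.encodePair m) (QubitBraid.encodeDesc m)
        (fun p => ⟨p.1, mul p.1 p.2.1 p.2.2⟩)) ∧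
      ∀ n : ℕ, 2 ≤ n → ∀ (d d' : QubitBraid.Desc m n) (U U' : QubitBraid.UOp n),
        QubitBraid.Describes d U → QubitBraid.Describes d' U' →
          QubitBraid.Describes (mul n d d') (U * U')) ∧
    -- the qubit representation: its image lies in `G ⋊ H`, and the image of a braid is computed
    -- in time polynomial in the number of strands and the length of the braid
    ∃ ρ : ∀ n : ℕ, QubitBraid.BraidGroup n →* QubitBraid.UOp n,
      (∀ (n : ℕ) (i : Fin (n - 1)),
        (ρ n (QubitBraid.braidGen i) : QubitBraid.Op n) = QubitBraid.localR m n (i.val + 1)) ∧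
      (∀ n : ℕ, 2 ≤ n → (ρ n).range ≤ QubitBraid.groupGH m n) ∧
      (∃ q : Polynomial ℕ, ∀ (n : ℕ) (w : QubitBraid.BraidWord n),
        (QubitBraid.encodeBraid ⟨n, w⟩).length ≤ q.eval (n + w.length)) ∧
      ∃ img : ∀ n : ℕ, QubitBraid.BraidWord n → QubitBraid.Desc m n,
        Nonempty (Turing.TM2ComputableInPolyTime QubitBraid.encodeBraid (QubitBraid.encodeDesc m)
          (fun b => ⟨b.1, img b.1 b.2⟩)) ∧
        ∀ n : ℕ, 2 ≤ n → ∀ w : QubitBraid.BraidWord n,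
          QubitBraid.Describes (img n w) (ρ n (QubitBraid.braidOf w)) := by
  have : NeZero m := ⟨by omega⟩
  refine ⟨fun n _ => ⟨QubitBraid.groupH_le_normalizer n, QubitBraid.groupG_inf_groupH n⟩,
    fun n _ U => QubitBraid.mem_groupGH_iff U,
    fun n _ d U U' => QubitBraid.describes_unique, QubitBraid.encodeDesc_injective m,
    ⟨8, fun n d => QubitBraid.encodeDesc_length_le d⟩,
    ⟨fun n => QubitBraid.mulDesc, QubitBraid.mul_computable m,
      fun n _ d d' U U' => QubitBraid.mulDesc_describes⟩,
    QubitBraid.qubitRep m, fun n i => ?_, fun n _ => QubitBraid.qubitRep_range_le m n,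
    ⟨(Polynomial.X + 1) ^ 2, fun n w => ?_⟩,
    fun n => QubitBraid.imgDesc fun b => if b then QubitBraid.genExpo m else -QubitBraid.genExpo m,
    QubitBraid.braid_computable _, fun n _ w => QubitBraid.imgDesc_describes w⟩
  · rw [QubitBraid.qubitRep_gen, QubitBraid.coe_genU h3]
  · simpa using QubitBraid.length_encodeBraid_le n w
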